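/- **Setting.** Let $K\ge 3$ be an integer and let $0\le\nu<\tfrac12$, $s>\tfrac12$, $\rho>0$, $0<\gamma\le1$, $B$, $C_0$ be real numbers. For an integer $M\ge K$, a step size $\tau>0$ and $\epsilon>0$ put $\delta=\epsilon^{1/2}$, $\omega_j=\sqrt{j^2+\rho}$, $\sigma_j=\max(|j|,1)^{2s}$, and $e(0)=2$, $e(j)=|j|$ for $0<|j|<K$, $e(j)=K$ for $|j|\ge K$. Vectors $\mathbf k=(k_0,\dots,k_M)$ have integer entries, $\mathbf k\cdot\omega=\sum_{l=0}^M k_l\omega_l$, $\mu(\mathbf k)=\sum_{l=0}^M|k_l|e(l)$, $\langle j\rangle$ is the $|j|$-th unit vector, $\operatorname{sinc}\xi=\sin\xi/\xi$, and $s_{2\mathbf k}=\sin(\tau\,\mathbf k\cdot\omega)$, $c_{2\mathbf k}=\cos(\tau\,\mathbf k\cdot\omega)$. Indices $j$ run through $\{-M,\dots,M-1\}$, residues modulo $2M$ are taken in this set, $\equiv$ is congruence modulo $2M$, and objects with index $M$ are those with index $-M$. Let $\mathcal K$ be the set of all $(j,\mathbf k)$ such that either $\max(|j|,\mu(\mathbf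 k))<2K$ and $k_l=0$ for all $l\ge K$, or $\mathbf k=\pm\langle (j-r)\bmod 2M\rangle+\bar{\mathbf k}$ for some integer $r$ and some $\bar{\mathbf k}$ with $|(j-r)\bmod 2M|\ge K$, $|r|<K$, $\mu(\bar{\mathbf k})<K$. Let $\mathcal K_j=\{\mathbf k:(j,\mathbf k)\in\mathcal K\}$ and $m(j,\mathbf k)=\max\bigl(e(j),\max_{l:k_l\ne0}e(l)\bigr)$. **Assumptions.** The filter functions $\phi,\psi:\mathbb R\to\mathbb R$ of the trigonometric integrator $\mathbf u^{n+1}-2\cos(\tau\Omega)\mathbf u^n+\mathbf u^{n-1}=\tau^2\psi(\tau\Omega)\bigl((\phi(\tau\Omega)\mathbf u^n)*(\phi(\tau\Omega)\mathbf u^n)\bigr)$ (for $\partial_{tt}u-\partial_{xx}u+\rho u=u^2$ on the torus, with $\Omega=\operatorname{diag}(\omega_j)$ and $*$ the convolution modulo $2M$) are even and bounded by $B$, with $\phi(0)=\psi(0)=1$ and $\psi=\operatorname{sinc}\cdot\phi$. The non-resonance condition holds: for both signs, $$\bigl|\sin\bigl(\tfrac12\tau(\omega_j\pm\mathbf k\cdot\omega)\bigr)\bigr|\ge\gamma\tau\epsilon^{\nu/2}\quad\text{for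 all }(j,\mathbf k)\in\mathcal K,\ \mathbf k\ne\mp\langle j\rangle,$$ $$\bigl|\sin\bigl(\tfrac12\tau(\omega_j\pm\mathbf k\cdot\omega)\bigr)\bigr|\ge\gamma\tau\quad\text{for all }(j,\mathbf k)\in\mathcal K,\ \mathbf k\ne\langle j\rangle,\ \mathbf k\ne-\langle j\rangle,\ |j|\le K.$$ The initial data $(u^0_j),(\dot u^0_j)$ are Fourier coefficients of trigonometric polynomials that are real in the collocation points ($u^0_{-j}=\overline{u^0_j}$, $\dot u^0_{-j}=\overline{\dot u^0_j}$, $u^0_M=u^0_{-M}$, $\dot u^0_M=\dot u^0_{-M}$), and their mode energies $E^0_l=\tfrac12|\omega_lu^0_l|^2+\tfrac12|\dot u^0_l|^2$ satisfy $$\sum_{l=0}^M\sigma_l\epsilon^{-e(l)}E^0_l\le C_0.$$ **Modulation functions.** Polynomials $z^{\mathbf k}_{j,m}$, $(j,\mathbf k)\in\mathcal K$, are constructed consecutively for $m=1,\dots,2K-1$. Put $z^{\mathbf k}_{j,m}=0$ for $m<m(j,\mathbf k)$. Otherwise let $$p=\tau^2\psi(\tau\omega_j)\sum_{j_1+j_2\equiv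 j}\ \sum_{\mathbf k^1+\mathbf k^2=\mathbf k}\delta^{2(m(j_1,\mathbf k^1)+m(j_2,\mathbf k^2)-m(j,\mathbf k))\nu}\sum_{m_1+m_2=m}\phi(\tau\omega_{j_1})z^{\mathbf k^1}_{j_1,m_1}\,\phi(\tau\omega_{j_2})z^{\mathbf k^2}_{j_2,m_2}$$ ($\mathbf k^i\in\mathcal K_{j_i}$, $m_i\ge1$), let $\alpha_0=4\sin(\tfrac\tau2(\omega_j-\mathbf k\cdot\omega))\sin(\tfrac\tau2(\omega_j+\mathbf k\cdot\omega))$, and for $l\ge1$ let $-\alpha_l=\frac{(\tau\delta^\nu)^l}{l!}\,\beta_l$ with $\beta_l=2\mathrm i\,s_{2\mathbf k}$ for odd $l$ and $\beta_l=2c_{2\mathbf k}$ for even $l$. For $\mathbf k\ne\pm\langle j\rangle$, $z=z^{\mathbf k}_{j,m}$ is the polynomial solution of $\alpha_0z-\alpha_1z'-\alpha_2z''-\dots=p$, namely $z=\sum_{n=0}^{\deg p}\bigl(\sum_{l\ge1}\frac{\alpha_l}{\alpha_0}\frac{d^l}{ds^l}\bigr)^n\frac1{\alpha_0}p$. For $\mathbf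 k=\pm\langle j\rangle$ (where $\alpha_0=0$), $z=z^{\mathbf k}_{j,m}$ has the derivative $z'=\sum_{n=0}^{\deg p}\bigl(\sum_{l\ge1}\frac{\alpha_{l+1}}{\alpha_1}\frac{d^l}{ds^l}\bigr)^n\frac{(-1)^{n+1}}{\alpha_1}p$ and the initial value determined by $$\begin{aligned}2\mathrm i\omega_jz^{\pm\langle j\rangle}_{j,m}(0)={}&-\mathrm i\sum_{\mathbf k\in\mathcal K_j,\ \mathbf k\ne\langle j\rangle,-\langle j\rangle}\delta^{2(m(j,\mathbf k)-e(j))\nu}\Bigl(\omega_j\pm(\mathbf k\cdot\omega)\frac{\operatorname{sinc}(\tau(\mathbf k\cdot\omega))}{\operatorname{sinc}(\tau\omega_j)}\Bigr)z^{\mathbf k}_{j,m}(0)\\&\mp\sum_{\mathbf k\in\mathcal K_j}\frac{\delta^{2(m(j,\mathbf k)-e(j))\nu}}{\operatorname{sinc}(\tau\omega_j)}\sum_{q\ge1}\frac{\tau^{q-1}\delta^{q\nu}}{q!}\,\theta_q\,\frac{d^qz^{\mathbf k}_{j,m}}{ds^q}(0)+\begin{cases}\delta^{-e(j)}(\mathrm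 i\omega_ju^0_j\pm\dot u^0_j),&m=e(j),\\0,&\text{else,}\end{cases}\end{aligned}$$ with $\theta_q=c_{2\mathbf k}$ for odd $q$ and $\theta_q=\mathrm i\,s_{2\mathbf k}$ for even $q$. The modulation functions are $z^{\mathbf k}_j=\delta^{m(j,\mathbf k)}\sum_{m=m(j,\mathbf k)}^{2K-1}\delta^{(m-m(j,\mathbf k))(1-2\nu)}z^{\mathbf k}_{j,m}$, and the discrete almost-invariant energies are, for $l=0,\dots,M$, $$\mathcal E_l(t)=-\frac{\mathrm i}2\sum_{j=-M}^{M-1}\sum_{\mathbf k\in\mathcal K_j}\frac{k_l\omega_l}{\tau\operatorname{sinc}(\tau\omega_j)}\,z^{-\mathbf k}_{-j}(\epsilon^{\nu/2}t)\,\mathrm e^{\mathrm i(\mathbf k\cdot\omega)\tau}\,z^{\mathbf k}_j(\epsilon^{\nu/2}(t+\tau)).$$ **Theorem.** There are $\epsilon_0>0$ and $\mathcal C_0>0$, depending only on $K,\nu,s,\rho,\gamma,B$ and $C_0$, such that for all $M\ge K$, $\tau>0$, $0<\epsilon\le\epsilon_0$, all filter functions and all initial data that satisfy the assumptions above, $$\sum_{l=0}^M\sigma_l\,\epsilon^{-e(l)}\,|\mathcal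 E_l(t)|\le\mathcal C_0\qquad\text{for }0\le t\le1.$$ In particular $\mathcal C_0$ is independent of $\epsilon$, $\tau$ and $M$ and depends on the initial data only through $C_0$. -/

import Mathlib

noncomputable section

namespace TrigInt

open Finset Polynomial

/-! ### Frequencies, weights and the energy profile -/

/-- The frequencies `ω_j = √(j² + ρ)`. -/
def freq (ρ : ℝ) (j : ℤ) : ℝ := Real.sqrt ((j : ℝ) ^ 2 + ρ)

/-- The Sobolev weights `σ_j = max(|j|, 1)^{2s}`. -/
def weight (s : ℝ) (j : ℤ) : ℝ := (max |(j : ℝ)| 1) ^ (2 * s)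

/-- The energy profile: `e(0) = 2`, `e(j) = |j|` for `0 < |j| < K`, `e(j) = K` for `|j| ≥ K`. -/
def profile (K : ℕ) (j : ℤ) : ℕ :=
  if j = 0 then 2 else if j.natAbs < K then j.natAbs else K

/-- The spatial modes `-M, …, M-1`. -/
def modes (M : ℕ) : Finset ℤ := Finset.Ico (-(M : ℤ)) (M : ℤ)

/-- The mode energy `E_j` belonging to the Fourier coefficients `u_j` (position) and
`v_j` (velocity). -/
def modeEnergy (ρ : ℝ) (u v : ℤ → ℂ) (j : ℤ) : ℝ :=
  1 / 2 * ‖(freq ρ j : ℂ) * u j‖ ^ 2 + 1 / 2 * ‖v j‖ ^ 2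

/-- `u_{-M}, …, u_{M-1}`, extended by `u_M = u_{-M}`, are the Fourier coefficients of a
trigonometric polynomial that takes real values in the collocation points `π k / M`. -/
def RealValued (M : ℕ) (u : ℤ → ℂ) : Prop :=
  u (M : ℤ) = u (-(M : ℤ)) ∧
    ∀ j : ℤ, -(M : ℤ) ≤ j → j ≤ (M : ℤ) → u (-j) = (starRingEnd ℂ) (u j)

/-! ### The index set -/

/-- The linear combination `k · ω = ∑_{l=0}^M k_l ω_l`. -/
def dotFreq {M : ℕ} (ρ : ℝ) (k : Fin (M + 1) → ℤ) : ℝ :=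
  ∑ l : Fin (M + 1), (k l : ℝ) * freq ρ ((l : ℕ) : ℤ)

/-- The vector `⟨j⟩`: the `|j|`-th unit vector (entries are numbered from `0` to `M`). -/
def unitVec (M : ℕ) (j : ℤ) : Fin (M + 1) → ℤ :=
  fun l => if (l : ℕ) = j.natAbs then 1 else 0

/-- `μ(k) = ∑_{l=0}^M |k_l| e(l)`. -/
def mu {M : ℕ} (K : ℕ) (k : Fin (M + 1) → ℤ) : ℕ :=
  ∑ l : Fin (M + 1), (k l).natAbs * profile K ((l : ℕ) : ℤ)

/-- The set `𝒦_j` of all `k` with `(j, k) ∈ 𝒦`, for a mode `j ∈ {-M, …, M-1}`. The residue of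
`j - r` modulo `2M` is the one in `{-M, …, M-1}`, which is `Int.bmod (j - r) (2 * M)`. -/
def indexSet (M K : ℕ) (j : ℤ) : Set (Fin (M + 1) → ℤ) :=
  {k | max j.natAbs (mu K k) < 2 * K ∧ ∀ l : Fin (M + 1), K ≤ (l : ℕ) → k l = 0} ∪
  {k | ∃ (r : ℤ) (k' : Fin (M + 1) → ℤ),
      K ≤ (Int.bmod (j - r) (2 * M)).natAbs ∧ r.natAbs < K ∧ mu K k' < K ∧
      (k = unitVec M (Int.bmod (j - r) (2 * M)) + k' ∨
        k = -unitVec M (Int.bmod (j - r) (2 * M)) + k')}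

theorem natAbs_le_mu {M K : ℕ} (hK : 0 < K) (k : Fin (M + 1) → ℤ) (l : Fin (M + 1)) :
    (k l).natAbs ≤ mu K k := by
  have h1 : 1 ≤ profile K ((l : ℕ) : ℤ) := by
    unfold profile
    split_ifs with h0 h
    · norm_num
    · omega
    · omega
  calc (k l).natAbs ≤ (k l).natAbs * profile K ((l : ℕ) : ℤ) := Nat.le_mul_of_pos_right _ h1
    _ ≤ mu K k := Finset.single_le_sum
        (f := fun l : Fin (M + 1) => (k l).natAbs * profile K ((l : ℕ) : ℤ))
        (fun _ _ => Nat.zero_le _) (Finset.mem_univ l)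

theorem indexSet_finite (M K : ℕ) (j : ℤ) : (indexSet M K j).Finite := by
  apply (Set.finite_Icc (fun _ : Fin (M + 1) => -(2 * K : ℤ)) (fun _ => (2 * K : ℤ))).subset
  have key : ∀ k ∈ indexSet M K j, ∀ l, (k l).natAbs ≤ 2 * K := by
    rintro k (⟨hk, -⟩ | ⟨r, k', -, hr, hk', h⟩) l
    · have := natAbs_le_mu (K := K) (by omega) k l
      omega
    · have h1 := natAbs_le_mu (K := K) (by omega) k' l
      have h2 : (unitVec M (Int.bmod (j - r) (2 * M)) l).natAbs ≤ 1 := by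
        unfold unitVec
        split_ifs <;> simp
      rcases h with h | h <;> rw [h] <;> simp only [Pi.add_apply, Pi.neg_apply] <;> omega
  intro k hk
  constructor <;> intro l <;> have := key k hk l <;> simp only <;> omega

/-- `𝒦_j` as a finite set. -/
def indices (M K : ℕ) (j : ℤ) : Finset (Fin (M + 1) → ℤ) := (indexSet_finite M K j).toFinset

/-- `m(j, k) = max(e(j), max_{l : k_l ≠ 0} e(l))`. -/
def order {M : ℕ} (K : ℕ) (j : ℤ) (k : Fin (M + 1) → ℤ) : ℕ :=
  max (profile K j)
    ((Finset.univ.filter fun l => k l ≠ 0).sup fun l => profile K ((l : ℕ) : ℤ))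

/-! ### Non-resonance condition and filter functions -/

/-- The non-resonance condition with constant `γ`: the weak bound for all `(j, k) ∈ 𝒦` and the
strong bound for `|j| ≤ K`, each of them for both signs. -/
def NonResonant (M K : ℕ) (ρ ν γ ε τ : ℝ) : Prop :=
  (∀ j ∈ modes M, ∀ k ∈ indexSet M K j,
    (k ≠ -unitVec M j →
      γ * τ * ε ^ (ν / 2) ≤ |Real.sin (1 / 2 * τ * (freq ρ j + dotFreq ρ k))|) ∧
    (k ≠ unitVec M j →
      γ * τ * ε ^ (ν / 2) ≤ |Real.sin (1 / 2 * τ * (freq ρ j - dotFreq ρ k))|)) ∧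
  (∀ j ∈ modes M, ∀ k ∈ indexSet M K j, k ≠ unitVec M j → k ≠ -unitVec M j → j.natAbs ≤ K →
    γ * τ ≤ |Real.sin (1 / 2 * τ * (freq ρ j + dotFreq ρ k))| ∧
    γ * τ ≤ |Real.sin (1 / 2 * τ * (freq ρ j - dotFreq ρ k))|)

/-- Admissible filter functions of a symplectic trigonometric integrator: `φ` and `ψ` are even
with value `1` at `0`, bounded by `B`, and `ψ = sinc · φ`. -/
structure IsSymplecticFilter (B : ℝ) (φ ψ : ℝ → ℝ) : Prop where
  even_phi : ∀ ξ, φ (-ξ) = φ ξ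
  even_psi : ∀ ξ, ψ (-ξ) = ψ ξ
  phi_zero : φ 0 = 1
  psi_zero : ψ 0 = 1
  bound_phi : ∀ ξ, |φ ξ| ≤ B
  bound_psi : ∀ ξ, |ψ ξ| ≤ B
  symplectic : ∀ ξ, ψ ξ = Real.sinc ξ * φ ξ

/-! ### Construction of the modulation functions -/

/-- The parameters of the equation, of the method and of the expansion. -/
structure Scheme where
  M : ℕ
  K : ℕ
  ρ : ℝ
  ν : ℝ
  ε : ℝ
  τ : ℝ
  φ : ℝ → ℝ
  ψ : ℝ → ℝ

namespace Scheme

variable (S : Scheme)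

/-- Frequency vectors `k = (k_0, …, k_M)`. -/
abbrev Vec : Type := Fin (S.M + 1) → ℤ

/-- `δ = ε^{1/2}`. -/
def δ : ℝ := Real.sqrt S.ε

/-- `ω_j`. -/
def ω (j : ℤ) : ℝ := freq S.ρ j

/-- `m(j, k)`. -/
def ord (j : ℤ) (k : S.Vec) : ℕ := order S.K j k

/-- `s_{2k} = sin(τ (k · ω))`. -/
def s2 (k : S.Vec) : ℝ := Real.sin (S.τ * dotFreq S.ρ k)

/-- `c_{2k} = cos(τ (k · ω))`. -/
def c2 (k : S.Vec) : ℝ := Real.cos (S.τ * dotFreq S.ρ k)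

/-- The coefficients in
`α₀ z - α₁ z' - α₂ z'' - ⋯ = e^{i(k·ω)τ} z(s + δ^ν τ) - 2 cos(τ ω_j) z(s) + e^{-i(k·ω)τ} z(s - δ^ν τ)`,
that is `α₀ = 4 sin(τ(ω_j - k·ω)/2) sin(τ(ω_j + k·ω)/2)` and, for `l ≥ 1`, `-α_l` is
`2 i s_{2k} (τ δ^ν)^l / l!` for odd `l` and `2 c_{2k} (τ δ^ν)^l / l!` for even `l`. -/
def α (j : ℤ) (k : S.Vec) (l : ℕ) : ℂ :=
  if l = 0 then
    ((4 * Real.sin (S.τ / 2 * (S.ω j - dotFreq S.ρ k))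
      * Real.sin (S.τ / 2 * (S.ω j + dotFreq S.ρ k)) : ℝ) : ℂ)
  else
    -(((S.τ * S.δ ^ S.ν) ^ l / (l.factorial : ℝ) : ℝ) : ℂ) *
      (if Odd l then 2 * Complex.I * (S.s2 k : ℂ) else 2 * (S.c2 k : ℂ))

/-- The right-hand side of the equation for `z_{j,m}^k`, formed with the functions
`z m' j' k' = z_{j',m'}^{k'}`, `1 ≤ m' < m`. -/
def rhs (z : ℕ → ℤ → S.Vec → ℂ[X]) (m : ℕ) (j : ℤ) (k : S.Vec) : ℂ[X] :=
  C ((S.τ ^ 2 * S.ψ (S.τ * S.ω j) : ℝ) : ℂ) *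
    ∑ q ∈ (modes S.M ×ˢ modes S.M).filter (fun q => q.1 + q.2 ≡ j [ZMOD 2 * (S.M : ℤ)]),
      ∑ κ ∈ (indices S.M S.K q.1 ×ˢ indices S.M S.K q.2).filter (fun κ => κ.1 + κ.2 = k),
        C ((S.δ ^ (2 * ((S.ord q.1 κ.1 : ℝ) + (S.ord q.2 κ.2 : ℝ) - (S.ord j k : ℝ)) * S.ν)
            : ℝ) : ℂ) *
          ∑ a ∈ Finset.Ico 1 m,
            (C (S.φ (S.τ * S.ω q.1) : ℂ) * z a q.1 κ.1) *
              (C (S.φ (S.τ * S.ω q.2) : ℂ) * z (m - a) q.2 κ.2)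

/-- The polynomial solution `z` of `α₀ z - α₁ z' - α₂ z'' - ⋯ = p` (used for `α₀ ≠ 0`).
Derivatives of order above the degree of `p` do not contribute. -/
def solveOff (a : ℕ → ℂ) (p : ℂ[X]) : ℂ[X] :=
  ∑ n ∈ Finset.range (p.natDegree + 1),
    ((∑ l ∈ Finset.Icc 1 p.natDegree,
        (a l / a 0) • (Polynomial.derivative : ℂ[X] →ₗ[ℂ] ℂ[X]) ^ l) ^ n)
      (C (1 / a 0) * p)

/-- The polynomial solution `z'` of `- α₁ z' - α₂ z'' - ⋯ = p` (used for `α₁ ≠ 0`). -/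
def solveDiag (a : ℕ → ℂ) (p : ℂ[X]) : ℂ[X] :=
  ∑ n ∈ Finset.range (p.natDegree + 1),
    ((∑ l ∈ Finset.Icc 1 p.natDegree,
        (a (l + 1) / a 1) • (Polynomial.derivative : ℂ[X] →ₗ[ℂ] ℂ[X]) ^ l) ^ n)
      (C ((-1) ^ (n + 1) / a 1) * p)

/-- The antiderivative of a polynomial that vanishes at `0`. -/
def antideriv (p : ℂ[X]) : ℂ[X] :=
  p.sum fun n c => Polynomial.monomial (n + 1) (c / ((n : ℂ) + 1))

/-- The off-diagonal coefficient function `z_{j,m}^k`, `k ≠ ±⟨j⟩`; it is zero for `m < m(j, k)`. -/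
def offDiag (z : ℕ → ℤ → S.Vec → ℂ[X]) (m : ℕ) (j : ℤ) (k : S.Vec) : ℂ[X] :=
  if m < S.ord j k then 0 else solveOff (S.α j k) (S.rhs z m j k)

/-- The derivative of the coefficient function `z_{j,m}^k`, off-diagonal or diagonal. -/
def slope (z : ℕ → ℤ → S.Vec → ℂ[X]) (m : ℕ) (j : ℤ) (k : S.Vec) : ℂ[X] :=
  if k = unitVec S.M j ∨ k = -unitVec S.M j then
    if m < S.ord j k then 0 else solveDiag (S.α j k) (S.rhs z m j k)
  else Polynomial.derivative (S.offDiag z m j k)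

/-- The sum `δ^ν c_{2k} z'(0) + (i/2) τ δ^{2ν} s_{2k} z''(0) + ⋯` for `z = z_{j,m}^k`: the `p`-th
derivative has the factor `τ^{p-1} δ^{pν} / p!` times `c_{2k}` (odd `p`) or `i s_{2k}`
(even `p`). -/
def slopeSum (z : ℕ → ℤ → S.Vec → ℂ[X]) (m : ℕ) (j : ℤ) (k : S.Vec) : ℂ :=
  ∑ p ∈ Finset.Icc 1 ((S.slope z m j k).natDegree + 1),
    ((S.τ ^ (p - 1) * (S.δ ^ S.ν) ^ p / (p.factorial : ℝ) : ℝ) : ℂ) *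
      (if Odd p then (S.c2 k : ℂ) else Complex.I * (S.s2 k : ℂ)) *
      (Polynomial.derivative^[p - 1] (S.slope z m j k)).eval 0

/-- The initial value of the diagonal coefficient function `z_{j,m}^{±⟨j⟩}`, where `sg = ±1` is
the sign and `u`, `v` are the initial position and velocity. -/
def diagInit (u v : ℤ → ℂ) (z : ℕ → ℤ → S.Vec → ℂ[X]) (m : ℕ) (j : ℤ) (sg : ℝ) : ℂ :=
  (2 * Complex.I * (S.ω j : ℂ))⁻¹ *
    (- Complex.I * ∑ k ∈ (indices S.M S.K j).filter
          (fun k => k ≠ unitVec S.M j ∧ k ≠ -unitVec S.M j),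
        ((S.δ ^ (2 * ((S.ord j k : ℝ) - (profile S.K j : ℝ)) * S.ν) : ℝ) : ℂ) *
        ((S.ω j + sg * dotFreq S.ρ k *
            (Real.sinc (S.τ * dotFreq S.ρ k) / Real.sinc (S.τ * S.ω j)) : ℝ) : ℂ) *
        (S.offDiag z m j k).eval 0
      - (sg : ℂ) * ∑ k ∈ indices S.M S.K j,
        ((S.δ ^ (2 * ((S.ord j k : ℝ) - (profile S.K j : ℝ)) * S.ν) /
            Real.sinc (S.τ * S.ω j) : ℝ) : ℂ) * S.slopeSum z m j k
      + (if m = profile S.K j then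
          (((S.δ ^ profile S.K j)⁻¹ : ℝ) : ℂ) *
            (Complex.I * (S.ω j : ℂ) * u j + (sg : ℂ) * v j)
        else 0))

/-- One step of the construction: `z_{j,m}^k` from the functions `z_{j',m'}^{k'}`, `m' < m`. -/
def step (u v : ℤ → ℂ) (z : ℕ → ℤ → S.Vec → ℂ[X]) (m : ℕ) (j : ℤ) (k : S.Vec) : ℂ[X] :=
  if k = unitVec S.M j then
    if m < S.ord j k then 0 else C (S.diagInit u v z m j 1) + antideriv (S.slope z m j k)
  else if k = -unitVec S.M j then
    if m < S.ord j k then 0 else C (S.diagInit u v z m j (-1)) + antideriv (S.slope z m j k)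
  else S.offDiag z m j k

/-- The modulation coefficient functions `z_{j,m}^k`, constructed consecutively in `m` from the
initial data `u`, `v`; only those with `(j, k) ∈ 𝒦` and `1 ≤ m ≤ 2K - 1` are ever used. -/
def modCoeff (u v : ℤ → ℂ) (m : ℕ) : ℤ → S.Vec → ℂ[X] :=
  S.step u v (fun m' => if _h : m' < m then modCoeff u v m' else 0) m
termination_by m

/-- The modulation functions
`z_j^k = δ^{m(j,k)} ∑_{m = m(j,k)}^{2K-1} δ^{(m - m(j,k))(1-2ν)} z_{j,m}^k`, polynomials in the
slow time. -/
def modFun (u v : ℤ → ℂ) (j : ℤ) (k : S.Vec) : ℂ[X] :=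
  C ((S.δ ^ S.ord j k : ℝ) : ℂ) *
    ∑ m ∈ Finset.Icc (S.ord j k) (2 * S.K - 1),
      C ((S.δ ^ (((m : ℝ) - (S.ord j k : ℝ)) * (1 - 2 * S.ν)) : ℝ) : ℂ) * S.modCoeff u v m j k

/-- The discrete almost-invariant energies `ℰ_l(t)`, `l = 0, …, M`. The mode `-j` is taken
modulo `2M` in `{-M, …, M-1}`, in accordance with `z_M^k = z_{-M}^k`. -/
def almostInvariant (u v : ℤ → ℂ) (l : Fin (S.M + 1)) (t : ℝ) : ℂ :=
  -(Complex.I / 2) * ∑ j ∈ modes S.M, ∑ k ∈ indices S.M S.K j,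
    (((k l : ℝ) * S.ω ((l : ℕ) : ℤ) / (S.τ * Real.sinc (S.τ * S.ω j)) : ℝ) : ℂ) *
      (S.modFun u v (Int.bmod (-j) (2 * S.M)) (-k)).eval ((S.ε ^ (S.ν / 2) * t : ℝ) : ℂ) *
      Complex.exp (Complex.I * ((dotFreq S.ρ k * S.τ : ℝ) : ℂ)) *
      (S.modFun u v j k).eval ((S.ε ^ (S.ν / 2) * (t + S.τ) : ℝ) : ℂ)

end Scheme

end TrigInt

end

/-! Everything constructed is a polynomial whose degree is bounded in terms of K, so the sum of the
moduli of the coefficients (`coeffNorm`) controls products, derivatives and values on bounded sets.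
The theorem combines a uniform weighted ℓ² bound for the coefficient functions z_{j,m}^k with a
bound of ℰ_l by a quadratic expression in them.

The obstacle is the denominators: α₀, α₁ and sinc(τω_j) can all be small. Three mechanisms
compensate for them. The identity ψ = sinc · φ puts a factor sinc(τω_j) into the right-hand side
(`coeffNorm_rhs_le`). The loss δ^ν in the weak non-resonance condition is needed only for |j| > K
and on the diagonal k = ±⟨j⟩, and there m(j,k) is strictly smaller than the sum of the orders of the
two factors, so that the right-hand side carries δ^{2ν} (`exists_small_denominator`,
`order_lt_order_add_of_unitVec`). Finally |sin(a ± b)| times a common lower bound of |sin a|, |sin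
b| is at most 2 |sin a| |sin b| (`abs_sin_add_mul_le`), so a numerator sin(τω_j) or s_{2k} cancels
one of the two sines in α₀.

Therefore `size` can afford the weights ω_j, |s_{2k}|/(τ|sinc(τω_j)|) and, on the derivative,
1/|sinc(τω_j)|. These are the weights that occur in the initial values of the diagonal functions and
in ℰ_l. Estimating one step (`offDiag_bound`, `slope_diag_bound`, `ω_mul_norm_diagInit_le`) and
summing over k leaves a convolution inequality in j alone (`modeSize_le`). Weighted ℓ² is an algebra
because s > 1/2 (`weightedSq_conv_le`), and induction on m gives bounds independent of ε, τ and M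
(`exists_weightedSq_modeSize_le`).

In ℰ_l the prefactor 1/(τ sinc(τω_j)) looks dangerous. Freezing the slow time and replacing
e^{i(k·ω)τ} by its cosine gives a term that is odd under (j,k) ↦ (-j,-k), because of the factor k_l,
so these terms sum to zero. What remains contains s_{2k} or a difference of z over a slow time step,
both controlled by `size` (`norm_almostInvariant_le`). If k_l ≠ 0, then l ≤ |j| + K and e(l) ≤
m(j,k): hence σ_l and ω_l are bounded by multiples of σ_j and ω_j, and ε^{-e(l)} is absorbed by
δ^{2m(j,k)}. Since ∑_l |k_l| ≤ 2K, summation over l costs no power of M. -/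

noncomputable section

namespace TrigInt

open Finset Polynomial

/-! ### The coefficient norm of polynomials -/

/-- The sum of the absolute values of the coefficients of a polynomial. -/
def coeffNorm (p : ℂ[X]) : ℝ := p.sum fun _ c => ‖c‖

theorem coeffNorm_eq_sum_range {p : ℂ[X]} {n : ℕ} (h : p.natDegree < n) :
    coeffNorm p = ∑ i ∈ range n, ‖p.coeff i‖ :=
  Polynomial.sum_over_range' p (fun _ => norm_zero) n h

theorem coeffNorm_nonneg (p : ℂ[X]) : 0 ≤ coeffNorm p :=
  Finset.sum_nonneg fun _ _ => norm_nonneg _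

@[simp] theorem coeffNorm_zero : coeffNorm 0 = 0 := by simp [coeffNorm]

@[simp] theorem coeffNorm_C (c : ℂ) : coeffNorm (C c) = ‖c‖ := by simp [coeffNorm]

theorem coeffNorm_add_le (p q : ℂ[X]) : coeffNorm (p + q) ≤ coeffNorm p + coeffNorm q := by
  have h1 : (p + q).natDegree < max p.natDegree q.natDegree + 1 :=
    Nat.lt_succ_of_le (natDegree_add_le p q)
  rw [coeffNorm_eq_sum_range h1,
    coeffNorm_eq_sum_range (Nat.lt_succ_of_le (le_max_left p.natDegree q.natDegree)),
    coeffNorm_eq_sum_range (Nat.lt_succ_of_le (le_max_right p.natDegree q.natDegree)),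
    ← Finset.sum_add_distrib]
  exact Finset.sum_le_sum fun i _ => by rw [coeff_add]; exact norm_add_le _ _

theorem coeffNorm_sum_le {ι : Type*} (t : Finset ι) (f : ι → ℂ[X]) :
    coeffNorm (∑ i ∈ t, f i) ≤ ∑ i ∈ t, coeffNorm (f i) := by
  classical
  induction t using Finset.induction_on with
  | empty => simp
  | insert a t ha ih =>
    rw [Finset.sum_insert ha, Finset.sum_insert ha]
    exact (coeffNorm_add_le _ _).trans (by gcongr)

theorem coeffNorm_monomial_mul (n : ℕ) (c : ℂ) (p : ℂ[X]) :
    coeffNorm (monomial n c * p) = ‖c‖ * coeffNorm p := by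
  have hd : (monomial n c * p).natDegree < n + (p.natDegree + 1) := by
    have h1 := natDegree_mul_le (p := monomial n c) (q := p)
    have h2 := natDegree_monomial_le c (m := n)
    omega
  rw [coeffNorm_eq_sum_range hd, coeffNorm_eq_sum_range (Nat.lt_succ_self p.natDegree),
    Finset.sum_range_add, Finset.mul_sum, Finset.sum_eq_zero, zero_add]
  · refine Finset.sum_congr rfl fun i _ => ?_
    rw [add_comm n i, coeff_monomial_mul, norm_mul]
  · intro i hi
    rw [← C_mul_X_pow_eq_monomial, mul_assoc, coeff_C_mul, coeff_X_pow_mul',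
      if_neg (by have := Finset.mem_range.1 hi; omega), mul_zero, norm_zero]

theorem coeffNorm_C_mul (c : ℂ) (p : ℂ[X]) : coeffNorm (C c * p) = ‖c‖ * coeffNorm p := by
  rw [← monomial_zero_left, coeffNorm_monomial_mul]

theorem coeffNorm_smul (c : ℂ) (p : ℂ[X]) : coeffNorm (c • p) = ‖c‖ * coeffNorm p := by
  rw [smul_eq_C_mul, coeffNorm_C_mul]

theorem coeffNorm_mul_le (p q : ℂ[X]) : coeffNorm (p * q) ≤ coeffNorm p * coeffNorm q := by
  conv_lhs => rw [p.as_sum_support, Finset.sum_mul]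
  refine (coeffNorm_sum_le _ _).trans (le_of_eq ?_)
  simp_rw [coeffNorm_monomial_mul]
  rw [← Finset.sum_mul]
  rfl

theorem coeffNorm_derivative_le {p : ℂ[X]} {D : ℕ} (h : p.natDegree ≤ D) :
    coeffNorm (derivative p) ≤ D * coeffNorm p := by
  have h1 : (derivative p).natDegree < D + 1 := by
    have := natDegree_derivative_le p
    omega
  -- The range for `p` is one longer than its degree requires, so that splitting off the constant
  -- term pairs coefficient i of the derivative with coefficient i + 1 of `p`.
  rw [coeffNorm_eq_sum_range h1, coeffNorm_eq_sum_range (show p.natDegree < D + 1 + 1 by omega),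
    Finset.sum_range_succ' _ (D + 1), mul_add, Finset.mul_sum]
  refine le_add_of_le_of_nonneg (Finset.sum_le_sum fun i hi => ?_) (by positivity)
  rw [coeff_derivative, norm_mul]
  rcases Nat.lt_or_ge i D with hiD | hiD
  · have h2 : ‖((i : ℂ) + 1)‖ ≤ D := by
      rw [show ((i : ℂ) + 1) = ((i + 1 : ℕ) : ℂ) by push_cast; rfl, Complex.norm_natCast]
      exact_mod_cast hiD
    rw [mul_comm]
    gcongr
  · rw [coeff_eq_zero_of_natDegree_lt (show p.natDegree < i + 1 by omega)]
    simp

theorem natDegree_iterate_derivative_le {p : ℂ[X]} {D : ℕ} (h : p.natDegree ≤ D) (l : ℕ) :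
    (derivative^[l] p).natDegree ≤ D :=
  (natDegree_iterate_derivative p l).trans (by omega)

theorem coeffNorm_iterate_derivative_le {p : ℂ[X]} {D : ℕ} (h : p.natDegree ≤ D) (l : ℕ) :
    coeffNorm (derivative^[l] p) ≤ (D : ℝ) ^ l * coeffNorm p := by
  induction l with
  | zero => simp
  | succ l ih =>
    rw [Function.iterate_succ_apply', pow_succ', mul_assoc]
    exact (coeffNorm_derivative_le (natDegree_iterate_derivative_le h l)).trans (by gcongr)

theorem norm_eval_le {p : ℂ[X]} {D : ℕ} (h : p.natDegree ≤ D) {R : ℝ} (hR : 1 ≤ R) {x : ℂ}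
    (hx : ‖x‖ ≤ R) : ‖p.eval x‖ ≤ R ^ D * coeffNorm p := by
  rw [eval_eq_sum_range' (Nat.lt_succ_of_le h), coeffNorm_eq_sum_range (Nat.lt_succ_of_le h),
    Finset.mul_sum]
  refine (norm_sum_le _ _).trans (Finset.sum_le_sum fun i hi => ?_)
  have hi' : i ≤ D := Nat.lt_succ_iff.1 (Finset.mem_range.1 hi)
  rw [norm_mul, norm_pow, mul_comm]
  gcongr
  exact (pow_le_pow_left₀ (norm_nonneg _) hx i).trans (pow_le_pow_right₀ hR hi')

theorem norm_eval_zero_le (p : ℂ[X]) : ‖p.eval 0‖ ≤ coeffNorm p := by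
  simpa using norm_eval_le (le_refl p.natDegree) le_rfl (x := 0) (by simp)

theorem norm_pow_sub_pow_le {R : ℝ} {x y : ℂ} (hx : ‖x‖ ≤ R) (hy : ‖y‖ ≤ R) (n : ℕ) :
    ‖x ^ (n + 1) - y ^ (n + 1)‖ ≤ ‖x - y‖ * ((n + 1) * R ^ n) := by
  have hR : 0 ≤ R := (norm_nonneg x).trans hx
  rw [← (Commute.all x y).mul_geom_sum₂, norm_mul]
  gcongr
  refine (norm_sum_le _ _).trans ?_
  refine (Finset.sum_le_card_nsmul _ _ (R ^ n) fun i hi => ?_).trans (by simp)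
  have hi' : i < n + 1 := Finset.mem_range.1 hi
  rw [norm_mul, norm_pow, norm_pow]
  calc ‖x‖ ^ i * ‖y‖ ^ (n + 1 - 1 - i) ≤ R ^ i * R ^ (n + 1 - 1 - i) := by gcongr
    _ = R ^ n := by rw [← pow_add]; congr 1; omega

/-- A mean value estimate with the derivative on the right: differences over a time step are to be
charged to the derivative term of `size`. -/
theorem norm_eval_sub_eval_le {p : ℂ[X]} {D : ℕ} (h : p.natDegree ≤ D) {R : ℝ} (hR : 1 ≤ R)
    {x y : ℂ} (hx : ‖x‖ ≤ R) (hy : ‖y‖ ≤ R) :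
    ‖p.eval x - p.eval y‖ ≤ ‖x - y‖ * (R ^ D * coeffNorm (derivative p)) := by
  have h1 : (derivative p).natDegree < D + 1 := by
    have := natDegree_derivative_le p
    omega
  rw [eval_eq_sum_range' (show p.natDegree < D + 1 + 1 by omega),
    eval_eq_sum_range' (show p.natDegree < D + 1 + 1 by omega), ← Finset.sum_sub_distrib,
    coeffNorm_eq_sum_range h1, Finset.mul_sum, Finset.mul_sum, Finset.sum_range_succ']
  simp only [pow_zero, sub_self, add_zero]
  refine (norm_sum_le _ _).trans (Finset.sum_le_sum fun i hi => ?_)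
  have hi' : i ≤ D := Nat.lt_succ_iff.1 (Finset.mem_range.1 hi)
  rw [← mul_sub, norm_mul, coeff_derivative, norm_mul,
    show ((i : ℂ) + 1) = ((i + 1 : ℕ) : ℂ) by push_cast; rfl, Complex.norm_natCast]
  have h2 := norm_pow_sub_pow_le hx hy i
  have h3 : R ^ i ≤ R ^ D := pow_le_pow_right₀ hR hi'
  calc ‖p.coeff (i + 1)‖ * ‖x ^ (i + 1) - y ^ (i + 1)‖
      ≤ ‖p.coeff (i + 1)‖ * (‖x - y‖ * ((i + 1) * R ^ D)) := by
        gcongr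
        exact h2.trans (by gcongr)
    _ = _ := by push_cast; ring

/-! ### The polynomial solutions -/

/-- A bound for the norm of `∑ b_l ∂^l` on polynomials of degree at most `D`, if `|b_l| ≤ A`. -/
def diffOpBound (A : ℝ) (D : ℕ) : ℝ := 1 + D * (A * ((D : ℝ) + 1) ^ D)

/-- A bound for the norm of the solution operators on polynomials of degree at most `D`. -/
def solveBound (A : ℝ) (D : ℕ) : ℝ := (D + 1) * diffOpBound A D ^ D

theorem one_le_diffOpBound {A : ℝ} (hA : 0 ≤ A) (D : ℕ) : 1 ≤ diffOpBound A D := by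
  unfold diffOpBound
  have : 0 ≤ D * (A * ((D : ℝ) + 1) ^ D) := by positivity
  linarith

theorem solveBound_nonneg {A : ℝ} (hA : 0 ≤ A) (D : ℕ) : 0 ≤ solveBound A D := by
  have := one_le_diffOpBound hA D
  unfold solveBound
  positivity

/-- The differential operator `∑_{l=1}^d b_l ∂^l`. -/
def diffOp (b : ℕ → ℂ) (d : ℕ) : ℂ[X] →ₗ[ℂ] ℂ[X] :=
  ∑ l ∈ Finset.Icc 1 d, b l • (Polynomial.derivative : ℂ[X] →ₗ[ℂ] ℂ[X]) ^ l

theorem diffOp_apply (b : ℕ → ℂ) (d : ℕ) (q : ℂ[X]) :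
    diffOp b d q = ∑ l ∈ Finset.Icc 1 d, b l • derivative^[l] q := by
  simp [diffOp, LinearMap.sum_apply, Module.End.pow_apply]

theorem natDegree_diffOp_le (b : ℕ → ℂ) (d : ℕ) {q : ℂ[X]} {D : ℕ} (h : q.natDegree ≤ D) :
    (diffOp b d q).natDegree ≤ D := by
  rw [diffOp_apply]
  exact natDegree_sum_le_of_forall_le _ _ fun l _ =>
    (natDegree_smul_le _ _).trans (natDegree_iterate_derivative_le h l)

theorem coeffNorm_diffOp_le {b : ℕ → ℂ} {A : ℝ} {d D : ℕ} (hA : 0 ≤ A)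
    (hb : ∀ l ∈ Finset.Icc 1 d, ‖b l‖ ≤ A) (hd : d ≤ D) {q : ℂ[X]} (h : q.natDegree ≤ D) :
    coeffNorm (diffOp b d q) ≤ diffOpBound A D * coeffNorm q := by
  rw [diffOp_apply]
  have hq := coeffNorm_nonneg q
  calc coeffNorm (∑ l ∈ Finset.Icc 1 d, b l • derivative^[l] q)
      ≤ ∑ l ∈ Finset.Icc 1 d, coeffNorm (b l • derivative^[l] q) := coeffNorm_sum_le _ _
    _ ≤ ∑ l ∈ Finset.Icc 1 d, A * ((D : ℝ) + 1) ^ D * coeffNorm q := by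
        refine Finset.sum_le_sum fun l hl => ?_
        have hl' := Finset.mem_Icc.1 hl
        rw [coeffNorm_smul, mul_assoc]
        have h1 : coeffNorm (derivative^[l] q) ≤ ((D : ℝ) + 1) ^ D * coeffNorm q :=
          (coeffNorm_iterate_derivative_le h l).trans (by
            gcongr
            calc (D : ℝ) ^ l ≤ ((D : ℝ) + 1) ^ l := by gcongr; linarith
              _ ≤ ((D : ℝ) + 1) ^ D := pow_le_pow_right₀ (by simp) (by omega))
        exact mul_le_mul (hb l hl) h1 (coeffNorm_nonneg _) hA
    _ = d * (A * ((D : ℝ) + 1) ^ D * coeffNorm q) := by simp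
    _ ≤ D * (A * ((D : ℝ) + 1) ^ D * coeffNorm q) := by gcongr
    _ ≤ diffOpBound A D * coeffNorm q := by unfold diffOpBound; nlinarith

theorem natDegree_diffOp_pow_le (b : ℕ → ℂ) (d : ℕ) {q : ℂ[X]} {D : ℕ} (h : q.natDegree ≤ D)
    (n : ℕ) : ((diffOp b d ^ n) q).natDegree ≤ D := by
  induction n with
  | zero => simpa using h
  | succ n ih =>
    rw [pow_succ', Module.End.mul_apply]
    exact natDegree_diffOp_le b d ih

theorem coeffNorm_diffOp_pow_le {b : ℕ → ℂ} {A : ℝ} {d D : ℕ} (hA : 0 ≤ A)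
    (hb : ∀ l ∈ Finset.Icc 1 d, ‖b l‖ ≤ A) (hd : d ≤ D) {q : ℂ[X]} (h : q.natDegree ≤ D) (n : ℕ) :
    coeffNorm ((diffOp b d ^ n) q) ≤ diffOpBound A D ^ n * coeffNorm q := by
  induction n with
  | zero => simp
  | succ n ih =>
    rw [pow_succ', Module.End.mul_apply, pow_succ', mul_assoc]
    have := one_le_diffOpBound hA D
    exact (coeffNorm_diffOp_le hA hb hd (natDegree_diffOp_pow_le b d h n)).trans
      (mul_le_mul_of_nonneg_left ih (by linarith))

theorem natDegree_neumann_le (b c : ℕ → ℂ) (d : ℕ) {D : ℕ} {p : ℂ[X]} (h : p.natDegree ≤ D) :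
    (∑ n ∈ Finset.range (d + 1), (diffOp b d ^ n) (C (c n) * p)).natDegree ≤ D :=
  natDegree_sum_le_of_forall_le _ _ fun n _ =>
    natDegree_diffOp_pow_le b d ((natDegree_C_mul_le _ _).trans h) n

/-- Common form of both polynomial solvers. The n-dependent factors `c n` accommodate the
alternating sign in `solveDiag`; `d` is the actual degree, at which the series is truncated, and `D`
an a priori bound that makes the constant uniform. -/
theorem coeffNorm_neumann_le {b c : ℕ → ℂ} {A g : ℝ} {d D : ℕ} (hA : 0 ≤ A)
    (hb : ∀ l ∈ Finset.Icc 1 d, ‖b l‖ ≤ A) (hc : ∀ n, ‖c n‖ ≤ g) (hd : d ≤ D) {p : ℂ[X]}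
    (h : p.natDegree ≤ D) :
    coeffNorm (∑ n ∈ Finset.range (d + 1), (diffOp b d ^ n) (C (c n) * p)) ≤
      solveBound A D * (g * coeffNorm p) := by
  have hg : 0 ≤ g := (norm_nonneg _).trans (hc 0)
  have hp := coeffNorm_nonneg p
  have h1 : ∀ n, (C (c n) * p).natDegree ≤ D := fun n => (natDegree_C_mul_le _ _).trans h
  have h2 := one_le_diffOpBound hA D
  calc _ ≤ ∑ n ∈ Finset.range (d + 1), coeffNorm ((diffOp b d ^ n) (C (c n) * p)) :=
        coeffNorm_sum_le _ _
    _ ≤ ∑ n ∈ Finset.range (d + 1), diffOpBound A D ^ D * (g * coeffNorm p) := by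
        refine Finset.sum_le_sum fun n hn => (coeffNorm_diffOp_pow_le hA hb hd (h1 n) n).trans ?_
        have hn' := Finset.mem_range.1 hn
        rw [coeffNorm_C_mul]
        have := hc n
        have h3 : diffOpBound A D ^ n ≤ diffOpBound A D ^ D := pow_le_pow_right₀ h2 (by omega)
        gcongr
    _ = (d + 1) * (diffOpBound A D ^ D * (g * coeffNorm p)) := by simp
    _ ≤ (D + 1) * (diffOpBound A D ^ D * (g * coeffNorm p)) := by gcongr
    _ = _ := by unfold solveBound; ring

theorem natDegree_solveOff_le (a : ℕ → ℂ) {p : ℂ[X]} {D : ℕ} (h : p.natDegree ≤ D) :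
    (Scheme.solveOff a p).natDegree ≤ D :=
  natDegree_neumann_le (fun l => a l / a 0) (fun _ => 1 / a 0) _ h

theorem natDegree_solveDiag_le (a : ℕ → ℂ) {p : ℂ[X]} {D : ℕ} (h : p.natDegree ≤ D) :
    (Scheme.solveDiag a p).natDegree ≤ D :=
  natDegree_neumann_le (fun l => a (l + 1) / a 1) (fun n => (-1) ^ (n + 1) / a 1) _ h

theorem coeffNorm_solveOff_le {a : ℕ → ℂ} {A g : ℝ} {D : ℕ} {p : ℂ[X]} (hA : 0 ≤ A)
    (h : p.natDegree ≤ D) (ha : ∀ l, 1 ≤ l → l ≤ D → ‖a l / a 0‖ ≤ A) (hg : ‖1 / a 0‖ ≤ g) :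
    coeffNorm (Scheme.solveOff a p) ≤ solveBound A D * (g * coeffNorm p) :=
  coeffNorm_neumann_le (b := fun l => a l / a 0) (c := fun _ => 1 / a 0) hA
    (fun l hl => ha l (Finset.mem_Icc.1 hl).1 ((Finset.mem_Icc.1 hl).2.trans h)) (fun _ => hg) h h

theorem coeffNorm_solveDiag_le {a : ℕ → ℂ} {A g : ℝ} {D : ℕ} {p : ℂ[X]} (hA : 0 ≤ A)
    (h : p.natDegree ≤ D) (ha : ∀ l, 1 ≤ l → l ≤ D → ‖a (l + 1) / a 1‖ ≤ A) (hg : ‖1 / a 1‖ ≤ g) :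
    coeffNorm (Scheme.solveDiag a p) ≤ solveBound A D * (g * coeffNorm p) :=
  coeffNorm_neumann_le (b := fun l => a (l + 1) / a 1) (c := fun n => (-1) ^ (n + 1) / a 1) hA
    (fun l hl => ha l (Finset.mem_Icc.1 hl).1 ((Finset.mem_Icc.1 hl).2.trans h))
    (fun n => by simpa using hg) h h

theorem natDegree_antideriv_le (p : ℂ[X]) : (Scheme.antideriv p).natDegree ≤ p.natDegree + 1 := by
  unfold Scheme.antideriv Polynomial.sum
  exact natDegree_sum_le_of_forall_le _ _ fun n hn =>
    (natDegree_monomial_le _).trans (by have := le_natDegree_of_mem_supp n hn; omega)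

theorem coeffNorm_antideriv_le (p : ℂ[X]) : coeffNorm (Scheme.antideriv p) ≤ coeffNorm p := by
  unfold Scheme.antideriv Polynomial.sum
  refine (coeffNorm_sum_le _ _).trans (Finset.sum_le_sum fun n _ => ?_)
  have h1 : coeffNorm (monomial (n + 1) (p.coeff n / ((n : ℂ) + 1))) =
      ‖p.coeff n / ((n : ℂ) + 1)‖ := by
    rw [← mul_one (monomial _ _), coeffNorm_monomial_mul, ← C_1, coeffNorm_C, norm_one, mul_one]
  rw [h1, norm_div, show ((n : ℂ) + 1) = ((n + 1 : ℕ) : ℂ) by push_cast; rfl, Complex.norm_natCast]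
  exact div_le_self (norm_nonneg _) (by simp)

theorem derivative_antideriv (p : ℂ[X]) : derivative (Scheme.antideriv p) = p := by
  unfold Scheme.antideriv Polynomial.sum
  conv_rhs => rw [p.as_sum_support]
  rw [derivative_sum]
  refine Finset.sum_congr rfl fun n _ => ?_
  rw [derivative_monomial]
  congr 1
  have : (n : ℂ) + 1 ≠ 0 := by exact_mod_cast Nat.succ_ne_zero n
  push_cast
  field_simp

/-! ### Weighted convolution -/

theorem weight_pos (s : ℝ) (j : ℤ) : 0 < weight s j :=
  Real.rpow_pos_of_pos (lt_max_of_lt_right one_pos) _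

theorem weight_nonneg (s : ℝ) (j : ℤ) : 0 ≤ weight s j := (weight_pos s j).le

theorem weight_eq_of_natAbs_eq (s : ℝ) {i j : ℤ} (h : i.natAbs = j.natAbs) :
    weight s i = weight s j := by
  have : |(i : ℝ)| = |(j : ℝ)| := by
    rw [← Int.cast_abs, ← Int.cast_abs, Int.abs_eq_natAbs, Int.abs_eq_natAbs, h]
  unfold weight
  rw [this]

theorem abs_cast_eq_natAbs (j : ℤ) : |(j : ℝ)| = (j.natAbs : ℝ) := by
  rw [← Int.cast_abs, Int.abs_eq_natAbs, Int.cast_natCast]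

theorem weight_le_of_natAbs_le_add {s : ℝ} (hs : 0 ≤ s) {l j : ℤ} {K : ℕ}
    (h : l.natAbs ≤ j.natAbs + K) : weight s l ≤ ((K : ℝ) + 1) ^ (2 * s) * weight s j := by
  unfold weight
  rw [← Real.mul_rpow (by positivity) (by positivity)]
  apply Real.rpow_le_rpow (by positivity) _ (by linarith)
  have h1 : |(l : ℝ)| ≤ |(j : ℝ)| + K := by
    rw [abs_cast_eq_natAbs, abs_cast_eq_natAbs]
    exact_mod_cast h
  have h2 := le_max_left |(j : ℝ)| 1
  have h3 := le_max_right |(j : ℝ)| 1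
  have hK : (0 : ℝ) ≤ K := by positivity
  apply max_le <;> nlinarith

/-- The representative in {-M, …, M-1} has least modulus in its residue class, so aliasing never
raises a mode number. -/
theorem natAbs_le_of_modEq {M : ℕ} {j n : ℤ} (hj : j ∈ modes M) (h : n ≡ j [ZMOD 2 * (M : ℤ)]) :
    j.natAbs ≤ n.natAbs := by
  obtain ⟨hj1, hj2⟩ := Finset.mem_Ico.1 hj
  obtain ⟨c, hc⟩ := h.dvd
  rcases lt_trichotomy c 0 with h0 | h0 | h0
  · have : 2 * (M : ℤ) * c ≤ 2 * M * (-1) := by gcongr; omega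
    omega
  · subst h0; simp at hc; omega
  · have : 2 * (M : ℤ) * 1 ≤ 2 * M * c := by gcongr; omega
    omega

theorem eq_of_modEq {M : ℕ} {i j : ℤ} (hi : i ∈ modes M) (hj : j ∈ modes M)
    (h : i ≡ j [ZMOD 2 * (M : ℤ)]) : i = j := by
  obtain ⟨hj1, hj2⟩ := Finset.mem_Ico.1 hj
  obtain ⟨hi1, hi2⟩ := Finset.mem_Ico.1 hi
  obtain ⟨c, hc⟩ := h.dvd
  rcases lt_trichotomy c 0 with h0 | h0 | h0
  · have : 2 * (M : ℤ) * c ≤ 2 * M * (-1) := by gcongr; omega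
    omega
  · subst h0; simp at hc; omega
  · have : 2 * (M : ℤ) * 1 ≤ 2 * M * c := by gcongr; omega
    omega

/-- The pairs of modes that contribute to the mode `j` of a convolution. -/
def convPairs (M : ℕ) (j : ℤ) : Finset (ℤ × ℤ) :=
  (modes M ×ˢ modes M).filter (fun q => q.1 + q.2 ≡ j [ZMOD 2 * (M : ℤ)])

theorem mem_convPairs {M : ℕ} {j : ℤ} {q : ℤ × ℤ} : q ∈ convPairs M j ↔
    (q.1 ∈ modes M ∧ q.2 ∈ modes M) ∧ q.1 + q.2 ≡ j [ZMOD 2 * (M : ℤ)] := by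
  simp [convPairs]

/-- Since |j| ≤ |j₁| + |j₂|, the larger of the two modes has at least half the modulus of j. -/
theorem weight_le_of_mem_convPairs {M : ℕ} {s : ℝ} (hs : 0 ≤ s) {j : ℤ} (hj : j ∈ modes M)
    {q : ℤ × ℤ} (hq : q ∈ convPairs M j) :
    weight s j ≤ 2 ^ (2 * s) * (weight s q.1 + weight s q.2) := by
  have h1 : |(j : ℝ)| ≤ |(q.1 : ℝ)| + |(q.2 : ℝ)| := by
    have := natAbs_le_of_modEq hj (mem_convPairs.1 hq).2
    have h2 := Int.natAbs_add_le q.1 q.2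
    simp only [abs_cast_eq_natAbs]
    exact_mod_cast this.trans h2
  set x := max |(q.1 : ℝ)| 1 with hx
  set y := max |(q.2 : ℝ)| 1 with hy
  have hx1 : 1 ≤ x := le_max_right _ _
  have hy1 : 1 ≤ y := le_max_right _ _
  have hx2 : |(q.1 : ℝ)| ≤ x := le_max_left _ _
  have hy2 : |(q.2 : ℝ)| ≤ y := le_max_left _ _
  have hxw : weight s q.1 = x ^ (2 * s) := rfl
  have hyw : weight s q.2 = y ^ (2 * s) := rfl
  have h0 : (0 : ℝ) ≤ 2 ^ (2 * s) := by positivity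
  have px : 0 ≤ x ^ (2 * s) := by positivity
  have py : 0 ≤ y ^ (2 * s) := by positivity
  rw [hxw, hyw]
  rcases le_total x y with h | h
  · calc weight s j ≤ (2 * y) ^ (2 * s) :=
        Real.rpow_le_rpow (by positivity) (max_le (by linarith) (by linarith)) (by linarith)
      _ = 2 ^ (2 * s) * y ^ (2 * s) := Real.mul_rpow (by norm_num) (by linarith)
      _ ≤ _ := by gcongr; linarith
  · calc weight s j ≤ (2 * x) ^ (2 * s) :=
        Real.rpow_le_rpow (by positivity) (max_le (by linarith) (by linarith)) (by linarith)
      _ = 2 ^ (2 * s) * x ^ (2 * s) := Real.mul_rpow (by norm_num) (by linarith)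
      _ ≤ _ := by gcongr; linarith

theorem summable_weight_inv {s : ℝ} (hs : 1 / 2 < s) : Summable fun j : ℤ => (weight s j)⁻¹ := by
  have h := (Real.summable_abs_int_rpow (b := 2 * s) (by linarith))
  refine Summable.of_norm_bounded_eventually h ?_
  have : ∀ᶠ j : ℤ in Filter.cofinite, j ≠ 0 := by
    simpa using (Set.finite_singleton (0 : ℤ)).compl_mem_cofinite
  filter_upwards [this] with j hj
  have h1 : (1 : ℝ) ≤ |(j : ℝ)| := by exact_mod_cast Int.one_le_abs hj
  rw [Real.norm_of_nonneg (inv_nonneg.2 (weight_nonneg s j)), weight, max_eq_left h1,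
    ← Real.rpow_neg (abs_nonneg _)]

/-- The constant of the convolution estimate. -/
def convConst (s : ℝ) : ℝ := 2 * 2 ^ (2 * s) * ∑' j : ℤ, (weight s j)⁻¹

theorem convConst_nonneg (s : ℝ) : 0 ≤ convConst s :=
  mul_nonneg (by positivity) (tsum_nonneg fun j => inv_nonneg.2 (weight_nonneg s j))

/-- The square of the weighted `ℓ²` norm. -/
def weightedSq (s : ℝ) (M : ℕ) (f : ℤ → ℝ) : ℝ := ∑ j ∈ modes M, weight s j * f j ^ 2

theorem weightedSq_nonneg (s : ℝ) (M : ℕ) (f : ℤ → ℝ) : 0 ≤ weightedSq s M f :=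
  Finset.sum_nonneg fun j _ => mul_nonneg (weight_nonneg s j) (sq_nonneg _)

theorem weightedSq_mono {s : ℝ} {M : ℕ} {f g : ℤ → ℝ} (h0 : ∀ j ∈ modes M, 0 ≤ f j)
    (h : ∀ j ∈ modes M, f j ≤ g j) : weightedSq s M f ≤ weightedSq s M g :=
  Finset.sum_le_sum fun j hj => mul_le_mul_of_nonneg_left
    (pow_le_pow_left₀ (h0 j hj) (h j hj) 2) (weight_nonneg s j)

theorem weightedSq_const_mul (s : ℝ) (M : ℕ) (c : ℝ) (f : ℤ → ℝ) :
    weightedSq s M (fun j => c * f j) = c ^ 2 * weightedSq s M f := by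
  unfold weightedSq
  rw [Finset.mul_sum]
  exact Finset.sum_congr rfl fun j _ => by ring

theorem weightedSq_add_le (s : ℝ) (M : ℕ) (f g : ℤ → ℝ) :
    weightedSq s M (fun j => f j + g j) ≤ 2 * (weightedSq s M f + weightedSq s M g) := by
  unfold weightedSq
  rw [← Finset.sum_add_distrib, Finset.mul_sum]
  refine Finset.sum_le_sum fun j _ => ?_
  have := mul_nonneg (weight_nonneg s j) (sq_nonneg (f j - g j))
  nlinarith

theorem weightedSq_sum_le {ι : Type*} (s : ℝ) (M : ℕ) (t : Finset ι) (f : ι → ℤ → ℝ) :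
    weightedSq s M (fun j => ∑ a ∈ t, f a j) ≤ #t * ∑ a ∈ t, weightedSq s M (f a) := by
  unfold weightedSq
  rw [Finset.sum_comm, Finset.mul_sum]
  refine Finset.sum_le_sum fun j _ => ?_
  rw [← Finset.mul_sum, mul_left_comm]
  exact mul_le_mul_of_nonneg_left sq_sum_le_card_mul_sum_sq (weight_nonneg s j)

/-- Weighted `ℓ²` is an algebra under convolution, uniformly in the number of modes. -/
theorem weightedSq_conv_le {s : ℝ} (hs : 1 / 2 < s) (M : ℕ) (f g : ℤ → ℝ) :
    weightedSq s M (fun j => ∑ q ∈ convPairs M j, f q.1 * g q.2) ≤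
      convConst s * (weightedSq s M f * weightedSq s M g) := by
  have hS : ∀ (t : Finset ℤ), ∑ i ∈ t, (weight s i)⁻¹ ≤ ∑' j : ℤ, (weight s j)⁻¹ := fun t =>
    (summable_weight_inv hs).sum_le_tsum t fun j _ => inv_nonneg.2 (weight_nonneg s j)
  set S := ∑' j : ℤ, (weight s j)⁻¹ with hSdef
  -- One component of a contributing pair determines the other modulo 2M. Sums over pairs of a
  -- function of one component are therefore bounded by the full series.
  have inj1 : ∀ j, Set.InjOn Prod.fst (convPairs M j : Set (ℤ × ℤ)) := by
    intro j p hp q hq h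
    have hp' := mem_convPairs.1 hp
    have hq' := mem_convPairs.1 hq
    have : p.2 ≡ q.2 [ZMOD 2 * (M : ℤ)] := by
      have h1 := hp'.2.trans hq'.2.symm
      rw [h] at h1
      exact Int.ModEq.add_left_cancel' _ h1
    exact Prod.ext h (eq_of_modEq hp'.1.2 hq'.1.2 this)
  have inj2 : ∀ j, Set.InjOn Prod.snd (convPairs M j : Set (ℤ × ℤ)) := by
    intro j p hp q hq h
    have hp' := mem_convPairs.1 hp
    have hq' := mem_convPairs.1 hq
    have : p.1 ≡ q.1 [ZMOD 2 * (M : ℤ)] := by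
      have h1 := hp'.2.trans hq'.2.symm
      rw [h] at h1
      exact Int.ModEq.add_right_cancel' _ h1
    exact Prod.ext (eq_of_modEq hp'.1.1 hq'.1.1 this) h
  have hsum : ∀ j ∈ modes M,
      ∑ q ∈ convPairs M j, weight s j * ((weight s q.1)⁻¹ * (weight s q.2)⁻¹) ≤ convConst s := by
    intro j hj
    calc _ ≤ ∑ q ∈ convPairs M j, 2 ^ (2 * s) * ((weight s q.1)⁻¹ + (weight s q.2)⁻¹) := by
          refine Finset.sum_le_sum fun q hq => ?_
          have h1 := weight_pos s q.1
          have h2 := weight_pos s q.2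
          calc weight s j * ((weight s q.1)⁻¹ * (weight s q.2)⁻¹)
              ≤ 2 ^ (2 * s) * (weight s q.1 + weight s q.2) *
                ((weight s q.1)⁻¹ * (weight s q.2)⁻¹) := by
                gcongr
                exact weight_le_of_mem_convPairs (by linarith) hj hq
            _ = _ := by field_simp; ring
      _ = 2 ^ (2 * s) * (∑ q ∈ convPairs M j, (weight s q.1)⁻¹ +
            ∑ q ∈ convPairs M j, (weight s q.2)⁻¹) := by
          rw [← Finset.sum_add_distrib, Finset.mul_sum]
      _ ≤ 2 ^ (2 * s) * (S + S) := by
          gcongr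
          · rw [← Finset.sum_image (f := fun i => (weight s i)⁻¹) (inj1 j)]
            exact hS _
          · rw [← Finset.sum_image (f := fun i => (weight s i)⁻¹) (inj2 j)]
            exact hS _
      _ = convConst s := by unfold convConst; ring
  have key : ∀ j ∈ modes M, weight s j * (∑ q ∈ convPairs M j, f q.1 * g q.2) ^ 2 ≤
      convConst s * ∑ q ∈ convPairs M j, (weight s q.1 * f q.1 ^ 2) * (weight s q.2 * g q.2 ^ 2) := by
    intro j hj
    -- Cauchy–Schwarz after multiplying and dividing by the weights of both factors; the inverse
    -- weights, times σ_j, sum to at most `convConst s`.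
    have cs := Finset.sum_sq_le_sum_mul_sum_of_sq_le_mul (convPairs M j)
      (r := fun q => f q.1 * g q.2)
      (f := fun q => (weight s q.1)⁻¹ * (weight s q.2)⁻¹)
      (g := fun q => (weight s q.1 * f q.1 ^ 2) * (weight s q.2 * g q.2 ^ 2))
      (fun q _ => mul_nonneg (inv_nonneg.2 (weight_nonneg _ _)) (inv_nonneg.2 (weight_nonneg _ _)))
      (fun q _ => mul_nonneg (mul_nonneg (weight_nonneg _ _) (sq_nonneg _))
        (mul_nonneg (weight_nonneg _ _) (sq_nonneg _)))
      (fun q _ => by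
        have h1 := (weight_pos s q.1).ne'
        have h2 := (weight_pos s q.2).ne'
        refine le_of_eq ?_
        field_simp)
    refine (mul_le_mul_of_nonneg_left cs (weight_nonneg s j)).trans ?_
    rw [← mul_assoc, Finset.mul_sum _ _ (weight s j)]
    exact mul_le_mul_of_nonneg_right (hsum j hj) (Finset.sum_nonneg fun q _ =>
      mul_nonneg (mul_nonneg (weight_nonneg _ _) (sq_nonneg _))
        (mul_nonneg (weight_nonneg _ _) (sq_nonneg _)))
  calc weightedSq s M (fun j => ∑ q ∈ convPairs M j, f q.1 * g q.2)
      ≤ ∑ j ∈ modes M, convConst s *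
        ∑ q ∈ convPairs M j, (weight s q.1 * f q.1 ^ 2) * (weight s q.2 * g q.2 ^ 2) :=
        Finset.sum_le_sum key
    _ = convConst s * ∑ q ∈ modes M ×ˢ modes M,
          ∑ j ∈ (modes M).filter (fun j => q.1 + q.2 ≡ j [ZMOD 2 * (M : ℤ)]),
          (weight s q.1 * f q.1 ^ 2) * (weight s q.2 * g q.2 ^ 2) := by
        rw [← Finset.mul_sum]
        congr 1
        apply Finset.sum_comm'
        intro j q
        simp only [mem_convPairs, Finset.mem_product, Finset.mem_filter]
        tauto
    _ ≤ convConst s * ∑ q ∈ modes M ×ˢ modes M,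
          (weight s q.1 * f q.1 ^ 2) * (weight s q.2 * g q.2 ^ 2) := by
        refine mul_le_mul_of_nonneg_left (Finset.sum_le_sum fun q _ => ?_) (convConst_nonneg s)
        rw [Finset.sum_const, nsmul_eq_mul]
        refine mul_le_of_le_one_left (mul_nonneg (mul_nonneg (weight_nonneg _ _) (sq_nonneg _))
          (mul_nonneg (weight_nonneg _ _) (sq_nonneg _))) ?_
        -- A pair feeds exactly one residue class, hence at most one mode.
        have : #((modes M).filter fun j => q.1 + q.2 ≡ j [ZMOD 2 * (M : ℤ)]) ≤ 1 := by
          refine Finset.card_le_one.2 fun a ha b hb => ?_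
          have ha' := Finset.mem_filter.1 ha
          have hb' := Finset.mem_filter.1 hb
          exact eq_of_modEq ha'.1 hb'.1 (ha'.2.symm.trans hb'.2)
        exact_mod_cast this
    _ = _ := by
        unfold weightedSq
        rw [Finset.sum_mul_sum, Finset.sum_product]

theorem sum_weight_mul_le (s : ℝ) (M : ℕ) (f g : ℤ → ℝ) :
    ∑ j ∈ modes M, weight s j * (f j * g j) ≤ weightedSq s M f + weightedSq s M g := by
  unfold weightedSq
  rw [← Finset.sum_add_distrib]
  refine Finset.sum_le_sum fun j _ => ?_
  have h1 := mul_nonneg (weight_nonneg s j) (sq_nonneg (f j - g j))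
  have h2 := mul_nonneg (weight_nonneg s j) (add_nonneg (sq_nonneg (f j)) (sq_nonneg (g j)))
  nlinarith

/-! ### Frequencies and the energy profile -/

theorem freq_pos {ρ : ℝ} (hρ : 0 < ρ) (j : ℤ) : 0 < freq ρ j :=
  Real.sqrt_pos.2 (by positivity)

theorem sqrt_le_freq (ρ : ℝ) (j : ℤ) : Real.sqrt ρ ≤ freq ρ j :=
  Real.sqrt_le_sqrt (by nlinarith [sq_nonneg (j : ℝ)])

theorem freq_eq_of_natAbs_eq (ρ : ℝ) {i j : ℤ} (h : i.natAbs = j.natAbs) :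
    freq ρ i = freq ρ j := by
  unfold freq
  rw [← sq_abs (i : ℝ), ← sq_abs (j : ℝ), abs_cast_eq_natAbs, abs_cast_eq_natAbs, h]

/-- The constant in the comparison of frequencies of neighbouring modes. -/
def freqConst (ρ : ℝ) (K : ℕ) : ℝ := Real.sqrt (2 + 2 * K ^ 2 / ρ)

theorem freq_le_of_natAbs_le_add {ρ : ℝ} (hρ : 0 < ρ) {l j : ℤ} {K : ℕ}
    (h : l.natAbs ≤ j.natAbs + K) : freq ρ l ≤ freqConst ρ K * freq ρ j := by
  unfold freq freqConst
  rw [← Real.sqrt_mul (by positivity)]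
  apply Real.sqrt_le_sqrt
  have h1 : |(l : ℝ)| ≤ |(j : ℝ)| + K := by
    rw [abs_cast_eq_natAbs, abs_cast_eq_natAbs]
    exact_mod_cast h
  have h2 : (l : ℝ) ^ 2 ≤ (|(j : ℝ)| + K) ^ 2 := by
    rw [← sq_abs (l : ℝ)]
    gcongr
  have h3 : (j : ℝ) ^ 2 = |(j : ℝ)| ^ 2 := (sq_abs _).symm
  have h4 : (2 + 2 * (K : ℝ) ^ 2 / ρ) * ((j : ℝ) ^ 2 + ρ) =
      2 * (j : ℝ) ^ 2 + 2 * ρ + 2 * K ^ 2 + 2 * K ^ 2 / ρ * (j : ℝ) ^ 2 := by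
    field_simp
    ring
  have h5 : 0 ≤ 2 * (K : ℝ) ^ 2 / ρ * (j : ℝ) ^ 2 := by positivity
  rw [h4]
  -- This is (|j| + K)² ≤ 2j² + 2K²; the term 2K² is the product of 2K²/ρ with ρ.
  nlinarith [sq_nonneg (|(j : ℝ)| - K)]

theorem profile_pos {K : ℕ} (hK : 0 < K) (j : ℤ) : 1 ≤ profile K j := by
  unfold profile
  split_ifs <;> omega

theorem profile_le {K : ℕ} (hK : 2 ≤ K) (j : ℤ) : profile K j ≤ K := by
  unfold profile
  split_ifs <;> omega

theorem profile_eq_of_natAbs_eq (K : ℕ) {i j : ℤ} (h : i.natAbs = j.natAbs) :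
    profile K i = profile K j := by
  unfold profile
  have : i = 0 ↔ j = 0 := by omega
  simp only [this, h]

theorem profile_le_order {M : ℕ} (K : ℕ) (j : ℤ) (k : Fin (M + 1) → ℤ) :
    profile K j ≤ order K j k := le_max_left _ _

theorem profile_le_order_of_ne_zero {M : ℕ} (K : ℕ) (j : ℤ) {k : Fin (M + 1) → ℤ}
    {l : Fin (M + 1)} (h : k l ≠ 0) : profile K ((l : ℕ) : ℤ) ≤ order K j k :=
  le_max_of_le_right
    (Finset.le_sup (f := fun l : Fin (M + 1) => profile K ((l : ℕ) : ℤ)) (by simpa using h))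

theorem order_le {M : ℕ} {K : ℕ} (hK : 2 ≤ K) (j : ℤ) (k : Fin (M + 1) → ℤ) : order K j k ≤ K :=
  max_le (profile_le hK j) (Finset.sup_le fun _ _ => profile_le hK _)

theorem order_le_iff {M K : ℕ} {j : ℤ} {k : Fin (M + 1) → ℤ} {n : ℕ} : order K j k ≤ n ↔
    profile K j ≤ n ∧ ∀ l, k l ≠ 0 → profile K ((l : ℕ) : ℤ) ≤ n := by
  simp [order]

/-- Subadditivity of the energy profile along convolutions. -/
theorem profile_le_add_of_mem_convPairs {M K : ℕ} (hK : 2 ≤ K) {j : ℤ} (hj : j ∈ modes M)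
    {q : ℤ × ℤ} (hq : q ∈ convPairs M j) : profile K j ≤ profile K q.1 + profile K q.2 := by
  have h1 := natAbs_le_of_modEq hj (mem_convPairs.1 hq).2
  have h2 := Int.natAbs_add_le q.1 q.2
  unfold profile
  split_ifs <;> omega

/-- The profile saturates at K. If one factor is saturated, the other adds at least 1; otherwise the
profiles dominate the moduli, whose sum is at least |j| > K. -/
theorem lt_profile_add_of_mem_convPairs {M K : ℕ} (hK : 2 ≤ K) {j : ℤ} (hj : j ∈ modes M)
    (hjK : K < j.natAbs) {q : ℤ × ℤ} (hq : q ∈ convPairs M j) :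
    K < profile K q.1 + profile K q.2 := by
  have h1 := natAbs_le_of_modEq hj (mem_convPairs.1 hq).2
  have h2 := Int.natAbs_add_le q.1 q.2
  unfold profile
  split_ifs <;> omega

/-- An entry that is nonzero in k₁ + k₂ is nonzero in one of the summands. Consequently the powers
of δ in the right-hand side have nonnegative exponents. -/
theorem order_le_order_add {M K : ℕ} (hK : 2 ≤ K) {j : ℤ} (hj : j ∈ modes M)
    {q : ℤ × ℤ} (hq : q ∈ convPairs M j) {k₁ k₂ k : Fin (M + 1) → ℤ} (hk : k₁ + k₂ = k) :
    order K j k ≤ order K q.1 k₁ + order K q.2 k₂ := by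
  refine order_le_iff.2 ⟨?_, fun l hl => ?_⟩
  · have := profile_le_add_of_mem_convPairs hK hj hq
    have := profile_le_order K q.1 k₁
    have := profile_le_order K q.2 k₂
    omega
  · by_cases h1 : k₁ l = 0
    · have h2 : k₂ l ≠ 0 := fun h2 => hl (by rw [← hk]; simp [h1, h2])
      have := profile_le_order_of_ne_zero K q.2 h2
      omega
    · have := profile_le_order_of_ne_zero K q.1 h1
      omega

theorem order_lt_order_add_of_lt {M K : ℕ} (hK : 2 ≤ K) {j : ℤ} (hj : j ∈ modes M)
    (hjK : K < j.natAbs) {q : ℤ × ℤ} (hq : q ∈ convPairs M j) {k₁ k₂ k : Fin (M + 1) → ℤ} :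
    order K j k < order K q.1 k₁ + order K q.2 k₂ := by
  have := lt_profile_add_of_mem_convPairs hK hj hjK hq
  have := profile_le_order K q.1 k₁
  have := profile_le_order K q.2 k₂
  have := order_le hK j k
  omega

theorem unitVec_apply_eq {M : ℕ} {j : ℤ} (l : Fin (M + 1)) (h : (l : ℕ) = j.natAbs) :
    unitVec M j l = 1 := if_pos h

theorem order_unitVec {M K : ℕ} {j : ℤ} {k : Fin (M + 1) → ℤ}
    (hk : k = unitVec M j ∨ k = -unitVec M j) : order K j k = profile K j := by
  refine le_antisymm (order_le_iff.2 ⟨le_rfl, fun l hl => ?_⟩) (profile_le_order _ _ _)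
  have : (l : ℕ) = j.natAbs := by
    by_contra h
    rcases hk with rfl | rfl <;> simp [unitVec, h] at hl
  exact (profile_eq_of_natAbs_eq K (by simpa using this)).le

theorem natAbs_le_of_mem_modes {M : ℕ} {j : ℤ} (hj : j ∈ modes M) : j.natAbs ≤ M := by
  obtain ⟨h1, h2⟩ := Finset.mem_Ico.1 hj
  omega

/-- The entry |j| of k is nonzero, so one factor alone already has order at least e(j), and the
other contributes at least 1. This gap pays for the small denominator α₁ on the diagonal. -/
theorem order_lt_order_add_of_unitVec {M K : ℕ} (hK : 2 ≤ K) {j : ℤ} (hj : j ∈ modes M)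
    (q : ℤ × ℤ) {k₁ k₂ k : Fin (M + 1) → ℤ}
    (hk : k₁ + k₂ = k) (hu : k = unitVec M j ∨ k = -unitVec M j) :
    order K j k < order K q.1 k₁ + order K q.2 k₂ := by
  rw [order_unitVec hu]
  have hjM := natAbs_le_of_mem_modes hj
  set l : Fin (M + 1) := ⟨j.natAbs, by omega⟩ with hl
  have hkl : k l ≠ 0 := by
    have h1 : unitVec M j l = 1 := unitVec_apply_eq l rfl
    rcases hu with rfl | rfl <;> simp [h1]
  have hp : profile K j = profile K ((l : ℕ) : ℤ) := profile_eq_of_natAbs_eq K (Int.natAbs_natCast _).symm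
  have e1 := (profile_pos (K := K) (by omega) q.1).trans (profile_le_order K q.1 k₁)
  have e2 := (profile_pos (K := K) (by omega) q.2).trans (profile_le_order K q.2 k₂)
  by_cases h1 : k₁ l = 0
  · have h2 : k₂ l ≠ 0 := fun h2 => hkl (by rw [← hk]; simp [h1, h2])
    have := profile_le_order_of_ne_zero K q.2 h2
    omega
  · have := profile_le_order_of_ne_zero K q.1 h1
    omega

theorem dotFreq_unitVec (ρ : ℝ) {M : ℕ} {j : ℤ} (hj : j ∈ modes M) :
    dotFreq ρ (unitVec M j) = freq ρ j := by
  have hjM := natAbs_le_of_mem_modes hj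
  unfold dotFreq
  rw [Finset.sum_eq_single (⟨j.natAbs, by omega⟩ : Fin (M + 1))]
  · rw [unitVec_apply_eq _ rfl, Int.cast_one, one_mul]
    exact freq_eq_of_natAbs_eq _ (Int.natAbs_natCast _)
  · intro l _ hl
    have : (l : ℕ) ≠ j.natAbs := fun e => hl (Fin.ext e)
    simp [unitVec, this]
  · simp

theorem dotFreq_neg (ρ : ℝ) {M : ℕ} (k : Fin (M + 1) → ℤ) : dotFreq ρ (-k) = -dotFreq ρ k := by
  simp [dotFreq, Finset.sum_neg_distrib]

theorem unitVec_ne_neg {M : ℕ} {j : ℤ} (hj : j ∈ modes M) :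
    unitVec M j ≠ -unitVec M j := by
  have hjM := natAbs_le_of_mem_modes hj
  intro e
  have := congrFun e ⟨j.natAbs, by omega⟩
  rw [Pi.neg_apply, unitVec_apply_eq _ rfl] at this
  omega

theorem mu_unitVec {M : ℕ} (K : ℕ) {j : ℤ} (hj : j ∈ modes M) :
    mu K (unitVec M j) = profile K j := by
  have hjM := natAbs_le_of_mem_modes hj
  unfold mu
  rw [Finset.sum_eq_single (⟨j.natAbs, by omega⟩ : Fin (M + 1))]
  · rw [unitVec_apply_eq _ rfl, Int.natAbs_one, one_mul]
    exact profile_eq_of_natAbs_eq _ (Int.natAbs_natCast _)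
  · intro l _ hl
    have : (l : ℕ) ≠ j.natAbs := fun e => hl (Fin.ext e)
    simp [unitVec, this]
  · simp

theorem bmod_of_mem_modes {M : ℕ} {j : ℤ} (hj : j ∈ modes M) : Int.bmod j (2 * M) = j := by
  obtain ⟨h1, h2⟩ := Finset.mem_Ico.1 hj
  exact Int.bmod_eq_of_le_mul_two (by push_cast; omega) (by push_cast; omega)

namespace Scheme

/-! ### Parameters -/

/-- The assumptions on the parameters of the equation, the method and the expansion. -/
structure Regime (S : Scheme) (γ B : ℝ) : Prop where
  three_le : 3 ≤ S.K
  K_le : S.K ≤ S.M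
  τ_pos : 0 < S.τ
  ε_pos : 0 < S.ε
  ε_le : S.ε ≤ 1
  ν_nonneg : 0 ≤ S.ν
  ν_lt : S.ν < 1 / 2
  ρ_pos : 0 < S.ρ
  γ_pos : 0 < γ
  γ_le : γ ≤ 1
  filter : IsSymplecticFilter B S.φ S.ψ
  nonres : NonResonant S.M S.K S.ρ S.ν γ S.ε S.τ

/-- The slow time scale `δ^ν = ε^{ν/2}`. -/
def slow (S : Scheme) : ℝ := S.δ ^ S.ν

/-- `|sinc(τ ω_j)|`. -/
def absSinc (S : Scheme) (j : ℤ) : ℝ := |Real.sinc (S.τ * S.ω j)|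

/-- The convolution in the right-hand side of the equation for `z_{j,m}^k`. -/
def conv (S : Scheme) (z : ℕ → ℤ → S.Vec → ℂ[X]) (m : ℕ) (j : ℤ) (k : S.Vec) : ℂ[X] :=
  ∑ q ∈ convPairs S.M j,
    ∑ κ ∈ (indices S.M S.K q.1 ×ˢ indices S.M S.K q.2).filter (fun κ => κ.1 + κ.2 = k),
      C ((S.δ ^ (2 * ((S.ord q.1 κ.1 : ℝ) + (S.ord q.2 κ.2 : ℝ) - (S.ord j k : ℝ)) * S.ν)
          : ℝ) : ℂ) *
        ∑ a ∈ Finset.Ico 1 m,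
          (C (S.φ (S.τ * S.ω q.1) : ℂ) * z a q.1 κ.1) *
            (C (S.φ (S.τ * S.ω q.2) : ℂ) * z (m - a) q.2 κ.2)

/-- The majorant of `conv` formed with the norms of its factors. -/
def convBound (S : Scheme) (z : ℕ → ℤ → S.Vec → ℂ[X]) (m : ℕ) (j : ℤ) (k : S.Vec) : ℝ :=
  ∑ q ∈ convPairs S.M j,
    ∑ κ ∈ (indices S.M S.K q.1 ×ˢ indices S.M S.K q.2).filter (fun κ => κ.1 + κ.2 = k),
      ∑ a ∈ Finset.Ico 1 m, coeffNorm (z a q.1 κ.1) * coeffNorm (z (m - a) q.2 κ.2)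

/-- The norm in which the coefficient function `z_{j,m}^k` is measured. -/
def size (S : Scheme) (j : ℤ) (k : S.Vec) (p : ℂ[X]) : ℝ :=
  (S.ω j + |S.s2 k| / (S.τ * S.absSinc j)) * coeffNorm p +
    coeffNorm (derivative p) / S.absSinc j

theorem rhs_eq (S : Scheme) (z : ℕ → ℤ → S.Vec → ℂ[X]) (m : ℕ) (j : ℤ) (k : S.Vec) :
    S.rhs z m j k = C ((S.τ ^ 2 * S.ψ (S.τ * S.ω j) : ℝ) : ℂ) * S.conv z m j k := rfl

theorem convBound_nonneg (S : Scheme) (z : ℕ → ℤ → S.Vec → ℂ[X]) (m : ℕ) (j : ℤ) (k : S.Vec) :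
    0 ≤ S.convBound z m j k :=
  Finset.sum_nonneg fun _ _ => Finset.sum_nonneg fun _ _ => Finset.sum_nonneg fun _ _ =>
    mul_nonneg (coeffNorm_nonneg _) (coeffNorm_nonneg _)

theorem natDegree_rhs_le {S : Scheme} {z : ℕ → ℤ → S.Vec → ℂ[X]} {m : ℕ}
    (hz : ∀ a < m, ∀ j k, (z a j k).natDegree ≤ 2 * a - 1) (j : ℤ) (k : S.Vec) :
    (S.rhs z m j k).natDegree ≤ 2 * m - 2 := by
  rw [rhs_eq]
  refine (natDegree_C_mul_le _ _).trans ?_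
  refine natDegree_sum_le_of_forall_le _ _ fun q _ => natDegree_sum_le_of_forall_le _ _ fun κ _ =>
    (natDegree_C_mul_le _ _).trans (natDegree_sum_le_of_forall_le _ _ fun a ha => ?_)
  obtain ⟨ha1, ha2⟩ := Finset.mem_Ico.1 ha
  have h1 := (natDegree_C_mul_le (S.φ (S.τ * S.ω q.1) : ℂ) (z a q.1 κ.1)).trans (hz a ha2 _ _)
  have h2 := (natDegree_C_mul_le (S.φ (S.τ * S.ω q.2) : ℂ) (z (m - a) q.2 κ.2)).trans
    (hz (m - a) (by omega) _ _)
  have h3 := natDegree_mul_le (p := C (S.φ (S.τ * S.ω q.1) : ℂ) * z a q.1 κ.1)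
    (q := C (S.φ (S.τ * S.ω q.2) : ℂ) * z (m - a) q.2 κ.2)
  omega

/-! ### Consequences of the non-resonance condition and size of the right-hand side. -/

namespace Regime

variable {S : Scheme} {γ B : ℝ}

theorem two_le (h : S.Regime γ B) : 2 ≤ S.K := by have := h.three_le; omega

theorem ω_pos (h : S.Regime γ B) (j : ℤ) : 0 < S.ω j := freq_pos h.ρ_pos j

theorem δ_pos (h : S.Regime γ B) : 0 < S.δ := Real.sqrt_pos.2 h.ε_pos

theorem δ_le (h : S.Regime γ B) : S.δ ≤ 1 := by
  rw [δ, ← Real.sqrt_one]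
  exact Real.sqrt_le_sqrt h.ε_le

theorem slow_pos (h : S.Regime γ B) : 0 < S.slow := Real.rpow_pos_of_pos h.δ_pos _

theorem slow_le (h : S.Regime γ B) : S.slow ≤ 1 :=
  Real.rpow_le_one h.δ_pos.le h.δ_le h.ν_nonneg

theorem rpow_half (h : S.Regime γ B) : S.ε ^ (S.ν / 2) = S.slow := by
  rw [slow, δ, Real.sqrt_eq_rpow, ← Real.rpow_mul h.ε_pos.le]
  congr 1
  ring

theorem δ_rpow_le_one (h : S.Regime γ B) {x : ℝ} (hx : 0 ≤ x) : S.δ ^ x ≤ 1 :=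
  Real.rpow_le_one h.δ_pos.le h.δ_le hx

theorem one_le_B (h : S.Regime γ B) : 1 ≤ B := by
  simpa [h.filter.phi_zero] using h.filter.bound_phi 0

/-- The strong non-resonance condition at j = 0, k = 0 bounds γτ by the modulus of a sine. It makes
every positive power of τ harmless. -/
theorem γτ_le (h : S.Regime γ B) : γ * S.τ ≤ 1 := by
  have hM := h.K_le
  have hK := h.three_le
  have h0 : (0 : ℤ) ∈ modes S.M := by
    simp only [modes, Finset.mem_Ico]
    omega
  have hk : (0 : S.Vec) ∈ indexSet S.M S.K 0 := by
    left
    simp [mu]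
    omega
  have hu : unitVec S.M 0 0 = 1 := unitVec_apply_eq _ (by simp)
  have h1 : (0 : S.Vec) ≠ unitVec S.M 0 := fun e => by
    have := congrFun e 0
    rw [hu] at this
    simp at this
  have h2 : (0 : S.Vec) ≠ -unitVec S.M 0 := fun e => by
    have := congrFun e 0
    rw [Pi.neg_apply, hu] at this
    simp at this
  exact (h.nonres.2 0 h0 0 hk h1 h2 (by simp)).1.trans (Real.abs_sin_le_one _)

theorem τ_le (h : S.Regime γ B) : S.τ ≤ γ⁻¹ := by
  rw [← one_div, le_div_iff₀ h.γ_pos, mul_comm]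
  exact h.γτ_le

theorem τ_slow_le (h : S.Regime γ B) : S.τ * S.slow ≤ γ⁻¹ :=
  (mul_le_of_le_one_right h.τ_pos.le h.slow_le).trans h.τ_le

theorem one_le_inv (h : S.Regime γ B) : 1 ≤ γ⁻¹ := (one_le_inv₀ h.γ_pos).2 h.γ_le

theorem coeffNorm_conv_le (h : S.Regime γ B) (z : ℕ → ℤ → S.Vec → ℂ[X]) (m : ℕ) (j : ℤ)
    (k : S.Vec) {G : ℝ}
    (hG : ∀ q ∈ convPairs S.M j, ∀ k₁ k₂ : S.Vec, k₁ + k₂ = k →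
      S.δ ^ (2 * ((S.ord q.1 k₁ : ℝ) + (S.ord q.2 k₂ : ℝ) - (S.ord j k : ℝ)) * S.ν) ≤ G) :
    coeffNorm (S.conv z m j k) ≤ G * (B ^ 2 * S.convBound z m j k) := by
  unfold conv convBound
  rw [Finset.mul_sum, Finset.mul_sum]
  refine (coeffNorm_sum_le _ _).trans (Finset.sum_le_sum fun q hq => ?_)
  rw [Finset.mul_sum, Finset.mul_sum]
  refine (coeffNorm_sum_le _ _).trans (Finset.sum_le_sum fun κ hκ => ?_)
  have h1 := hG q hq κ.1 κ.2 (Finset.mem_filter.1 hκ).2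
  have h0 : 0 ≤ S.δ ^ (2 * ((S.ord q.1 κ.1 : ℝ) + (S.ord q.2 κ.2 : ℝ) - (S.ord j k : ℝ)) * S.ν) :=
    Real.rpow_nonneg h.δ_pos.le _
  rw [coeffNorm_C_mul, Complex.norm_real, Real.norm_of_nonneg h0]
  have hB := h.one_le_B
  refine mul_le_mul h1 ?_ (coeffNorm_nonneg _) (h0.trans h1)
  rw [Finset.mul_sum]
  refine (coeffNorm_sum_le _ _).trans (Finset.sum_le_sum fun a _ => ?_)
  refine (coeffNorm_mul_le _ _).trans ?_
  rw [coeffNorm_C_mul, coeffNorm_C_mul, Complex.norm_real, Complex.norm_real, Real.norm_eq_abs,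
    Real.norm_eq_abs]
  have b1 := h.filter.bound_phi (S.τ * S.ω q.1)
  have b2 := h.filter.bound_phi (S.τ * S.ω q.2)
  have n1 := coeffNorm_nonneg (z a q.1 κ.1)
  have n2 := coeffNorm_nonneg (z (m - a) q.2 κ.2)
  calc _ ≤ B * coeffNorm (z a q.1 κ.1) * (B * coeffNorm (z (m - a) q.2 κ.2)) := by gcongr
    _ = _ := by ring

theorem coeffNorm_conv_le_one (h : S.Regime γ B) (z : ℕ → ℤ → S.Vec → ℂ[X]) (m : ℕ) {j : ℤ}
    (hj : j ∈ modes S.M) (k : S.Vec) :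
    coeffNorm (S.conv z m j k) ≤ 1 ^ 2 * (B ^ 2 * S.convBound z m j k) := by
  refine h.coeffNorm_conv_le z m j k fun q hq k₁ k₂ hk => ?_
  rw [one_pow]
  refine h.δ_rpow_le_one (mul_nonneg ?_ h.ν_nonneg)
  have : S.ord j k ≤ S.ord q.1 k₁ + S.ord q.2 k₂ := order_le_order_add h.two_le hj hq hk
  have : (S.ord j k : ℝ) ≤ S.ord q.1 k₁ + S.ord q.2 k₂ := by exact_mod_cast this
  linarith

/-- Orders are integers, so a strict gap is at least 1 and yields the factor δ^{2ν}. -/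
theorem coeffNorm_conv_le_slow (h : S.Regime γ B) (z : ℕ → ℤ → S.Vec → ℂ[X]) (m : ℕ) {j : ℤ}
    (k : S.Vec) (hord : ∀ q ∈ convPairs S.M j, ∀ k₁ k₂ : S.Vec, k₁ + k₂ = k →
      S.ord j k < S.ord q.1 k₁ + S.ord q.2 k₂) :
    coeffNorm (S.conv z m j k) ≤ S.slow ^ 2 * (B ^ 2 * S.convBound z m j k) := by
  refine h.coeffNorm_conv_le z m j k fun q hq k₁ k₂ hk => ?_
  have : (S.ord j k : ℝ) + 1 ≤ S.ord q.1 k₁ + S.ord q.2 k₂ := by exact_mod_cast hord q hq k₁ k₂ hk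
  have e : S.slow ^ 2 = S.δ ^ (2 * S.ν) := by
    rw [slow, ← Real.rpow_natCast, ← Real.rpow_mul h.δ_pos.le]
    congr 1
    push_cast
    ring
  rw [e]
  refine Real.rpow_le_rpow_of_exponent_ge h.δ_pos h.δ_le ?_
  have := h.ν_nonneg
  nlinarith

/-- Off the diagonal, small denominators are compensated by the size of the right-hand side. -/
theorem exists_small_denominator (h : S.Regime γ B) (z : ℕ → ℤ → S.Vec → ℂ[X]) (m : ℕ) {j : ℤ}
    (hj : j ∈ modes S.M) {k : S.Vec} (hk : k ∈ indexSet S.M S.K j)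
    (hu : ¬(k = unitVec S.M j ∨ k = -unitVec S.M j)) :
    ∃ θ : ℝ, 0 < θ ∧ θ ≤ 1 ∧ S.slow ≤ θ ∧
      γ * S.τ * θ ≤ |Real.sin (S.τ / 2 * (S.ω j - dotFreq S.ρ k))| ∧
      γ * S.τ * θ ≤ |Real.sin (S.τ / 2 * (S.ω j + dotFreq S.ρ k))| ∧
      coeffNorm (S.conv z m j k) ≤ θ ^ 2 * (B ^ 2 * S.convBound z m j k) := by
  have e : S.τ / 2 = 1 / 2 * S.τ := by ring
  rw [e]
  push Not at hu
  rcases Nat.lt_or_ge S.K j.natAbs with hjK | hjK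
  -- For |j| > K only the weak bound is available, but the gap in the orders supplies θ² = δ^{2ν},
  -- one δ^ν for each sine in α₀.
  · refine ⟨S.slow, h.slow_pos, h.slow_le, le_rfl, ?_, ?_,
      h.coeffNorm_conv_le_slow z m k fun q hq k₁ k₂ _ =>
        order_lt_order_add_of_lt h.two_le hj hjK hq⟩
    · rw [← h.rpow_half]
      exact (h.nonres.1 j hj k hk).2 hu.1
    · rw [← h.rpow_half]
      exact (h.nonres.1 j hj k hk).1 hu.2
  -- For |j| ≤ K the strong bound holds, and θ = 1 needs no gain from the right-hand side.
  · have := h.nonres.2 j hj k hk hu.1 hu.2 hjK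
    exact ⟨1, one_pos, le_rfl, h.slow_le, by rw [mul_one]; exact this.2,
      by rw [mul_one]; exact this.1, h.coeffNorm_conv_le_one z m hj k⟩

theorem abs_s2_of_unitVec {j : ℤ} (hj : j ∈ modes S.M) {k : S.Vec}
    (hu : k = unitVec S.M j ∨ k = -unitVec S.M j) :
    |S.s2 k| = |Real.sin (S.τ * S.ω j)| := by
  unfold s2
  rcases hu with rfl | rfl
  · rw [dotFreq_unitVec _ hj]; rfl
  · rw [dotFreq_neg, dotFreq_unitVec _ hj, mul_neg, Real.sin_neg, abs_neg]; rfl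

theorem unitVec_mem_indexSet (h : S.Regime γ B) {j : ℤ} (hj : j ∈ modes S.M) :
    unitVec S.M j ∈ indexSet S.M S.K j := by
  have hK := h.three_le
  rcases Nat.lt_or_ge j.natAbs S.K with hjK | hjK
  · left
    refine ⟨?_, fun l hl => if_neg (by omega)⟩
    rw [mu_unitVec _ hj]
    have := profile_le h.two_le j
    omega
  · right
    refine ⟨0, 0, ?_, by simp; omega, by simp [mu]; omega, Or.inl ?_⟩
    · rw [sub_zero, bmod_of_mem_modes hj]
      exact hjK
    · rw [sub_zero, bmod_of_mem_modes hj, add_zero]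

/-- This is the weak condition for k = ⟨j⟩ with the plus sign, where the half-angle is τω_j. -/
theorem le_abs_sin (h : S.Regime γ B) {j : ℤ} (hj : j ∈ modes S.M) :
    γ * S.τ * S.slow ≤ |Real.sin (S.τ * S.ω j)| := by
  have := (h.nonres.1 j hj _ (h.unitVec_mem_indexSet hj)).1 (unitVec_ne_neg hj)
  rw [dotFreq_unitVec _ hj, h.rpow_half] at this
  convert this using 3
  rw [ω]
  ring

theorem absSinc_mul (h : S.Regime γ B) (j : ℤ) :
    S.absSinc j * (S.τ * S.ω j) = |Real.sin (S.τ * S.ω j)| := by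
  have h1 : 0 < S.τ * S.ω j := mul_pos h.τ_pos (h.ω_pos j)
  unfold absSinc
  rw [Real.sinc_of_ne_zero h1.ne', abs_div, abs_of_pos h1, div_mul_cancel₀ _ h1.ne']

theorem absSinc_pos (h : S.Regime γ B) {j : ℤ} (hj : j ∈ modes S.M) : 0 < S.absSinc j := by
  have h1 : 0 < S.τ * S.ω j := mul_pos h.τ_pos (h.ω_pos j)
  have h2 : 0 < γ * S.τ * S.slow := mul_pos (mul_pos h.γ_pos h.τ_pos) h.slow_pos
  have h3 := h2.trans_le (h.le_abs_sin hj)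
  rw [← h.absSinc_mul j] at h3
  exact pos_of_mul_pos_left h3 h1.le

/-- Symplecticity enters here: ψ = sinc · φ produces the factor |sinc(τω_j)| that later cancels the
divisions by sinc(τω_j). -/
theorem coeffNorm_rhs_le (h : S.Regime γ B) (z : ℕ → ℤ → S.Vec → ℂ[X]) (m : ℕ) (j : ℤ)
    (k : S.Vec) {θ : ℝ}
    (hc : coeffNorm (S.conv z m j k) ≤ θ ^ 2 * (B ^ 2 * S.convBound z m j k)) :
    coeffNorm (S.rhs z m j k) ≤
      S.τ ^ 2 * S.absSinc j * θ ^ 2 * (B ^ 3 * S.convBound z m j k) := by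
  have hB := h.one_le_B
  have hs : 0 ≤ S.absSinc j := abs_nonneg _
  have hτ := h.τ_pos
  have hψ : |S.ψ (S.τ * S.ω j)| ≤ S.absSinc j * B := by
    rw [h.filter.symplectic, abs_mul]
    exact mul_le_mul_of_nonneg_left (h.filter.bound_phi _) (abs_nonneg _)
  rw [rhs_eq, coeffNorm_C_mul, Complex.norm_real, Real.norm_eq_abs, abs_mul, abs_of_nonneg (sq_nonneg S.τ)]
  calc _ ≤ S.τ ^ 2 * (S.absSinc j * B) * (θ ^ 2 * (B ^ 2 * S.convBound z m j k)) := by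
        gcongr
        exact coeffNorm_nonneg _
    _ = _ := by ring

theorem norm_α_le (h : S.Regime γ B) (j : ℤ) (k : S.Vec) {l : ℕ} (hl : l ≠ 0) :
    ‖S.α j k l‖ ≤ 2 * (S.τ * S.slow) ^ l := by
  have hx : 0 ≤ S.τ * S.slow := mul_nonneg h.τ_pos.le h.slow_pos.le
  have h1 : ‖(if Odd l then 2 * Complex.I * (S.s2 k : ℂ) else 2 * (S.c2 k : ℂ))‖ ≤ 2 := by
    split_ifs
    · rw [norm_mul, norm_mul, Complex.norm_I, Complex.norm_ofNat, Complex.norm_real, mul_one]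
      exact mul_le_of_le_one_right zero_le_two (Real.abs_sin_le_one _)
    · rw [norm_mul, Complex.norm_ofNat, Complex.norm_real]
      exact mul_le_of_le_one_right zero_le_two (Real.abs_cos_le_one _)
  have h2 : ‖(((S.τ * S.δ ^ S.ν) ^ l / (l.factorial : ℝ) : ℝ) : ℂ)‖ ≤ (S.τ * S.slow) ^ l := by
    rw [Complex.norm_real, Real.norm_of_nonneg (by unfold slow at hx; positivity)]
    exact div_le_self (by positivity) (by exact_mod_cast Nat.succ_le_of_lt l.factorial_pos)
  rw [α, if_neg hl, norm_mul, norm_neg]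
  calc _ ≤ (S.τ * S.slow) ^ l * 2 := by gcongr
    _ = _ := by ring

theorem norm_α_one (h : S.Regime γ B) (j : ℤ) (k : S.Vec) :
    ‖S.α j k 1‖ = 2 * (S.τ * S.slow) * |S.s2 k| := by
  have hx : 0 ≤ S.τ * S.slow := mul_nonneg h.τ_pos.le h.slow_pos.le
  rw [α, if_neg one_ne_zero, if_pos odd_one, norm_mul, norm_neg, Complex.norm_real]
  simp only [pow_one, Nat.factorial_one, Nat.cast_one, div_one, norm_mul, Complex.norm_I,
    Complex.norm_real, Real.norm_eq_abs, Complex.norm_ofNat, mul_one]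
  change |S.τ| * |S.slow| * (2 * |S.s2 k|) = _
  rw [abs_of_pos h.τ_pos, abs_of_pos h.slow_pos]
  ring

theorem norm_α_zero (j : ℤ) (k : S.Vec) :
    ‖S.α j k 0‖ = 4 * (|Real.sin (S.τ / 2 * (S.ω j - dotFreq S.ρ k))| *
      |Real.sin (S.τ / 2 * (S.ω j + dotFreq S.ρ k))|) := by
  rw [α, if_pos rfl, Complex.norm_real, Real.norm_eq_abs, abs_mul, abs_mul]
  norm_num [mul_assoc]

end Regime

/-- By the addition theorem |sin(a + b)| ≤ |sin a| + |sin b|, and multiplication by x turns each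
summand into at most the product of both sines. -/
theorem abs_sin_add_mul_le {a b x : ℝ} (hx : 0 ≤ x) (ha : x ≤ |Real.sin a|)
    (hb : x ≤ |Real.sin b|) :
    |Real.sin (b + a)| * x ≤ 2 * (|Real.sin a| * |Real.sin b|) := by
  have h1 : |Real.sin (b + a)| ≤ |Real.sin a| + |Real.sin b| := by
    rw [Real.sin_add]
    refine (abs_add_le _ _).trans ?_
    rw [abs_mul, abs_mul]
    have := mul_le_of_le_one_right (abs_nonneg (Real.sin b)) (Real.abs_cos_le_one a)
    have := mul_le_of_le_one_left (abs_nonneg (Real.sin a)) (Real.abs_cos_le_one b)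
    linarith
  have := abs_nonneg (Real.sin a)
  have := abs_nonneg (Real.sin b)
  nlinarith

theorem abs_sin_sub_mul_le {a b x : ℝ} (hx : 0 ≤ x) (ha : x ≤ |Real.sin a|)
    (hb : x ≤ |Real.sin b|) :
    |Real.sin (b - a)| * x ≤ 2 * (|Real.sin a| * |Real.sin b|) := by
  have := abs_sin_add_mul_le (a := -a) hx (by simpa using ha) hb
  simpa [sub_eq_add_neg] using this

/-- The norm bound for the solution operators in the construction of the functions `z_{j,m}^k`. -/
def solveConst (γ : ℝ) (m : ℕ) : ℝ := solveBound (γ⁻¹ ^ (2 * m)) (2 * m)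

/-- The constant in the bounds for a single coefficient function in terms of the right-hand side. -/
def modeConst (γ B : ℝ) (m : ℕ) : ℝ := solveConst γ m * B ^ 3 * ((2 * m + 3) * γ⁻¹ ^ 2)

/-- The constant in the bound for `slopeSum` in terms of the slope. -/
def slopeSumConst (γ : ℝ) (m : ℕ) : ℝ := (2 * m + 1) * (γ⁻¹ * (2 * m + 1)) ^ (2 * m)

/-- The contribution of the initial data to the diagonal coefficient functions. -/
def dataSize (S : Scheme) (u v : ℤ → ℂ) (j : ℤ) : ℝ :=
  (S.δ ^ profile S.K j)⁻¹ * (S.ω j * ‖u j‖ + ‖v j‖)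

theorem size_zero (S : Scheme) (j : ℤ) (k : S.Vec) : S.size j k 0 = 0 := by simp [size]

/-! ### Estimates for single coefficient functions. -/

namespace Regime

variable {S : Scheme} {γ B : ℝ}

theorem solveConst_nonneg (h : S.Regime γ B) (m : ℕ) : 0 ≤ solveConst γ m :=
  solveBound_nonneg (pow_nonneg (inv_nonneg.2 h.γ_pos.le) _) _

theorem slopeSumConst_nonneg (h : S.Regime γ B) (m : ℕ) : 0 ≤ slopeSumConst γ m := by
  have := inv_nonneg.2 h.γ_pos.le
  unfold slopeSumConst
  positivity

theorem modeConst_nonneg (h : S.Regime γ B) (m : ℕ) : 0 ≤ modeConst γ B m := by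
  have h1 := h.one_le_B
  have h2 := h.solveConst_nonneg m
  unfold modeConst
  positivity

theorem dataSize_nonneg (h : S.Regime γ B) (u v : ℤ → ℂ) (j : ℤ) : 0 ≤ S.dataSize u v j := by
  have h1 := h.ω_pos j
  have h2 := h.δ_pos
  unfold dataSize
  positivity

theorem size_nonneg (h : S.Regime γ B) (j : ℤ) (k : S.Vec) (p : ℂ[X]) : 0 ≤ S.size j k p := by
  have h1 := h.ω_pos j
  have h2 := h.τ_pos
  have h3 : 0 ≤ S.absSinc j := abs_nonneg _
  have h4 := coeffNorm_nonneg p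
  have h5 := coeffNorm_nonneg (derivative p)
  unfold size
  positivity

/-- For l = 1 the factor s_{2k} in α₁ cancels one of the sines in α₀. For l ≥ 2 two of the factors
τδ^ν already match both sines. -/
theorem norm_α_div_le (h : S.Regime γ B) {j : ℤ} {k : S.Vec} {θ N : ℝ} (hN0 : 0 < N)
    (hθ0 : 0 < θ) (hθd : S.slow ≤ θ)
    (hNx : (γ * S.τ * θ) * (γ * S.τ * θ) ≤ N) (hα0 : ‖S.α j k 0‖ = 4 * N)
    (hdiff : |S.s2 k| * (γ * S.τ * θ) ≤ 2 * N) {n : ℕ} {l : ℕ} (hl1 : 1 ≤ l) (hl2 : l ≤ n) :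
    ‖S.α j k l / S.α j k 0‖ ≤ γ⁻¹ ^ n := by
  have hτ := h.τ_pos
  have hγ := h.γ_pos
  have hγi := h.one_le_inv
  have hd := h.slow_pos
  refine le_trans ?_ (pow_le_pow_right₀ hγi hl2)
  rw [norm_div, hα0, div_le_iff₀ (by positivity)]
  obtain ⟨n, rfl⟩ := Nat.exists_eq_add_of_le hl1
  rcases n with _ | n
  · rw [add_zero, h.norm_α_one, pow_one]
    have e : S.τ * S.slow * |S.s2 k| ≤ γ⁻¹ * (|S.s2 k| * (γ * S.τ * θ)) := by
      rw [show γ⁻¹ * (|S.s2 k| * (γ * S.τ * θ)) = S.τ * θ * |S.s2 k| by field_simp]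
      gcongr
    have e2 : γ⁻¹ * (|S.s2 k| * (γ * S.τ * θ)) ≤ γ⁻¹ * (2 * N) := by gcongr
    linarith
  · refine (h.norm_α_le j k (by omega)).trans ?_
    have e1 : (S.τ * S.slow) ^ n ≤ γ⁻¹ ^ n := pow_le_pow_left₀ (by positivity) h.τ_slow_le n
    have e2 : (S.τ * S.slow) ^ 2 ≤ γ⁻¹ ^ 2 * N := by
      calc (S.τ * S.slow) ^ 2 ≤ (S.τ * θ) ^ 2 := by gcongr
        _ = γ⁻¹ ^ 2 * ((γ * S.τ * θ) * (γ * S.τ * θ)) := by field_simp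
        _ ≤ _ := by gcongr
    have e3 : 0 ≤ γ⁻¹ ^ n * (γ⁻¹ ^ 2 * N) := by positivity
    calc 2 * (S.τ * S.slow) ^ (1 + (n + 1)) = 2 * ((S.τ * S.slow) ^ n * (S.τ * S.slow) ^ 2) := by
          ring
      _ ≤ 2 * (γ⁻¹ ^ n * (γ⁻¹ ^ 2 * N)) := by gcongr
      _ ≤ 4 * (γ⁻¹ ^ n * (γ⁻¹ ^ 2 * N)) := by linarith
      _ = _ := by ring

/-- Each term of `size` is handled by one cancellation. The weight ω_j joins τ|sinc(τω_j)| to form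
|sin(τω_j)|; the second weight brings |s_{2k}|; both remove one sine from N. In the derivative term
the sinc cancels directly and (γτθ)² ≤ N does the rest. -/
theorem size_le_of_coeffNorm_le (h : S.Regime γ B) {j : ℤ} (hj : j ∈ modes S.M) {k : S.Vec}
    {θ N W : ℝ} (hN0 : 0 < N) (hW0 : 0 ≤ W) (hθ0 : 0 < θ) (hθ1 : θ ≤ 1)
    (hNx : (γ * S.τ * θ) * (γ * S.τ * θ) ≤ N)
    (hsum : |Real.sin (S.τ * S.ω j)| * (γ * S.τ * θ) ≤ 2 * N)
    (hdiff : |S.s2 k| * (γ * S.τ * θ) ≤ 2 * N) {p : ℂ[X]} {m : ℕ} (hdeg : p.natDegree ≤ 2 * m)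
    (hpW : coeffNorm p ≤ S.τ ^ 2 * S.absSinc j * θ ^ 2 / (4 * N) * W) :
    S.size j k p ≤ (2 * m + 3) * (γ⁻¹ ^ 2 * W) := by
  have hτ := h.τ_pos
  have hγ := h.γ_pos
  have hγi := h.one_le_inv
  have hω := h.ω_pos j
  have hσ := h.absSinc_pos hj
  have hder := coeffNorm_derivative_le hdeg
  have t1 : S.ω j * coeffNorm p ≤ γ⁻¹ * W := by
    calc _ ≤ S.ω j * (S.τ ^ 2 * S.absSinc j * θ ^ 2 / (4 * N) * W) := by gcongr
      _ = (S.absSinc j * (S.τ * S.ω j)) * (γ * S.τ * θ) * θ * (γ⁻¹ * W) / (4 * N) := by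
          field_simp
      _ ≤ 2 * N * 1 * (γ⁻¹ * W) / (4 * N) := by
          rw [h.absSinc_mul]
          gcongr
      _ = γ⁻¹ * W / 2 := by field_simp; ring
      _ ≤ γ⁻¹ * W := half_le_self (by positivity)
  have t2 : |S.s2 k| / (S.τ * S.absSinc j) * coeffNorm p ≤ γ⁻¹ * W := by
    calc _ ≤ |S.s2 k| / (S.τ * S.absSinc j) *
            (S.τ ^ 2 * S.absSinc j * θ ^ 2 / (4 * N) * W) := by gcongr
      _ = |S.s2 k| * (γ * S.τ * θ) * θ * (γ⁻¹ * W) / (4 * N) := by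
          field_simp
      _ ≤ 2 * N * 1 * (γ⁻¹ * W) / (4 * N) := by gcongr
      _ = γ⁻¹ * W / 2 := by field_simp; ring
      _ ≤ γ⁻¹ * W := half_le_self (by positivity)
  have t3 : coeffNorm (derivative p) / S.absSinc j ≤ 2 * m * (γ⁻¹ ^ 2 * W) := by
    rw [div_le_iff₀ hσ]
    calc coeffNorm (derivative p) ≤ ((2 * m : ℕ) : ℝ) * coeffNorm p := hder
      _ ≤ ((2 * m : ℕ) : ℝ) * (S.τ ^ 2 * S.absSinc j * θ ^ 2 / (4 * N) * W) := by gcongr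
      _ = 2 * m * (γ⁻¹ ^ 2 * W) * S.absSinc j * ((γ * S.τ * θ) * (γ * S.τ * θ) / (4 * N)) := by
          push_cast
          field_simp
      _ ≤ 2 * m * (γ⁻¹ ^ 2 * W) * S.absSinc j * 1 := by
          gcongr
          rw [div_le_one (by positivity)]
          linarith
      _ = _ := by ring
  have hγ2 : γ⁻¹ ≤ γ⁻¹ ^ 2 := le_self_pow₀ hγi two_ne_zero
  calc S.size j k p = S.ω j * coeffNorm p + |S.s2 k| / (S.τ * S.absSinc j) * coeffNorm p +
        coeffNorm (derivative p) / S.absSinc j := by unfold size; ring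
    _ ≤ γ⁻¹ ^ 2 * W + γ⁻¹ ^ 2 * W + 2 * m * (γ⁻¹ ^ 2 * W) := by
        have := mul_le_mul_of_nonneg_right hγ2 hW0
        exact add_le_add (add_le_add (t1.trans this) (t2.trans this)) t3
    _ ≤ (2 * m + 3) * (γ⁻¹ ^ 2 * W) := by
        have : 0 ≤ γ⁻¹ ^ 2 * W := by positivity
        linarith

theorem offDiag_bound (h : S.Regime γ B) {z : ℕ → ℤ → S.Vec → ℂ[X]} {m : ℕ}
    (hz : ∀ a < m, ∀ j k, (z a j k).natDegree ≤ 2 * a - 1) {j : ℤ}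
    (hj : j ∈ modes S.M) {k : S.Vec} (hk : k ∈ indexSet S.M S.K j)
    (hu : ¬(k = unitVec S.M j ∨ k = -unitVec S.M j)) :
    S.size j k (S.offDiag z m j k) ≤ modeConst γ B m * S.convBound z m j k := by
  have hQ := S.convBound_nonneg z m j k
  unfold offDiag
  split_ifs with hm
  · rw [size_zero]
    exact mul_nonneg (h.modeConst_nonneg m) hQ
  obtain ⟨θ, hθ0, hθ1, hθd, ha, hb, hc⟩ := h.exists_small_denominator z m hj hk hu
  have hrhs := h.coeffNorm_rhs_le z m j k hc
  have hdeg : (S.rhs z m j k).natDegree ≤ 2 * m := (natDegree_rhs_le hz j k).trans (by omega)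
  have hτ := h.τ_pos
  have hγ := h.γ_pos
  have hγi := h.one_le_inv
  have hd := h.slow_pos
  have hω := h.ω_pos j
  have hσ := h.absSinc_pos hj
  have hB := h.one_le_B
  have hx : 0 < γ * S.τ * θ := by positivity
  set N := |Real.sin (S.τ / 2 * (S.ω j - dotFreq S.ρ k))| *
      |Real.sin (S.τ / 2 * (S.ω j + dotFreq S.ρ k))| with hN
  have hNx : (γ * S.τ * θ) * (γ * S.τ * θ) ≤ N := mul_le_mul ha hb hx.le (abs_nonneg _)
  have hN0 : 0 < N := lt_of_lt_of_le (by positivity) hNx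
  have hα0 : ‖S.α j k 0‖ = 4 * N := norm_α_zero j k
  -- The two half-angles in α₀ have sum τω_j and difference τ(k·ω).
  have hsum : |Real.sin (S.τ * S.ω j)| * (γ * S.τ * θ) ≤ 2 * N := by
    have := abs_sin_add_mul_le hx.le ha hb
    rwa [show S.τ / 2 * (S.ω j + dotFreq S.ρ k) + S.τ / 2 * (S.ω j - dotFreq S.ρ k) = S.τ * S.ω j
      by ring] at this
  have hdiff : |S.s2 k| * (γ * S.τ * θ) ≤ 2 * N := by
    have := abs_sin_sub_mul_le hx.le ha hb
    rwa [show S.τ / 2 * (S.ω j + dotFreq S.ρ k) - S.τ / 2 * (S.ω j - dotFreq S.ρ k) =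
      S.τ * dotFreq S.ρ k by ring] at this
  have hdeg' := natDegree_solveOff_le (S.α j k) hdeg
  have hnorm := coeffNorm_solveOff_le (a := S.α j k) (g := (4 * N)⁻¹)
    (pow_nonneg (inv_nonneg.2 hγ.le) _) hdeg
    (fun l hl1 hl2 => h.norm_α_div_le hN0 hθ0 hθd hNx hα0 hdiff hl1 hl2)
    (by rw [norm_div, hα0]; simp)
  set p := solveOff (S.α j k) (S.rhs z m j k)
  set W := solveConst γ m * (B ^ 3 * S.convBound z m j k) with hW
  have hW0 : 0 ≤ W := mul_nonneg (h.solveConst_nonneg m) (by positivity)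
  have hpW : coeffNorm p ≤ S.τ ^ 2 * S.absSinc j * θ ^ 2 / (4 * N) * W := by
    refine hnorm.trans ?_
    calc _ ≤ solveConst γ m * ((4 * N)⁻¹ *
          (S.τ ^ 2 * S.absSinc j * θ ^ 2 * (B ^ 3 * S.convBound z m j k))) := by
          have := h.solveConst_nonneg m
          unfold solveConst at this ⊢
          gcongr
      _ = _ := by rw [hW]; field_simp
  exact (h.size_le_of_coeffNorm_le hj hN0 hW0 hθ0 hθ1 hNx hsum hdiff hdeg' hpW).trans
    (le_of_eq (by rw [hW]; unfold modeConst; ring))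

/-- On the diagonal α₁ is of size τδ^ν|sin(τω_j)|, against τ²|sinc(τω_j)|δ^{2ν} in the right-hand
side. The frequency ω_j turns τ|sinc| into |sin(τω_j)|, which cancels; without ω_j, the lower bound
γτδ^ν for |sin(τω_j)| suffices. -/
theorem slope_diag_bound (h : S.Regime γ B) {z : ℕ → ℤ → S.Vec → ℂ[X]} {m : ℕ}
    (hz : ∀ a < m, ∀ j k, (z a j k).natDegree ≤ 2 * a - 1) {j : ℤ}
    (hj : j ∈ modes S.M) {k : S.Vec}
    (hu : k = unitVec S.M j ∨ k = -unitVec S.M j) :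
    S.ω j * coeffNorm (S.slope z m j k) ≤ solveConst γ m * (B ^ 3 * S.convBound z m j k) ∧
      coeffNorm (S.slope z m j k) / S.absSinc j ≤
        γ⁻¹ * (solveConst γ m * (B ^ 3 * S.convBound z m j k)) := by
  have hQ := S.convBound_nonneg z m j k
  have hτ := h.τ_pos
  have hγ := h.γ_pos
  have hγi := h.one_le_inv
  have hd := h.slow_pos
  have hω := h.ω_pos j
  have hσ := h.absSinc_pos hj
  have hB := h.one_le_B
  set W := solveConst γ m * (B ^ 3 * S.convBound z m j k) with hW
  have hW0 : 0 ≤ W := mul_nonneg (h.solveConst_nonneg m) (by positivity)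
  unfold slope
  rw [if_pos hu]
  split_ifs with hm
  · simp only [coeffNorm_zero, mul_zero, zero_div]
    exact ⟨hW0, by positivity⟩
  have hc := h.coeffNorm_conv_le_slow z m (j := j) k
    (fun q _ k₁ k₂ hk => order_lt_order_add_of_unitVec h.two_le hj q hk hu)
  have hrhs := h.coeffNorm_rhs_le z m j k hc
  have hdeg : (S.rhs z m j k).natDegree ≤ 2 * m := (natDegree_rhs_le hz j k).trans (by omega)
  have hs2 := abs_s2_of_unitVec hj hu
  set N := |Real.sin (S.τ * S.ω j)| with hN
  have hNx : γ * S.τ * S.slow ≤ N := h.le_abs_sin hj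
  have hN0 : 0 < N := lt_of_lt_of_le (by positivity) hNx
  have hα1 : ‖S.α j k 1‖ = 2 * (S.τ * S.slow) * N := by rw [h.norm_α_one, hs2]
  have hratio : ∀ l, 1 ≤ l → l ≤ 2 * m → ‖S.α j k (l + 1) / S.α j k 1‖ ≤ γ⁻¹ ^ (2 * m) := by
    intro l hl1 hl2
    refine le_trans ?_ (pow_le_pow_right₀ hγi hl2)
    rw [norm_div, hα1, div_le_iff₀ (by positivity)]
    refine (h.norm_α_le j k (by omega)).trans ?_
    obtain ⟨n, rfl⟩ := Nat.exists_eq_add_of_le' hl1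
    have e1 : (S.τ * S.slow) ^ n ≤ γ⁻¹ ^ n := pow_le_pow_left₀ (by positivity) h.τ_slow_le n
    have e2 : S.τ * S.slow ≤ γ⁻¹ * N := by
      calc S.τ * S.slow = γ⁻¹ * (γ * S.τ * S.slow) := by field_simp
        _ ≤ _ := by gcongr
    calc 2 * (S.τ * S.slow) ^ (n + 1 + 1)
        = 2 * (S.τ * S.slow) * ((S.τ * S.slow) ^ n * (S.τ * S.slow)) := by ring
      _ ≤ 2 * (S.τ * S.slow) * (γ⁻¹ ^ n * (γ⁻¹ * N)) := by gcongr
      _ = _ := by ring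
  have hnorm := coeffNorm_solveDiag_le (a := S.α j k) (g := (2 * (S.τ * S.slow) * N)⁻¹)
    (pow_nonneg (inv_nonneg.2 hγ.le) _) hdeg hratio (by rw [norm_div, hα1]; simp)
  set p := solveDiag (S.α j k) (S.rhs z m j k)
  have hpW : coeffNorm p ≤ S.τ * S.absSinc j * S.slow / (2 * N) * W := by
    refine hnorm.trans ?_
    calc _ ≤ solveConst γ m * ((2 * (S.τ * S.slow) * N)⁻¹ *
          (S.τ ^ 2 * S.absSinc j * S.slow ^ 2 * (B ^ 3 * S.convBound z m j k))) := by
          have := h.solveConst_nonneg m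
          unfold solveConst at this ⊢
          gcongr
      _ = _ := by rw [hW]; field_simp
  constructor
  · calc _ ≤ S.ω j * (S.τ * S.absSinc j * S.slow / (2 * N) * W) := by gcongr
      _ = (S.absSinc j * (S.τ * S.ω j)) * S.slow / (2 * N) * W := by ring
      _ = S.slow * W / 2 := by rw [h.absSinc_mul, ← hN]; field_simp
      _ ≤ W := by
        have := mul_le_of_le_one_left hW0 h.slow_le
        linarith
  · rw [div_le_iff₀ hσ]
    calc _ ≤ S.τ * S.absSinc j * S.slow / (2 * N) * W := hpW
      _ = γ⁻¹ * W * S.absSinc j * (γ * S.τ * S.slow / (2 * N)) := by field_simp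
      _ ≤ γ⁻¹ * W * S.absSinc j * 1 := by
          gcongr
          rw [div_le_one (by positivity)]
          linarith
      _ = _ := mul_one _

theorem slope_bound (h : S.Regime γ B) {z : ℕ → ℤ → S.Vec → ℂ[X]} {m : ℕ}
    (hz : ∀ a < m, ∀ j k, (z a j k).natDegree ≤ 2 * a - 1) {j : ℤ}
    (hj : j ∈ modes S.M) {k : S.Vec} (hk : k ∈ indexSet S.M S.K j) :
    coeffNorm (S.slope z m j k) / S.absSinc j ≤ modeConst γ B m * S.convBound z m j k := by
  have hQ := S.convBound_nonneg z m j k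
  have hB := h.one_le_B
  have hγi := h.one_le_inv
  have hs := h.solveConst_nonneg m
  have hσ := h.absSinc_pos hj
  by_cases hu : k = unitVec S.M j ∨ k = -unitVec S.M j
  · refine (h.slope_diag_bound hz hj hu).2.trans ?_
    have hγ2 : γ⁻¹ ≤ (2 * m + 3) * γ⁻¹ ^ 2 := by
      have : γ⁻¹ ≤ γ⁻¹ ^ 2 := le_self_pow₀ hγi two_ne_zero
      have : 0 ≤ 2 * (m : ℝ) * γ⁻¹ ^ 2 := by positivity
      nlinarith
    calc _ ≤ ((2 * m + 3) * γ⁻¹ ^ 2) * (solveConst γ m * (B ^ 3 * S.convBound z m j k)) := by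
          gcongr
      _ = _ := by unfold modeConst; ring
  · have e : S.slope z m j k = derivative (S.offDiag z m j k) := if_neg hu
    refine le_trans ?_ (h.offDiag_bound hz hj hk hu)
    rw [e]
    have h1 := h.ω_pos j
    have h2 := h.τ_pos
    have h4 := coeffNorm_nonneg (S.offDiag z m j k)
    unfold size
    have : 0 ≤ (S.ω j + |S.s2 k| / (S.τ * S.absSinc j)) * coeffNorm (S.offDiag z m j k) := by
      positivity
    linarith

end Regime

theorem natDegree_offDiag_le {S : Scheme} {z : ℕ → ℤ → S.Vec → ℂ[X]} {m : ℕ}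
    (hz : ∀ a < m, ∀ j k, (z a j k).natDegree ≤ 2 * a - 1) (j : ℤ) (k : S.Vec) :
    (S.offDiag z m j k).natDegree ≤ 2 * m - 2 := by
  unfold offDiag
  split_ifs
  · simp
  · exact natDegree_solveOff_le _ (natDegree_rhs_le hz j k)

theorem natDegree_slope_le {S : Scheme} {z : ℕ → ℤ → S.Vec → ℂ[X]} {m : ℕ}
    (hz : ∀ a < m, ∀ j k, (z a j k).natDegree ≤ 2 * a - 1) (j : ℤ) (k : S.Vec) :
    (S.slope z m j k).natDegree ≤ 2 * m - 2 := by
  unfold slope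
  split_ifs
  · simp
  · exact natDegree_solveDiag_le _ (natDegree_rhs_le hz j k)
  · exact (natDegree_derivative_le _).trans
      ((Nat.sub_le _ _).trans (natDegree_offDiag_le hz j k))

theorem natDegree_step_le {S : Scheme} (hK : 0 < S.K) (u v : ℤ → ℂ)
    {z : ℕ → ℤ → S.Vec → ℂ[X]} {m : ℕ}
    (hz : ∀ a < m, ∀ j k, (z a j k).natDegree ≤ 2 * a - 1) (j : ℤ) (k : S.Vec) :
    (S.step u v z m j k).natDegree ≤ 2 * m - 1 := by
  have key : ∀ c : ℂ, ¬ m < S.ord j k →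
      (C c + antideriv (S.slope z m j k)).natDegree ≤ 2 * m - 1 := by
    intro c hm
    have h1 := natDegree_slope_le hz j k
    have h2 := natDegree_antideriv_le (S.slope z m j k)
    -- The order is at least 1, hence m ≥ 1. For m = 0 truncated subtraction would leave no room for
    -- the degree gained by integration.
    have h3 := (profile_pos hK j).trans (profile_le_order S.K j k)
    change 1 ≤ S.ord j k at h3
    refine (natDegree_add_le _ _).trans ?_
    rw [natDegree_C]
    omega
  unfold step
  split_ifs with h1 h2 h3 h4
  · simp
  · exact key _ h2
  · simp
  · exact key _ h4
  · exact (natDegree_offDiag_le hz j k).trans (by omega)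

/-- The constant in the bound for all coefficient functions of a mode. -/
def stepConst (γ B : ℝ) (m : ℕ) : ℝ :=
  3 * modeConst γ B m + 2 * ((1 + slopeSumConst γ m) * modeConst γ B m) + 2

namespace Regime

variable {S : Scheme} {γ B : ℝ}

/-- The p-th term carries τ^{p-1} together with p - 1 derivatives of the slope, so each further
order costs at most γ⁻¹(2m + 1). -/
theorem norm_slopeSum_le (h : S.Regime γ B) {z : ℕ → ℤ → S.Vec → ℂ[X]} {m : ℕ}
    (hz : ∀ a < m, ∀ j k, (z a j k).natDegree ≤ 2 * a - 1) (j : ℤ) (k : S.Vec) :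
    ‖S.slopeSum z m j k‖ ≤ slopeSumConst γ m * coeffNorm (S.slope z m j k) := by
  have hdeg : (S.slope z m j k).natDegree ≤ 2 * m := (natDegree_slope_le hz j k).trans (by omega)
  have hτ := h.τ_pos
  have hγi := h.one_le_inv
  have hd := h.slow_pos
  have hp := coeffNorm_nonneg (S.slope z m j k)
  set D : ℕ := 2 * m with hD
  set x : ℝ := γ⁻¹ * (D + 1) with hx
  have hx1 : 1 ≤ x := by
    have : (0 : ℝ) ≤ D := by positivity
    nlinarith
  unfold slopeSum
  calc _ ≤ ∑ p ∈ Finset.Icc 1 ((S.slope z m j k).natDegree + 1),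
        x ^ D * coeffNorm (S.slope z m j k) := by
        refine (norm_sum_le _ _).trans (Finset.sum_le_sum fun p hpm => ?_)
        obtain ⟨hp1, hp2⟩ := Finset.mem_Icc.1 hpm
        obtain ⟨n, rfl⟩ := Nat.exists_eq_add_of_le' hp1
        rw [Nat.add_sub_cancel, norm_mul, norm_mul]
        have h1 : ‖(if Odd (n + 1) then (S.c2 k : ℂ) else Complex.I * (S.s2 k : ℂ))‖ ≤ 1 := by
          split_ifs
          · rw [Complex.norm_real]
            exact Real.abs_cos_le_one _
          · rw [norm_mul, Complex.norm_I, one_mul, Complex.norm_real]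
            exact Real.abs_sin_le_one _
        have h2 : ‖((S.τ ^ n * (S.δ ^ S.ν) ^ (n + 1) / ((n + 1).factorial : ℝ) : ℝ) : ℂ)‖ ≤
            γ⁻¹ ^ n := by
          change ‖((S.τ ^ n * S.slow ^ (n + 1) / ((n + 1).factorial : ℝ) : ℝ) : ℂ)‖ ≤ _
          rw [Complex.norm_real, Real.norm_of_nonneg (by positivity)]
          refine (div_le_self (by positivity)
            (by exact_mod_cast Nat.succ_le_of_lt (n + 1).factorial_pos)).trans ?_
          have e1 : S.slow ^ (n + 1) ≤ 1 := pow_le_one₀ hd.le h.slow_le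
          have e2 : S.τ ^ n ≤ γ⁻¹ ^ n := pow_le_pow_left₀ hτ.le h.τ_le n
          calc S.τ ^ n * S.slow ^ (n + 1) ≤ γ⁻¹ ^ n * 1 := by gcongr
            _ = _ := mul_one _
        have h3 : ‖(Polynomial.derivative^[n] (S.slope z m j k)).eval 0‖ ≤
            ((D : ℝ) + 1) ^ n * coeffNorm (S.slope z m j k) := by
          refine (norm_eval_zero_le _).trans ((coeffNorm_iterate_derivative_le hdeg n).trans ?_)
          gcongr
          linarith
        have hn : n ≤ D := by omega
        calc _ ≤ γ⁻¹ ^ n * 1 * (((D : ℝ) + 1) ^ n * coeffNorm (S.slope z m j k)) := by gcongr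
          _ = x ^ n * coeffNorm (S.slope z m j k) := by rw [hx, mul_pow]; ring
          _ ≤ x ^ D * coeffNorm (S.slope z m j k) := by gcongr
    _ = (((S.slope z m j k).natDegree + 1 : ℕ) : ℝ) * (x ^ D * coeffNorm (S.slope z m j k)) := by
        simp
    _ ≤ ((D + 1 : ℕ) : ℝ) * (x ^ D * coeffNorm (S.slope z m j k)) := by gcongr
    _ = _ := by
        rw [hx, hD]
        unfold slopeSumConst
        push_cast
        ring

/-- Stated without dividing by x, because it is applied to x = k·ω, which may vanish. -/
theorem abs_mul_sinc_le (h : S.Regime γ B) (x : ℝ) :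
    |x * Real.sinc (S.τ * x)| = |Real.sin (S.τ * x)| / S.τ := by
  have hτ := h.τ_pos
  rcases eq_or_ne x 0 with rfl | hx
  · simp
  · have : S.τ * x ≠ 0 := mul_ne_zero hτ.ne' hx
    rw [Real.sinc_of_ne_zero this, show x * (Real.sin (S.τ * x) / (S.τ * x)) =
      Real.sin (S.τ * x) / S.τ by field_simp, abs_div, abs_of_pos hτ]

/-- The off-diagonal functions enter with a coefficient of modulus at most ω_j +
|s_{2k}|/(τ|sinc(τω_j)|), the first weight in `size`. The derivatives enter divided by sinc(τω_j),
which `slope_bound` permits. -/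
theorem ω_mul_norm_diagInit_le (h : S.Regime γ B) (u v : ℤ → ℂ) {z : ℕ → ℤ → S.Vec → ℂ[X]} {m : ℕ}
    (hz : ∀ a < m, ∀ j k, (z a j k).natDegree ≤ 2 * a - 1) {j : ℤ} (hj : j ∈ modes S.M)
    {sg : ℝ} (hsg : |sg| = 1) :
    2 * (S.ω j * ‖S.diagInit u v z m j sg‖) ≤
      (1 + slopeSumConst γ m) * modeConst γ B m * ∑ k ∈ indices S.M S.K j, S.convBound z m j k +
        S.dataSize u v j := by
  have hω := h.ω_pos j
  have hτ := h.τ_pos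
  have hδ := h.δ_pos
  have hν := h.ν_nonneg
  have hσ := h.absSinc_pos hj
  have hS := h.slopeSumConst_nonneg m
  have hC := h.modeConst_nonneg m
  have hpow : ∀ k, S.δ ^ (2 * ((S.ord j k : ℝ) - (profile S.K j : ℝ)) * S.ν) ≤ 1 := by
    intro k
    refine h.δ_rpow_le_one (mul_nonneg (mul_nonneg zero_le_two ?_) hν)
    rw [sub_nonneg]
    exact_mod_cast profile_le_order S.K j k
  have hmem : ∀ k ∈ indices S.M S.K j, k ∈ indexSet S.M S.K j := fun k hk =>
    (Set.Finite.mem_toFinset _).1 hk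
  unfold diagInit
  rw [norm_mul, norm_inv, norm_mul, norm_mul, Complex.norm_I, Complex.norm_real,
    Complex.norm_ofNat, Real.norm_of_nonneg hω.le, mul_one]
  rw [show ∀ x : ℝ, 2 * (S.ω j * ((2 * S.ω j)⁻¹ * x)) = x by intro x; field_simp]
  refine (norm_add_le _ _).trans (add_le_add ((norm_sub_le _ _).trans ?_) ?_)
  · rw [one_add_mul, add_mul]
    refine add_le_add ?_ ?_
    · rw [norm_mul, norm_neg, Complex.norm_I, one_mul, Finset.mul_sum]
      refine (norm_sum_le _ _).trans ((Finset.sum_le_sum (g := fun k =>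
        modeConst γ B m * S.convBound z m j k) fun k hk => ?_).trans
        (Finset.sum_le_sum_of_subset_of_nonneg (Finset.filter_subset _ _)
          fun k _ _ => mul_nonneg hC (S.convBound_nonneg z m j k)))
      obtain ⟨hk1, hk2⟩ := Finset.mem_filter.1 hk
      refine le_trans ?_ (h.offDiag_bound hz hj (hmem k hk1) (by tauto))
      rw [norm_mul, norm_mul, Complex.norm_real, Complex.norm_real,
        Real.norm_of_nonneg (Real.rpow_nonneg hδ.le _), Real.norm_eq_abs]
      have e1 : |S.ω j + sg * dotFreq S.ρ k *
          (Real.sinc (S.τ * dotFreq S.ρ k) / Real.sinc (S.τ * S.ω j))| ≤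
          S.ω j + |S.s2 k| / (S.τ * S.absSinc j) := by
        refine (abs_add_le _ _).trans (add_le_add (abs_of_pos hω).le (le_of_eq ?_))
        rw [mul_assoc, abs_mul, hsg, one_mul, ← mul_div_assoc, abs_div, h.abs_mul_sinc_le, div_div]
        rfl
      have e2 := norm_eval_zero_le (S.offDiag z m j k)
      have e3 := hpow k
      have e4 : 0 ≤ coeffNorm (derivative (S.offDiag z m j k)) / S.absSinc j :=
        div_nonneg (coeffNorm_nonneg _) hσ.le
      calc _ ≤ 1 * (S.ω j + |S.s2 k| / (S.τ * S.absSinc j)) * coeffNorm (S.offDiag z m j k) := by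
            gcongr
        _ ≤ _ := by unfold size; linarith
    · rw [norm_mul, Complex.norm_real, Real.norm_eq_abs, hsg, one_mul, Finset.mul_sum]
      refine (norm_sum_le _ _).trans (Finset.sum_le_sum fun k hk => ?_)
      have e1 := h.slope_bound hz hj (hmem k hk)
      have e2 := h.norm_slopeSum_le hz j k
      have e3 := hpow k
      rw [norm_mul, Complex.norm_real, Real.norm_eq_abs, abs_div,
        abs_of_nonneg (Real.rpow_nonneg hδ.le _)]
      calc _ ≤ 1 / S.absSinc j * (slopeSumConst γ m * coeffNorm (S.slope z m j k)) := by
            gcongr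
            exact le_rfl
        _ = slopeSumConst γ m * (coeffNorm (S.slope z m j k) / S.absSinc j) := by ring
        _ ≤ slopeSumConst γ m * (modeConst γ B m * S.convBound z m j k) := by gcongr
        _ = _ := by ring
  · split_ifs
    · unfold dataSize
      rw [norm_mul, Complex.norm_real, Real.norm_of_nonneg (by positivity)]
      gcongr
      refine (norm_add_le _ _).trans (le_of_eq ?_)
      rw [norm_mul, norm_mul, norm_mul, Complex.norm_I, one_mul, Complex.norm_real,
        Complex.norm_real, Real.norm_of_nonneg hω.le, Real.norm_eq_abs, hsg, one_mul]
    · rw [norm_zero]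
      exact h.dataSize_nonneg u v j

/-- On the diagonal |s_{2k}|/(τ|sinc(τω_j)|) equals ω_j, so the integration constant is weighted by
2ω_j only, and the derivative is the slope itself. -/
theorem size_diag_step_le (h : S.Regime γ B) {z : ℕ → ℤ → S.Vec → ℂ[X]} {m : ℕ}
    (hz : ∀ a < m, ∀ j k, (z a j k).natDegree ≤ 2 * a - 1) {j : ℤ} (hj : j ∈ modes S.M)
    {k : S.Vec} (hk : k ∈ indexSet S.M S.K j) (hu : k = unitVec S.M j ∨ k = -unitVec S.M j)
    (c : ℂ) :
    S.size j k (C c + antideriv (S.slope z m j k)) ≤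
      3 * modeConst γ B m * S.convBound z m j k + 2 * (S.ω j * ‖c‖) := by
  have hω := h.ω_pos j
  have hτ := h.τ_pos
  have hσ := h.absSinc_pos hj
  have hQ := S.convBound_nonneg z m j k
  have hγi := h.one_le_inv
  have hW : solveConst γ m * (B ^ 3 * S.convBound z m j k) ≤
      modeConst γ B m * S.convBound z m j k := by
    have h1 : 1 ≤ (2 * (m : ℝ) + 3) * γ⁻¹ ^ 2 := by
      have : 1 ≤ γ⁻¹ ^ 2 := one_le_pow₀ hγi
      have : 0 ≤ 2 * (m : ℝ) * γ⁻¹ ^ 2 := by positivity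
      nlinarith
    have hB := h.one_le_B
    have := h.solveConst_nonneg m
    calc _ ≤ solveConst γ m * (B ^ 3 * S.convBound z m j k) * ((2 * (m : ℝ) + 3) * γ⁻¹ ^ 2) :=
          le_mul_of_one_le_right (by positivity) h1
      _ = _ := by unfold modeConst; ring
  have h1 := (h.slope_diag_bound hz hj hu).1.trans hW
  have h2 := h.slope_bound hz hj hk
  have e1 : |S.s2 k| / (S.τ * S.absSinc j) = S.ω j := by
    rw [abs_s2_of_unitVec hj hu, ← h.absSinc_mul]
    field_simp
  have e2 : coeffNorm (C c + antideriv (S.slope z m j k)) ≤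
      ‖c‖ + coeffNorm (S.slope z m j k) :=
    (coeffNorm_add_le _ _).trans (add_le_add (coeffNorm_C c).le (coeffNorm_antideriv_le _))
  unfold size
  rw [e1, derivative_add, derivative_C, zero_add, derivative_antideriv]
  have e3 := mul_le_mul_of_nonneg_left e2 (by linarith : 0 ≤ S.ω j + S.ω j)
  linarith

theorem sum_size_step_le (h : S.Regime γ B) (u v : ℤ → ℂ) {z : ℕ → ℤ → S.Vec → ℂ[X]} {m : ℕ}
    (hz : ∀ a < m, ∀ j k, (z a j k).natDegree ≤ 2 * a - 1) {j : ℤ} (hj : j ∈ modes S.M) :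
    ∑ k ∈ indices S.M S.K j, S.size j k (S.step u v z m j k) ≤
      stepConst γ B m * (∑ k ∈ indices S.M S.K j, S.convBound z m j k + S.dataSize u v j) := by
  have hS := h.slopeSumConst_nonneg m
  have hC := h.modeConst_nonneg m
  have hI := h.dataSize_nonneg u v j
  have hinit := fun (sg : ℝ) (hsg : |sg| = 1) => h.ω_mul_norm_diagInit_le u v hz hj hsg
  obtain ⟨Q, hQ⟩ : ∃ Q, Q = ∑ k ∈ indices S.M S.K j, S.convBound z m j k := ⟨_, rfl⟩
  have hQ0 : 0 ≤ Q := hQ ▸ Finset.sum_nonneg fun k _ => S.convBound_nonneg z m j k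
  obtain ⟨R, hR⟩ : ∃ R, R = (1 + slopeSumConst γ m) * modeConst γ B m * Q + S.dataSize u v j :=
    ⟨_, rfl⟩
  have hR0 : 0 ≤ R := by rw [hR]; positivity
  rw [← hQ, ← hR] at hinit
  rw [← hQ]
  have hmem : ∀ k ∈ indices S.M S.K j, k ∈ indexSet S.M S.K j := fun k hk =>
    (Set.Finite.mem_toFinset _).1 hk
  have hdiag : ∀ k ∈ indices S.M S.K j, (k = unitVec S.M j ∨ k = -unitVec S.M j) →
      ∀ sg : ℝ, |sg| = 1 →
      S.size j k (if m < S.ord j k then 0 else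
        C (S.diagInit u v z m j sg) + antideriv (S.slope z m j k)) ≤
        3 * modeConst γ B m * S.convBound z m j k + R := by
    intro k hk hu sg hsg
    have hcb := S.convBound_nonneg z m j k
    split_ifs
    · rw [size_zero]
      exact add_nonneg (mul_nonneg (mul_nonneg zero_le_three hC) hcb) hR0
    · exact (h.size_diag_step_le hz hj (hmem k hk) hu _).trans
        (add_le_add_right (hinit sg hsg) _)
  -- The initial-value contribution `R` is attached to the two diagonal indices by indicators, so
  -- that it enters the sum over k at most twice.
  have hpoint : ∀ k ∈ indices S.M S.K j, S.size j k (S.step u v z m j k) ≤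
      3 * modeConst γ B m * S.convBound z m j k + (if k = unitVec S.M j then R else 0) +
        (if k = -unitVec S.M j then R else 0) := by
    intro k hk
    have hcb := S.convBound_nonneg z m j k
    unfold step
    by_cases h1 : k = unitVec S.M j
    · rw [if_pos h1, if_pos h1]
      refine (hdiag k hk (Or.inl h1) 1 (by simp)).trans (le_add_of_nonneg_right ?_)
      split_ifs <;> [exact hR0; exact le_rfl]
    · rw [if_neg h1, if_neg h1]
      by_cases h2 : k = -unitVec S.M j
      · rw [if_pos h2, if_pos h2, add_zero]
        exact hdiag k hk (Or.inr h2) (-1) (by simp)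
      · rw [if_neg h2, if_neg h2, add_zero, add_zero]
        refine (h.offDiag_bound hz hj (hmem k hk) (by tauto)).trans ?_
        have := mul_nonneg hC hcb
        linarith
  refine (Finset.sum_le_sum hpoint).trans ?_
  rw [Finset.sum_add_distrib, Finset.sum_add_distrib, ← Finset.mul_sum, ← hQ, Finset.sum_ite_eq',
    Finset.sum_ite_eq']
  have i1 : (if unitVec S.M j ∈ indices S.M S.K j then R else 0) ≤ R := by
    split_ifs <;> [exact le_rfl; exact hR0]
  have i2 : (if -unitVec S.M j ∈ indices S.M S.K j then R else 0) ≤ R := by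
    split_ifs <;> [exact le_rfl; exact hR0]
  have i3 : 0 ≤ (3 * modeConst γ B m + 2 * ((1 + slopeSumConst γ m) * modeConst γ B m)) *
      S.dataSize u v j := by positivity
  calc _ ≤ 3 * modeConst γ B m * Q + R + R := add_le_add (add_le_add_right i1 _) i2
    _ ≤ _ := by
      unfold stepConst
      rw [hR]
      linarith

end Regime
end Scheme

/-! ### Initial data and induction over the order m. -/

theorem sum_modes_natAbs_le (M : ℕ) {f : ℕ → ℝ} (hf : ∀ n, 0 ≤ f n) :
    ∑ j ∈ modes M, f j.natAbs ≤ 2 * ∑ l : Fin (M + 1), f l := by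
  have hmaps : ∀ j ∈ modes M, j.natAbs ∈ Finset.range (M + 1) := fun j hj =>
    Finset.mem_range.2 (Nat.lt_succ_of_le (natAbs_le_of_mem_modes hj))
  rw [← Finset.sum_fiberwise_of_maps_to hmaps, Finset.sum_fin_eq_sum_range, Finset.mul_sum]
  refine Finset.sum_le_sum fun n hn => ?_
  rw [dif_pos (Finset.mem_range.1 hn)]
  have hsub : (modes M).filter (fun j => j.natAbs = n) ⊆ {(n : ℤ), -(n : ℤ)} := by
    intro j hj
    have := (Finset.mem_filter.1 hj).2
    simp only [Finset.mem_insert, Finset.mem_singleton]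
    omega
  have hcard : #((modes M).filter (fun j => j.natAbs = n)) ≤ 2 :=
    (Finset.card_le_card hsub).trans Finset.card_le_two
  calc ∑ j ∈ modes M with j.natAbs = n, f j.natAbs
      = ∑ j ∈ modes M with j.natAbs = n, f n :=
        Finset.sum_congr rfl fun j hj => by rw [(Finset.mem_filter.1 hj).2]
    _ = #((modes M).filter (fun j => j.natAbs = n)) * f n := by simp
    _ ≤ 2 * f n := mul_le_mul_of_nonneg_right (by exact_mod_cast hcard) (hf n)

theorem RealValued.norm_eq {M : ℕ} {u : ℤ → ℂ} (hu : RealValued M u) {j : ℤ} (hj : j ∈ modes M) :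
    ‖u j‖ = ‖u (j.natAbs : ℤ)‖ := by
  obtain ⟨h1, h2⟩ := Finset.mem_Ico.1 hj
  rcases le_total 0 j with h | h
  · rw [Int.natAbs_of_nonneg h]
  · rw [Int.ofNat_natAbs_of_nonpos h, hu.2 j h1 h2.le, RCLike.norm_conj]

namespace Scheme

/-- The coefficient functions `z_{j,m'}^k` with `m' < m`. -/
def prev (S : Scheme) (u v : ℤ → ℂ) (m : ℕ) : ℕ → ℤ → S.Vec → ℂ[X] :=
  fun m' => if m' < m then S.modCoeff u v m' else 0

theorem modCoeff_eq (S : Scheme) (u v : ℤ → ℂ) (m : ℕ) :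
    S.modCoeff u v m = S.step u v (S.prev u v m) m := by
  rw [modCoeff]
  congr 1

theorem natDegree_modCoeff_le {S : Scheme} (hK : 0 < S.K) (u v : ℤ → ℂ) (m : ℕ) :
    ∀ j k, (S.modCoeff u v m j k).natDegree ≤ 2 * m - 1 := by
  induction m using Nat.strong_induction_on with
  | _ m ih =>
    intro j k
    rw [modCoeff_eq]
    refine natDegree_step_le hK u v (fun a ha j k => ?_) j k
    rw [prev, if_pos ha]
    exact ih a ha j k

theorem natDegree_prev_le {S : Scheme} (hK : 0 < S.K) (u v : ℤ → ℂ) {m : ℕ} :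
    ∀ a < m, ∀ j k, (S.prev u v m a j k).natDegree ≤ 2 * a - 1 := by
  intro a ha j k
  rw [prev, if_pos ha]
  exact natDegree_modCoeff_le hK u v a j k

/-- The convolution of order m involves only orders from 1 to m - 1, so extending the earlier
functions by zero changes nothing. -/
theorem convBound_prev (S : Scheme) (u v : ℤ → ℂ) (m : ℕ) (j : ℤ) (k : S.Vec) :
    S.convBound (S.prev u v m) m j k = S.convBound (S.modCoeff u v) m j k := by
  unfold convBound
  refine Finset.sum_congr rfl fun q _ => Finset.sum_congr rfl fun κ _ =>
    Finset.sum_congr rfl fun a ha => ?_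
  obtain ⟨h1, h2⟩ := Finset.mem_Ico.1 ha
  rw [prev, if_pos h2, prev, if_pos (by omega)]

/-- The fibres of (k₁, k₂) ↦ k₁ + k₂ are disjoint, so summing over k counts each pair at most once
and the double sum factorizes. Only a convolution in the modes is left. -/
theorem sum_convBound_le (S : Scheme) (z : ℕ → ℤ → S.Vec → ℂ[X]) (m : ℕ) (j : ℤ) :
    ∑ k ∈ indices S.M S.K j, S.convBound z m j k ≤
      ∑ a ∈ Finset.Ico 1 m, ∑ q ∈ convPairs S.M j,
        (∑ k ∈ indices S.M S.K q.1, coeffNorm (z a q.1 k)) *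
          ∑ k ∈ indices S.M S.K q.2, coeffNorm (z (m - a) q.2 k) := by
  unfold convBound
  rw [Finset.sum_comm, Finset.sum_comm (s := Finset.Ico 1 m)]
  refine Finset.sum_le_sum fun q _ => ?_
  have h0 : ∀ κ : S.Vec × S.Vec, 0 ≤
      ∑ a ∈ Finset.Ico 1 m, coeffNorm (z a q.1 κ.1) * coeffNorm (z (m - a) q.2 κ.2) :=
    fun κ => Finset.sum_nonneg fun a _ => mul_nonneg (coeffNorm_nonneg _) (coeffNorm_nonneg _)
  refine (Finset.sum_fiberwise_le_sum_of_sum_fiber_nonneg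
    fun k _ => Finset.sum_nonneg fun κ _ => h0 κ).trans (le_of_eq ?_)
  rw [Finset.sum_comm]
  refine Finset.sum_congr rfl fun a _ => ?_
  rw [Finset.sum_mul_sum, Finset.sum_product]

/-- The size of all coefficient functions of order `m` of a mode. -/
def modeSize (S : Scheme) (u v : ℤ → ℂ) (m : ℕ) (j : ℤ) : ℝ :=
  ∑ k ∈ indices S.M S.K j, S.size j k (S.modCoeff u v m j k)

namespace Regime

variable {S : Scheme} {γ B : ℝ}

theorem modeSize_nonneg (h : S.Regime γ B) (u v : ℤ → ℂ) (m : ℕ) (j : ℤ) :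
    0 ≤ S.modeSize u v m j :=
  Finset.sum_nonneg fun k _ => h.size_nonneg j k _

theorem ω_mul_coeffNorm_le_size (h : S.Regime γ B) (j : ℤ) (k : S.Vec) (p : ℂ[X]) :
    S.ω j * coeffNorm p ≤ S.size j k p := by
  have h2 := h.τ_pos
  have h3 : 0 ≤ S.absSinc j := abs_nonneg _
  have h4 := coeffNorm_nonneg p
  have h5 := coeffNorm_nonneg (derivative p)
  have h6 : 0 ≤ |S.s2 k| / (S.τ * S.absSinc j) * coeffNorm p + coeffNorm (derivative p) / S.absSinc j := by
    positivity
  unfold size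
  linarith

theorem sum_coeffNorm_le (h : S.Regime γ B) (u v : ℤ → ℂ) (m : ℕ) (j : ℤ) :
    ∑ k ∈ indices S.M S.K j, coeffNorm (S.modCoeff u v m j k) ≤
      (Real.sqrt S.ρ)⁻¹ * S.modeSize u v m j := by
  have hρ := Real.sqrt_pos.2 h.ρ_pos
  unfold modeSize
  rw [Finset.mul_sum]
  refine Finset.sum_le_sum fun k _ => ?_
  rw [inv_mul_eq_div, le_div_iff₀ hρ, mul_comm]
  exact (mul_le_mul_of_nonneg_right (sqrt_le_freq _ _) (coeffNorm_nonneg _)).trans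
    (h.ω_mul_coeffNorm_le_size j k _)

/-- The recursion behind the induction; the factor ρ⁻¹ comes from using ω ≥ √ρ once for each factor.
-/
theorem modeSize_le (h : S.Regime γ B) (u v : ℤ → ℂ) (m : ℕ) {j : ℤ} (hj : j ∈ modes S.M) :
    S.modeSize u v m j ≤ stepConst γ B m * (∑ a ∈ Finset.Ico 1 m, S.ρ⁻¹ *
      ∑ q ∈ convPairs S.M j, S.modeSize u v a q.1 * S.modeSize u v (m - a) q.2 +
        S.dataSize u v j) := by
  have hK : 0 < S.K := by have := h.three_le; omega
  have h1 := h.sum_size_step_le u v (natDegree_prev_le hK u v (m := m)) hj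
  simp_rw [convBound_prev, ← modCoeff_eq] at h1
  refine h1.trans ?_
  have hC := h.modeConst_nonneg m
  have hS := h.slopeSumConst_nonneg m
  have hstep : 0 ≤ stepConst γ B m := by unfold stepConst; positivity
  refine mul_le_mul_of_nonneg_left (add_le_add ((S.sum_convBound_le _ m j).trans ?_) le_rfl) hstep
  refine Finset.sum_le_sum fun a _ => ?_
  rw [Finset.mul_sum]
  refine Finset.sum_le_sum fun q _ => ?_
  have hρ := h.ρ_pos
  have e : S.ρ⁻¹ = (Real.sqrt S.ρ)⁻¹ * (Real.sqrt S.ρ)⁻¹ := by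
    rw [← mul_inv, Real.mul_self_sqrt hρ.le]
  have n1 := h.modeSize_nonneg u v a q.1
  calc _ ≤ ((Real.sqrt S.ρ)⁻¹ * S.modeSize u v a q.1) *
        ((Real.sqrt S.ρ)⁻¹ * S.modeSize u v (m - a) q.2) :=
        mul_le_mul (h.sum_coeffNorm_le u v a q.1) (h.sum_coeffNorm_le u v (m - a) q.2)
          (Finset.sum_nonneg fun _ _ => coeffNorm_nonneg _) (by positivity)
    _ = _ := by rw [e]; ring

/-- The constant is 8 = 4 · 2: (a + b)² ≤ 4(a²/2 + b²/2), and every modulus |j| belongs to at most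
two modes, whose data have equal modulus by realness. -/
theorem weightedSq_dataSize_le (h : S.Regime γ B) {u v : ℤ → ℂ} (hu : RealValued S.M u)
    (hv : RealValued S.M v) {s C₀ : ℝ}
    (hC : ∑ l : Fin (S.M + 1), weight s ((l : ℕ) : ℤ) *
          S.ε ^ (-(profile S.K ((l : ℕ) : ℤ) : ℤ)) * modeEnergy S.ρ u v ((l : ℕ) : ℤ) ≤ C₀) :
    weightedSq s S.M (S.dataSize u v) ≤ 8 * C₀ := by
  have hE : ∀ j, 0 ≤ modeEnergy S.ρ u v j := fun j => by unfold modeEnergy; positivity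
  have hδ := h.δ_pos
  have hε := h.ε_pos
  have key : ∀ j ∈ modes S.M, weight s j * S.dataSize u v j ^ 2 ≤
      4 * (weight s (j.natAbs : ℤ) * S.ε ^ (-(profile S.K (j.natAbs : ℤ) : ℤ)) *
        modeEnergy S.ρ u v (j.natAbs : ℤ)) := by
    intro j hj
    have ha : j.natAbs = ((j.natAbs : ℤ)).natAbs := (Int.natAbs_natCast _).symm
    rw [← weight_eq_of_natAbs_eq s ha, ← profile_eq_of_natAbs_eq S.K ha, modeEnergy,
      ← freq_eq_of_natAbs_eq S.ρ ha, norm_mul, ← hu.norm_eq hj, ← hv.norm_eq hj, Complex.norm_real,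
      Real.norm_of_nonneg (freq_pos h.ρ_pos j).le, dataSize]
    change _ ≤ 4 * (weight s j * S.ε ^ (-(profile S.K j : ℤ)) *
      (1 / 2 * (S.ω j * ‖u j‖) ^ 2 + 1 / 2 * ‖v j‖ ^ 2))
    have e1 : ((S.δ ^ profile S.K j)⁻¹) ^ 2 = S.ε ^ (-(profile S.K j : ℤ)) := by
      rw [zpow_neg, zpow_natCast, inv_pow, ← pow_mul, mul_comm, pow_mul, δ, Real.sq_sqrt hε.le]
    rw [mul_pow, e1]
    have w := weight_nonneg s j
    have z : 0 ≤ S.ε ^ (-(profile S.K j : ℤ)) := by positivity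
    have := mul_nonneg (mul_nonneg w z) (sq_nonneg (S.ω j * ‖u j‖ - ‖v j‖))
    nlinarith
  calc weightedSq s S.M (S.dataSize u v)
      ≤ ∑ j ∈ modes S.M, 4 * (weight s (j.natAbs : ℤ) *
          S.ε ^ (-(profile S.K (j.natAbs : ℤ) : ℤ)) * modeEnergy S.ρ u v (j.natAbs : ℤ)) :=
        Finset.sum_le_sum key
    _ = 4 * ∑ j ∈ modes S.M, weight s (j.natAbs : ℤ) *
          S.ε ^ (-(profile S.K (j.natAbs : ℤ) : ℤ)) * modeEnergy S.ρ u v (j.natAbs : ℤ) := by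
        rw [Finset.mul_sum]
    _ ≤ 4 * (2 * ∑ l : Fin (S.M + 1), weight s ((l : ℕ) : ℤ) *
          S.ε ^ (-(profile S.K ((l : ℕ) : ℤ) : ℤ)) * modeEnergy S.ρ u v ((l : ℕ) : ℤ)) := by
        refine mul_le_mul_of_nonneg_left (sum_modes_natAbs_le S.M (f := fun n => weight s (n : ℤ) *
          S.ε ^ (-(profile S.K (n : ℤ) : ℤ)) * modeEnergy S.ρ u v (n : ℤ)) fun n => ?_) (by norm_num)
        exact mul_nonneg (mul_nonneg (weight_nonneg _ _) (by positivity)) (hE _)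
    _ ≤ 8 * C₀ := by linarith

end Regime

/-- The modulation functions of each order are bounded in the weighted `ℓ²` norm, uniformly in
the discretization parameters. -/
theorem exists_weightedSq_modeSize_le {s : ℝ} (hs : 1 / 2 < s)
    (ρ γ B C₁ : ℝ) (m : ℕ) :
    ∃ C : ℝ, 0 ≤ C ∧ ∀ S : Scheme, S.Regime γ B → S.ρ = ρ → ∀ u v : ℤ → ℂ,
      weightedSq s S.M (S.dataSize u v) ≤ C₁ → weightedSq s S.M (S.modeSize u v m) ≤ C := by
  induction m using Nat.strong_induction_on with
  | _ m ih =>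
    -- The constants of all lower orders are fixed before the scheme is given, so the new constant
    -- is uniform in all schemes.
    choose! c hc0 hc using ih
    refine ⟨max 0 (stepConst γ B m ^ 2 * (2 * ((#(Finset.Ico 1 m) : ℝ) *
      ∑ a ∈ Finset.Ico 1 m, ρ⁻¹ ^ 2 * (convConst s * (c a * c (m - a))) + C₁))),
      le_max_left _ _, fun S h hρ u v hdata => le_max_of_le_right ?_⟩
    refine (weightedSq_mono (fun j _ => h.modeSize_nonneg u v m j)
      fun j hj => h.modeSize_le u v m hj).trans ?_
    rw [weightedSq_const_mul]
    refine mul_le_mul_of_nonneg_left ((weightedSq_add_le _ _ _ _).trans ?_) (sq_nonneg _)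
    refine mul_le_mul_of_nonneg_left (add_le_add ?_ hdata) zero_le_two
    refine (weightedSq_sum_le _ _ _ _).trans ?_
    refine mul_le_mul_of_nonneg_left (Finset.sum_le_sum fun a ha => ?_) (Nat.cast_nonneg _)
    obtain ⟨h1, h2⟩ := Finset.mem_Ico.1 ha
    rw [weightedSq_const_mul, hρ]
    refine mul_le_mul_of_nonneg_left ((weightedSq_conv_le hs _ _ _).trans ?_) (sq_nonneg _)
    refine mul_le_mul_of_nonneg_left ?_ (convConst_nonneg s)
    exact mul_le_mul (hc a h2 S h hρ u v hdata) (hc (m - a) (by omega) S h hρ u v hdata)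
      (weightedSq_nonneg _ _ _) (hc0 a h2)

end Scheme

/-! ### The reflection `(j, k) ↦ (-j, -k)` -/

/-- The mode `-j`, taken modulo `2M` in `{-M, …, M-1}`. -/
def reflect (M : ℕ) (j : ℤ) : ℤ := Int.bmod (-j) (2 * M)

theorem bmod_mem_modes {M : ℕ} (hM : 0 < M) (j : ℤ) : Int.bmod j (2 * M) ∈ modes M := by
  have h1 := Int.le_bmod (x := j) (m := 2 * M) (by omega)
  have h2 := Int.bmod_lt (x := j) (m := 2 * M) (by omega)
  rw [modes, Finset.mem_Ico]
  push_cast at h1 h2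
  omega

theorem modEq_bmod (M : ℕ) (j : ℤ) : Int.bmod j (2 * M) ≡ j [ZMOD 2 * (M : ℤ)] := by
  have := Int.bmod_emod (x := j) (m := 2 * M)
  push_cast at this
  exact this

theorem natAbs_bmod_neg {M : ℕ} (hM : 0 < M) (j : ℤ) :
    (Int.bmod (-j) (2 * M)).natAbs = (Int.bmod j (2 * M)).natAbs := by
  have key : ∀ i : ℤ, (Int.bmod (-i) (2 * M)).natAbs ≤ (Int.bmod i (2 * M)).natAbs := fun i => by
    rw [← Int.natAbs_neg (Int.bmod i (2 * M))]
    refine natAbs_le_of_modEq (bmod_mem_modes hM _) ?_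
    exact (modEq_bmod M i).neg.trans (modEq_bmod M (-i)).symm
  refine le_antisymm (key j) ?_
  have := key (-j)
  rwa [neg_neg] at this

theorem unitVec_eq_of_natAbs_eq (M : ℕ) {i j : ℤ} (h : i.natAbs = j.natAbs) :
    unitVec M i = unitVec M j := by
  unfold unitVec
  rw [h]

theorem reflect_mem {M : ℕ} (hM : 0 < M) (j : ℤ) : reflect M j ∈ modes M := bmod_mem_modes hM _

theorem natAbs_reflect {M : ℕ} (hM : 0 < M) {j : ℤ} (hj : j ∈ modes M) :
    (reflect M j).natAbs = j.natAbs := by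
  rw [reflect, natAbs_bmod_neg hM, bmod_of_mem_modes hj]

theorem reflect_reflect {M : ℕ} (hM : 0 < M) {j : ℤ} (hj : j ∈ modes M) :
    reflect M (reflect M j) = j := by
  refine eq_of_modEq (reflect_mem hM _) hj ((modEq_bmod M _).trans ?_)
  have := (modEq_bmod M (-j)).neg
  rwa [neg_neg] at this

theorem mu_neg {M : ℕ} (K : ℕ) (k : Fin (M + 1) → ℤ) : mu K (-k) = mu K k := by simp [mu]

theorem order_neg_of_natAbs_eq {M : ℕ} (K : ℕ) {i j : ℤ} (h : i.natAbs = j.natAbs)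
    (k : Fin (M + 1) → ℤ) : order K i (-k) = order K j k := by
  simp [order, profile_eq_of_natAbs_eq K h]

/-- The shift r and the remainder of k change sign. The unit vector depends only on the modulus of
its mode, so reflection merely exchanges the two signs in the definition. -/
theorem neg_mem_indexSet_reflect {M K : ℕ} (hM : 0 < M) {j : ℤ} (hj : j ∈ modes M)
    {k : Fin (M + 1) → ℤ} (hk : k ∈ indexSet M K j) : -k ∈ indexSet M K (reflect M j) := by
  rcases hk with ⟨h1, h2⟩ | ⟨r, k', h1, h2, h3, h4⟩
  · left
    refine ⟨?_, fun l hl => by simp [h2 l hl]⟩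
    rw [mu_neg, natAbs_reflect hM hj]
    exact h1
  · right
    have e : (Int.bmod (reflect M j - -r) (2 * M)).natAbs = (Int.bmod (j - r) (2 * M)).natAbs := by
      rw [← natAbs_bmod_neg hM (j - r)]
      congr 1
      refine eq_of_modEq (bmod_mem_modes hM _) (bmod_mem_modes hM _)
        ((modEq_bmod M _).trans (Int.ModEq.trans ?_ (modEq_bmod M _).symm))
      rw [show reflect M j - -r = reflect M j + r by ring, show -(j - r) = -j + r by ring]
      exact (modEq_bmod M (-j)).add_right r
    refine ⟨-r, -k', by rw [e]; exact h1, by simpa using h2, by rw [mu_neg]; exact h3, ?_⟩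
    rw [unitVec_eq_of_natAbs_eq M e]
    rcases h4 with rfl | rfl
    · right
      abel
    · left
      abel

theorem mem_indices {M K : ℕ} {j : ℤ} {k : Fin (M + 1) → ℤ} :
    k ∈ indices M K j ↔ k ∈ indexSet M K j := Set.Finite.mem_toFinset _

theorem sum_indices_reflect {β : Type*} [AddCommMonoid β] {M K : ℕ} (hM : 0 < M) {j : ℤ}
    (hj : j ∈ modes M) (f : (Fin (M + 1) → ℤ) → β) :
    ∑ k ∈ indices M K j, f (-k) = ∑ k ∈ indices M K (reflect M j), f k := by
  refine Finset.sum_nbij' (fun k => -k) (fun k => -k) (fun k hk => ?_) (fun k hk => ?_)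
    (fun k _ => neg_neg k) (fun k _ => neg_neg k) (fun k _ => rfl)
  · exact mem_indices.2 (neg_mem_indexSet_reflect hM hj (mem_indices.1 hk))
  · have := neg_mem_indexSet_reflect hM (reflect_mem hM j) (mem_indices.1 hk)
    rw [reflect_reflect hM hj] at this
    exact mem_indices.2 this

theorem sum_modes_reflect {β : Type*} [AddCommMonoid β] {M : ℕ} (hM : 0 < M) (f : ℤ → β) :
    ∑ j ∈ modes M, f (reflect M j) = ∑ j ∈ modes M, f j :=
  Finset.sum_nbij' (reflect M) (reflect M) (fun j _ => reflect_mem hM j)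
    (fun j _ => reflect_mem hM j) (fun _ hj => reflect_reflect hM hj)
    (fun _ hj => reflect_reflect hM hj) (fun _ _ => rfl)

theorem sum_reflect {β : Type*} [AddCommMonoid β] {M K : ℕ} (hM : 0 < M)
    (f : ℤ → (Fin (M + 1) → ℤ) → β) :
    ∑ j ∈ modes M, ∑ k ∈ indices M K j, f (reflect M j) (-k) =
      ∑ j ∈ modes M, ∑ k ∈ indices M K j, f j k := by
  rw [← sum_modes_reflect hM fun j => ∑ k ∈ indices M K j, f j k]
  exact Finset.sum_congr rfl fun j hj => sum_indices_reflect hM hj (f (reflect M j))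

theorem weightedSq_reflect (s : ℝ) {M : ℕ} (hM : 0 < M) (f : ℤ → ℝ) :
    weightedSq s M (fun j => f (reflect M j)) = weightedSq s M f := by
  unfold weightedSq
  rw [← sum_modes_reflect hM fun j => weight s j * f j ^ 2]
  exact Finset.sum_congr rfl fun j hj => by
    rw [weight_eq_of_natAbs_eq s (natAbs_reflect hM hj)]

/-! ### Support and length of the index vectors -/

theorem natAbs_unitVec_le (M : ℕ) (j : ℤ) (l : Fin (M + 1)) : (unitVec M j l).natAbs ≤ 1 := by
  unfold unitVec
  split_ifs <;> simp

theorem sum_natAbs_le_mu {M K : ℕ} (hK : 0 < K) (k : Fin (M + 1) → ℤ) :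
    ∑ l, (k l).natAbs ≤ mu K k :=
  Finset.sum_le_sum fun _ _ => Nat.le_mul_of_pos_right _ (profile_pos hK _)

theorem sum_natAbs_unitVec_le (M : ℕ) (j : ℤ) : ∑ l, (unitVec M j l).natAbs ≤ 1 := by
  by_cases hj : j.natAbs ≤ M
  · rw [Finset.sum_eq_single (⟨j.natAbs, by omega⟩ : Fin (M + 1))]
    · exact natAbs_unitVec_le _ _ _
    · intro l _ hl
      have : (l : ℕ) ≠ j.natAbs := fun e => hl (Fin.ext e)
      simp [unitVec, this]
    · simp
  · rw [Finset.sum_eq_zero]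
    · exact zero_le_one
    · intro l _
      have : (l : ℕ) ≠ j.natAbs := by have := l.2; omega
      simp [unitVec, this]

/-- With this bound the sum over l in the theorem costs a factor 2K instead of one depending on M.
-/
theorem sum_natAbs_le_of_mem {M K : ℕ} (hK : 0 < K) {j : ℤ} {k : Fin (M + 1) → ℤ}
    (hk : k ∈ indexSet M K j) : ∑ l, (k l).natAbs ≤ 2 * K := by
  rcases hk with ⟨h1, -⟩ | ⟨r, k', -, -, h3, h4⟩
  · have := sum_natAbs_le_mu hK k
    omega
  · have e1 := sum_natAbs_le_mu hK k'
    have e2 := sum_natAbs_unitVec_le M (Int.bmod (j - r) (2 * M))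
    have e3 : ∑ l, (k l).natAbs ≤
        ∑ l, ((unitVec M (Int.bmod (j - r) (2 * M)) l).natAbs + (k' l).natAbs) := by
      refine Finset.sum_le_sum fun l _ => ?_
      rcases h4 with rfl | rfl <;> simp only [Pi.add_apply, Pi.neg_apply] <;> omega
    rw [Finset.sum_add_distrib] at e3
    omega

theorem lt_of_mu_lt {M K : ℕ} {k : Fin (M + 1) → ℤ} (hk : mu K k < K) {l : Fin (M + 1)}
    (hl : k l ≠ 0) : (l : ℕ) < K := by
  by_contra hlK
  have h1 : (k l).natAbs * profile K ((l : ℕ) : ℤ) ≤ mu K k :=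
    Finset.single_le_sum (f := fun l : Fin (M + 1) => (k l).natAbs * profile K ((l : ℕ) : ℤ))
      (fun _ _ => Nat.zero_le _) (Finset.mem_univ l)
  have h2 : profile K ((l : ℕ) : ℤ) = K := by
    unfold profile
    rw [Int.natAbs_natCast]
    split_ifs <;> omega
  rw [h2] at h1
  have h3 : 1 * K ≤ (k l).natAbs * K := Nat.mul_le_mul_right K (by omega)
  omega

/-- An active entry is either below K or equals |(j - r) mod 2M| ≤ |j| + |r|. This allows the weight
and frequency of l to be compared with those of j. -/
theorem le_natAbs_add_of_mem {M K : ℕ} (hM : 0 < M) {j : ℤ} {k : Fin (M + 1) → ℤ}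
    (hk : k ∈ indexSet M K j) {l : Fin (M + 1)} (hl : k l ≠ 0) : (l : ℕ) ≤ j.natAbs + K := by
  rcases hk with ⟨-, h2⟩ | ⟨r, k', -, h2, h3, h4⟩
  · by_contra h
    exact hl (h2 l (by omega))
  · by_cases hk' : k' l = 0
    · have e1 : (l : ℕ) = (Int.bmod (j - r) (2 * M)).natAbs := by
        by_contra h
        rcases h4 with rfl | rfl <;> simp [unitVec, h, hk'] at hl
      have e2 := natAbs_le_of_modEq (bmod_mem_modes hM (j - r)) (modEq_bmod M (j - r)).symm
      omega
    · have := lt_of_mu_lt h3 hk'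
      omega

/-! ### Estimate of the almost-invariant energies. -/

namespace Scheme

theorem natDegree_modFun_le {S : Scheme} (hK : 0 < S.K) (u v : ℤ → ℂ) (j : ℤ) (k : S.Vec) :
    (S.modFun u v j k).natDegree ≤ 4 * S.K := by
  unfold modFun
  refine (natDegree_C_mul_le _ _).trans (natDegree_sum_le_of_forall_le _ _ fun m hm =>
    (natDegree_C_mul_le _ _).trans ((natDegree_modCoeff_le hK u v m j k).trans ?_))
  have := (Finset.mem_Icc.1 hm).2
  omega

/-- The size of the rescaled modulation function `δ^{-m(j,k)} z_j^k`. -/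
def rescaledSize (S : Scheme) (u v : ℤ → ℂ) (j : ℤ) (k : S.Vec) : ℝ :=
  ∑ m ∈ Finset.range (2 * S.K), S.size j k (S.modCoeff u v m j k)

theorem size_C_mul (S : Scheme) (j : ℤ) (k : S.Vec) (c : ℂ) (p : ℂ[X]) :
    S.size j k (C c * p) = ‖c‖ * S.size j k p := by
  unfold size
  rw [derivative_C_mul, coeffNorm_C_mul, coeffNorm_C_mul]
  ring

namespace Regime

variable {S : Scheme} {γ B : ℝ}

theorem M_pos (h : S.Regime γ B) : 0 < S.M := by
  have := h.three_le
  have := h.K_le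
  omega

theorem size_add_le (h : S.Regime γ B) (j : ℤ) (k : S.Vec) (p q : ℂ[X]) :
    S.size j k (p + q) ≤ S.size j k p + S.size j k q := by
  have h1 := h.ω_pos j
  have h2 := h.τ_pos
  have h3 : 0 ≤ S.absSinc j := abs_nonneg _
  have e1 := coeffNorm_add_le p q
  have e2 := coeffNorm_add_le (derivative p) (derivative q)
  rw [← derivative_add] at e2
  unfold size
  calc _ ≤ (S.ω j + |S.s2 k| / (S.τ * S.absSinc j)) * (coeffNorm p + coeffNorm q) +
        (coeffNorm (derivative p) + coeffNorm (derivative q)) / S.absSinc j := by gcongr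
    _ = _ := by ring

theorem size_sum_le (h : S.Regime γ B) (j : ℤ) (k : S.Vec) {ι : Type*} (t : Finset ι)
    (f : ι → ℂ[X]) : S.size j k (∑ i ∈ t, f i) ≤ ∑ i ∈ t, S.size j k (f i) := by
  classical
  induction t using Finset.induction_on with
  | empty => simp [size_zero]
  | insert a t ha ih =>
    rw [Finset.sum_insert ha, Finset.sum_insert ha]
    exact (h.size_add_le _ _ _ _).trans (add_le_add le_rfl ih)

/-- Since ν < 1/2, the powers of δ in front of the terms with m > m(j,k) are at most 1, and only
δ^{m(j,k)} has to be kept. -/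
theorem size_modFun_le (h : S.Regime γ B) (u v : ℤ → ℂ) (j : ℤ) (k : S.Vec) :
    S.size j k (S.modFun u v j k) ≤ S.δ ^ S.ord j k * S.rescaledSize u v j k := by
  have hδ := h.δ_pos
  unfold modFun rescaledSize
  rw [size_C_mul, Complex.norm_real, Real.norm_of_nonneg (by positivity)]
  refine mul_le_mul_of_nonneg_left ((h.size_sum_le _ _ _ _).trans ?_) (by positivity)
  refine (Finset.sum_le_sum (g := fun m => S.size j k (S.modCoeff u v m j k)) fun m hm => ?_).trans
    (Finset.sum_le_sum_of_subset_of_nonneg (fun m hm => ?_) fun _ _ _ => h.size_nonneg j k _)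
  · rw [size_C_mul, Complex.norm_real, Real.norm_of_nonneg (Real.rpow_nonneg hδ.le _)]
    refine mul_le_of_le_one_left (h.size_nonneg j k _) (h.δ_rpow_le_one (mul_nonneg ?_ ?_))
    · have : (S.ord j k : ℝ) ≤ m := by exact_mod_cast (Finset.mem_Icc.1 hm).1
      linarith
    · have := h.ν_lt
      linarith
  · have := (Finset.mem_Icc.1 hm).2
    have := h.three_le
    exact Finset.mem_range.2 (by omega)

theorem rescaledSize_nonneg (h : S.Regime γ B) (u v : ℤ → ℂ) (j : ℤ) (k : S.Vec) :
    0 ≤ S.rescaledSize u v j k :=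
  Finset.sum_nonneg fun _ _ => h.size_nonneg j k _

/-- The factor τ|sinc(τω_j)| on the right cancels the prefactor in ℰ_l. The sine term uses the
second weight of `size`, the difference its derivative term. -/
theorem norm_eval_shift_le (h : S.Regime γ B) {j : ℤ} (hj : j ∈ modes S.M) (k : S.Vec) {p : ℂ[X]}
    {D : ℕ} (hdeg : p.natDegree ≤ D) {R : ℝ} (hR1 : 1 ≤ R) {x y : ℂ} (hxR : ‖x‖ ≤ R)
    (hyR : ‖y‖ ≤ R) (hyx : ‖y - x‖ = S.slow * S.τ) :
    ‖((Real.sin (dotFreq S.ρ k * S.τ) : ℝ) : ℂ) * Complex.I * p.eval x +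
      Complex.exp (Complex.I * ((dotFreq S.ρ k * S.τ : ℝ) : ℂ)) * (p.eval y - p.eval x)‖ ≤
      S.τ * S.absSinc j * (R ^ D * S.size j k p) := by
  have hτ := h.τ_pos
  have hσ := h.absSinc_pos hj
  have hω := h.ω_pos j
  have e2 := norm_eval_le hdeg hR1 hxR
  have e3 := norm_eval_sub_eval_le hdeg hR1 hyR hxR
  rw [hyx] at e3
  have e5 : ‖((Real.sin (dotFreq S.ρ k * S.τ) : ℝ) : ℂ)‖ = |S.s2 k| := by
    rw [Complex.norm_real, Real.norm_eq_abs, mul_comm, s2]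
  have e6 : ‖Complex.exp (Complex.I * ((dotFreq S.ρ k * S.τ : ℝ) : ℂ))‖ = 1 := by
    rw [mul_comm, Complex.norm_exp_ofReal_mul_I]
  have n1 := coeffNorm_nonneg p
  have n3 := coeffNorm_nonneg (derivative p)
  have n4 : S.slow * S.τ ≤ S.τ := mul_le_of_le_one_left hτ.le h.slow_le
  refine (norm_add_le _ _).trans ?_
  rw [norm_mul, norm_mul, norm_mul, e5, e6, Complex.norm_I, mul_one, one_mul]
  calc _ ≤ |S.s2 k| * (R ^ D * coeffNorm p) + S.τ * (R ^ D * coeffNorm (derivative p)) :=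
        add_le_add (by gcongr) (e3.trans (by gcongr))
    _ = S.τ * S.absSinc j * (R ^ D * (|S.s2 k| / (S.τ * S.absSinc j) * coeffNorm p +
          coeffNorm (derivative p) / S.absSinc j)) := by
        field_simp
    _ ≤ _ := by
        unfold size
        gcongr
        linarith [mul_nonneg hω.le n1]

/-- The contribution of `(j, k)` to the almost-invariant energy `ℰ_l`, after removal of the part
that is antisymmetric under `(j, k) ↦ (-j, -k)`. -/
theorem norm_almostInvariant_le (h : S.Regime γ B) (u v : ℤ → ℂ) (l : Fin (S.M + 1)) {t : ℝ}
    (ht0 : 0 ≤ t) (ht1 : t ≤ 1) :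
    ‖S.almostInvariant u v l t‖ ≤ (1 + γ⁻¹) ^ (4 * S.K) * (1 + γ⁻¹) ^ (4 * S.K) *
      ∑ j ∈ modes S.M, ∑ k ∈ indices S.M S.K j,
        |(k l : ℝ)| * (S.ω ((l : ℕ) : ℤ) * coeffNorm (S.modFun u v (reflect S.M j) (-k))) *
          S.size j k (S.modFun u v j k) := by
  have hK : 0 < S.K := by have := h.three_le; omega
  have hM := h.M_pos
  have hτ := h.τ_pos
  have hd := h.slow_pos
  have hγi := h.one_le_inv
  have hτγ := h.τ_le
  have hl := h.ω_pos ((l : ℕ) : ℤ)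
  -- Both slow times lie within modulus 1 + γ⁻¹, because t ≤ 1, τ ≤ γ⁻¹ and δ^ν ≤ 1.
  obtain ⟨R, hR⟩ : ∃ R, R = 1 + γ⁻¹ := ⟨_, rfl⟩
  have hR1 : 1 ≤ R := by rw [hR]; linarith
  rw [← hR]
  set x : ℂ := ((S.ε ^ (S.ν / 2) * t : ℝ) : ℂ) with hx
  set y : ℂ := ((S.ε ^ (S.ν / 2) * (t + S.τ) : ℝ) : ℂ) with hy
  have hxR : ‖x‖ ≤ R := by
    rw [hx, h.rpow_half, Complex.norm_real, Real.norm_of_nonneg (by positivity)]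
    have := mul_le_one₀ h.slow_le ht0 ht1
    linarith
  have hyR : ‖y‖ ≤ R := by
    rw [hy, h.rpow_half, Complex.norm_real, Real.norm_of_nonneg (by positivity), hR]
    calc S.slow * (t + S.τ) ≤ 1 * (1 + γ⁻¹) := by
          gcongr
          exact h.slow_le
      _ = _ := one_mul _
  have hyx : ‖y - x‖ = S.slow * S.τ := by
    rw [hx, hy, h.rpow_half, ← Complex.ofReal_sub, Complex.norm_real,
      show S.slow * (t + S.τ) - S.slow * t = S.slow * S.τ by ring,
      Real.norm_of_nonneg (by positivity)]
  let κ : ℤ → S.Vec → ℝ := fun j k =>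
    (k l : ℝ) * S.ω ((l : ℕ) : ℤ) / (S.τ * Real.sinc (S.τ * S.ω j))
  let P : ℤ → S.Vec → ℂ[X] := S.modFun u v
  let F : ℤ → S.Vec → ℂ := fun j k => (κ j k : ℂ) * (P (reflect S.M j) (-k)).eval x *
    ((Real.cos (dotFreq S.ρ k * S.τ) : ℝ) : ℂ) * (P j k).eval x
  let G : ℤ → S.Vec → ℂ := fun j k => (κ j k : ℂ) * (P (reflect S.M j) (-k)).eval x *
    (((Real.sin (dotFreq S.ρ k * S.τ) : ℝ) : ℂ) * Complex.I * (P j k).eval x +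
      Complex.exp (Complex.I * ((dotFreq S.ρ k * S.τ : ℝ) : ℂ)) *
        ((P j k).eval y - (P j k).eval x))
  -- With θ = (k·ω)τ, e^{iθ}z(y) = cos θ z(x) + [i sin θ z(x) + e^{iθ}(z(y) - z(x))]: `F` collects
  -- the cosine terms and `G` the bracket.
  have hsplit : S.almostInvariant u v l t = -(Complex.I / 2) *
      (∑ j ∈ modes S.M, ∑ k ∈ indices S.M S.K j, F j k +
        ∑ j ∈ modes S.M, ∑ k ∈ indices S.M S.K j, G j k) := by
    rw [← Finset.sum_add_distrib]
    simp_rw [← Finset.sum_add_distrib]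
    unfold almostInvariant
    congr 1
    refine Finset.sum_congr rfl fun j _ => Finset.sum_congr rfl fun k _ => ?_
    have e : Complex.exp (Complex.I * ((dotFreq S.ρ k * S.τ : ℝ) : ℂ)) =
        ((Real.cos (dotFreq S.ρ k * S.τ) : ℝ) : ℂ) +
          ((Real.sin (dotFreq S.ρ k * S.τ) : ℝ) : ℂ) * Complex.I := by
      rw [mul_comm, Complex.exp_mul_I, Complex.ofReal_cos, Complex.ofReal_sin]
    simp only [F, G, κ, P, reflect, e]
    ring
  -- Reflection swaps the two modulation functions and fixes the cosine and the sinc, but reverses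
  -- the sign of k_l. The sum thus equals its own negative.
  have hF : ∑ j ∈ modes S.M, ∑ k ∈ indices S.M S.K j, F j k = 0 := by
    have h1 := sum_reflect (K := S.K) hM F
    have h2 : ∑ j ∈ modes S.M, ∑ k ∈ indices S.M S.K j, F (reflect S.M j) (-k) =
        -∑ j ∈ modes S.M, ∑ k ∈ indices S.M S.K j, F j k := by
      simp_rw [← Finset.sum_neg_distrib]
      refine Finset.sum_congr rfl fun j hj => Finset.sum_congr rfl fun k _ => ?_
      have e : S.ω (reflect S.M j) = S.ω j := freq_eq_of_natAbs_eq _ (natAbs_reflect hM hj)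
      simp only [F, κ, reflect_reflect hM hj, neg_neg, dotFreq_neg, e, Pi.neg_apply, neg_mul,
        Real.cos_neg]
      push_cast
      ring
    rw [h2] at h1
    exact self_eq_neg.1 h1.symm
  have hG : ∀ j ∈ modes S.M, ∀ k ∈ indices S.M S.K j, ‖G j k‖ ≤
      R ^ (4 * S.K) * R ^ (4 * S.K) * (|(k l : ℝ)| *
        (S.ω ((l : ℕ) : ℤ) * coeffNorm (P (reflect S.M j) (-k))) * S.size j k (P j k)) := by
    intro j hj k _
    have hσ := h.absSinc_pos hj
    have hω := h.ω_pos j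
    have e1 : ‖(P (reflect S.M j) (-k)).eval x‖ ≤
        R ^ (4 * S.K) * coeffNorm (P (reflect S.M j) (-k)) :=
      norm_eval_le (natDegree_modFun_le hK u v _ _) hR1 hxR
    have e4 : ‖((κ j k : ℝ) : ℂ)‖ = |(k l : ℝ)| * S.ω ((l : ℕ) : ℤ) / (S.τ * S.absSinc j) := by
      rw [Complex.norm_real, Real.norm_eq_abs, abs_div, abs_mul, abs_mul, abs_of_pos hl,
        abs_of_pos hτ]
      rfl
    have e7 := h.norm_eval_shift_le hj k (natDegree_modFun_le hK u v j k) hR1 hxR hyR hyx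
    have n2 := coeffNorm_nonneg (P (reflect S.M j) (-k))
    simp only [G]
    rw [norm_mul, norm_mul, e4]
    calc _ ≤ |(k l : ℝ)| * S.ω ((l : ℕ) : ℤ) / (S.τ * S.absSinc j) *
          (R ^ (4 * S.K) * coeffNorm (P (reflect S.M j) (-k))) *
            (S.τ * S.absSinc j * (R ^ (4 * S.K) * S.size j k (P j k))) := by gcongr
      _ = _ := by field_simp
  rw [hsplit, hF, zero_add, norm_mul]
  have hI : ‖-(Complex.I / 2)‖ ≤ 1 := by
    rw [norm_neg, norm_div, Complex.norm_I, Complex.norm_ofNat]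
    norm_num
  refine (mul_le_of_le_one_left (norm_nonneg _) hI).trans ?_
  rw [Finset.mul_sum]
  refine (norm_sum_le _ _).trans (Finset.sum_le_sum fun j hj => ?_)
  rw [Finset.mul_sum]
  exact (norm_sum_le _ _).trans (Finset.sum_le_sum fun k hk => hG j hj k hk)

theorem weighted_summand_le (h : S.Regime γ B) (u v : ℤ → ℂ) {s : ℝ} (hs : 0 ≤ s)
    {j : ℤ} (hj : j ∈ modes S.M) {k : S.Vec} (hk : k ∈ indices S.M S.K j) (l : Fin (S.M + 1)) :
    weight s ((l : ℕ) : ℤ) * S.ε ^ (-(profile S.K ((l : ℕ) : ℤ) : ℤ)) *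
      (|(k l : ℝ)| * (S.ω ((l : ℕ) : ℤ) * coeffNorm (S.modFun u v (reflect S.M j) (-k))) *
        S.size j k (S.modFun u v j k)) ≤
      ((S.K : ℝ) + 1) ^ (2 * s) * freqConst S.ρ S.K * (((k l).natAbs : ℝ) * (weight s j *
        (S.rescaledSize u v (reflect S.M j) (-k) * S.rescaledSize u v j k))) := by
  have hM := h.M_pos
  have hε := h.ε_pos
  have hδ := h.δ_pos
  have hw := weight_nonneg s j
  have hf : 0 ≤ freqConst S.ρ S.K := Real.sqrt_nonneg _
  have r1 := h.rescaledSize_nonneg u v (reflect S.M j) (-k)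
  have r2 := h.rescaledSize_nonneg u v j k
  rcases eq_or_ne (k l) 0 with h0 | h0
  · simp [h0]
  have hle := le_natAbs_add_of_mem hM (mem_indices.1 hk) h0
  have e1 : weight s ((l : ℕ) : ℤ) ≤ ((S.K : ℝ) + 1) ^ (2 * s) * weight s j :=
    weight_le_of_natAbs_le_add hs (by simpa using hle)
  have e2 : S.ω ((l : ℕ) : ℤ) ≤ freqConst S.ρ S.K * S.ω (reflect S.M j) :=
    freq_le_of_natAbs_le_add h.ρ_pos (by simpa [natAbs_reflect hM hj] using hle)
  have hord : S.ord (reflect S.M j) (-k) = S.ord j k :=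
    order_neg_of_natAbs_eq S.K (natAbs_reflect hM hj) k
  have e3 : S.ω ((l : ℕ) : ℤ) * coeffNorm (S.modFun u v (reflect S.M j) (-k)) ≤
      freqConst S.ρ S.K * (S.δ ^ S.ord j k * S.rescaledSize u v (reflect S.M j) (-k)) := by
    have n := coeffNorm_nonneg (S.modFun u v (reflect S.M j) (-k))
    calc _ ≤ freqConst S.ρ S.K * S.ω (reflect S.M j) *
          coeffNorm (S.modFun u v (reflect S.M j) (-k)) := by gcongr
      _ = freqConst S.ρ S.K * (S.ω (reflect S.M j) *
          coeffNorm (S.modFun u v (reflect S.M j) (-k))) := by ring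
      _ ≤ _ := by
          rw [← hord]
          exact mul_le_mul_of_nonneg_left
            ((h.ω_mul_coeffNorm_le_size _ _ _).trans (h.size_modFun_le u v _ _)) hf
  have e4 := h.size_modFun_le u v j k
  -- The two factors δ^{m(j,k)} multiply to ε^{m(j,k)}, and e(l) ≤ m(j,k) because k_l ≠ 0.
  have e5 : S.ε ^ (-(profile S.K ((l : ℕ) : ℤ) : ℤ)) * (S.δ ^ S.ord j k * S.δ ^ S.ord j k) ≤ 1 := by
    have hp : profile S.K ((l : ℕ) : ℤ) ≤ S.ord j k := profile_le_order_of_ne_zero S.K j h0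
    have : S.δ ^ S.ord j k * S.δ ^ S.ord j k = S.ε ^ S.ord j k := by
      rw [← mul_pow, δ, Real.mul_self_sqrt hε.le]
    rw [this, zpow_neg, zpow_natCast, inv_mul_le_one₀ (by positivity)]
    exact pow_le_pow_of_le_one hε.le h.ε_le hp
  have e6 : |(k l : ℝ)| = ((k l).natAbs : ℝ) := abs_cast_eq_natAbs _
  have n0 := h.size_nonneg j k (S.modFun u v j k)
  have n1 := coeffNorm_nonneg (S.modFun u v (reflect S.M j) (-k))
  have z : 0 ≤ S.ε ^ (-(profile S.K ((l : ℕ) : ℤ) : ℤ)) := by positivity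
  have hω := h.ω_pos ((l : ℕ) : ℤ)
  rw [e6]
  calc _ ≤ (((S.K : ℝ) + 1) ^ (2 * s) * weight s j) *
        S.ε ^ (-(profile S.K ((l : ℕ) : ℤ) : ℤ)) * (((k l).natAbs : ℝ) *
        (freqConst S.ρ S.K * (S.δ ^ S.ord j k * S.rescaledSize u v (reflect S.M j) (-k))) *
          (S.δ ^ S.ord j k * S.rescaledSize u v j k)) := by gcongr
    _ = ((S.K : ℝ) + 1) ^ (2 * s) * freqConst S.ρ S.K * (((k l).natAbs : ℝ) * (weight s j *
        (S.rescaledSize u v (reflect S.M j) (-k) * S.rescaledSize u v j k))) *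
        (S.ε ^ (-(profile S.K ((l : ℕ) : ℤ) : ℤ)) * (S.δ ^ S.ord j k * S.δ ^ S.ord j k)) := by
        ring
    _ ≤ _ := mul_le_of_le_one_right (by positivity) e5

theorem sum_rescaledSize (u v : ℤ → ℂ) (j : ℤ) :
    ∑ k ∈ indices S.M S.K j, S.rescaledSize u v j k =
      ∑ m ∈ Finset.range (2 * S.K), S.modeSize u v m j :=
  Finset.sum_comm

/-- The sum over k pairs k only with -k. Bounding one factor by its full sum over k gives a product
of mode sizes at j and at its reflection, and the weighted norm is invariant under reflection. -/
theorem sum_weight_rescaledSize_le (h : S.Regime γ B) (u v : ℤ → ℂ) (s : ℝ) :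
    ∑ j ∈ modes S.M, ∑ k ∈ indices S.M S.K j, (((∑ l, (k l).natAbs : ℕ) : ℝ) * (weight s j *
        (S.rescaledSize u v (reflect S.M j) (-k) * S.rescaledSize u v j k))) ≤
      2 * S.K * (2 *
        weightedSq s S.M fun j => ∑ m ∈ Finset.range (2 * S.K), S.modeSize u v m j) := by
  have hK : 0 < S.K := by have := h.three_le; omega
  have hM := h.M_pos
  have hpoint : ∀ j ∈ modes S.M, ∑ k ∈ indices S.M S.K j,
      (((∑ l, (k l).natAbs : ℕ) : ℝ) * (weight s j *
        (S.rescaledSize u v (reflect S.M j) (-k) * S.rescaledSize u v j k))) ≤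
      2 * S.K * (weight s j * ((∑ m ∈ Finset.range (2 * S.K), S.modeSize u v m (reflect S.M j)) *
        ∑ m ∈ Finset.range (2 * S.K), S.modeSize u v m j)) := by
    intro j hj
    rw [← sum_rescaledSize, ← sum_rescaledSize,
      ← sum_indices_reflect hM hj (S.rescaledSize u v (reflect S.M j)), Finset.sum_mul,
      Finset.mul_sum, Finset.mul_sum]
    refine Finset.sum_le_sum fun k hk => ?_
    have r1 := h.rescaledSize_nonneg u v (reflect S.M j) (-k)
    have r2 := h.rescaledSize_nonneg u v j k
    have hw := weight_nonneg s j
    have c1 : ((∑ l, (k l).natAbs : ℕ) : ℝ) ≤ 2 * S.K := by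
      exact_mod_cast sum_natAbs_le_of_mem hK (mem_indices.1 hk)
    have c2 : S.rescaledSize u v j k ≤ ∑ k ∈ indices S.M S.K j, S.rescaledSize u v j k :=
      Finset.single_le_sum (fun k _ => h.rescaledSize_nonneg u v j k) hk
    exact mul_le_mul c1 (mul_le_mul_of_nonneg_left (mul_le_mul_of_nonneg_left c2 r1) hw)
      (mul_nonneg hw (mul_nonneg r1 r2)) (by positivity)
  generalize hf : (fun j => ∑ m ∈ Finset.range (2 * S.K), S.modeSize u v m j) = f
  have hf' : ∀ j, ∑ m ∈ Finset.range (2 * S.K), S.modeSize u v m j = f j := fun j => by rw [← hf]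
  simp_rw [hf'] at hpoint
  calc _ ≤ ∑ j ∈ modes S.M, 2 * S.K * (weight s j * (f (reflect S.M j) * f j)) :=
        Finset.sum_le_sum hpoint
    _ = 2 * S.K * ∑ j ∈ modes S.M, weight s j * (f (reflect S.M j) * f j) := by
        rw [Finset.mul_sum]
    _ ≤ 2 * S.K * (weightedSq s S.M (fun j => f (reflect S.M j)) + weightedSq s S.M f) :=
        mul_le_mul_of_nonneg_left (sum_weight_mul_le s S.M _ _) (by positivity)
    _ = _ := by rw [weightedSq_reflect s hM f, two_mul (weightedSq s S.M f)]

theorem sum_weight_almostInvariant_le (h : S.Regime γ B) (u v : ℤ → ℂ) {s : ℝ} (hs : 0 ≤ s)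
    {t : ℝ} (ht0 : 0 ≤ t) (ht1 : t ≤ 1) :
    ∑ l : Fin (S.M + 1), weight s ((l : ℕ) : ℤ) *
        S.ε ^ (-(profile S.K ((l : ℕ) : ℤ) : ℤ)) * ‖S.almostInvariant u v l t‖ ≤
      (1 + γ⁻¹) ^ (4 * S.K) * (1 + γ⁻¹) ^ (4 * S.K) *
        (((S.K : ℝ) + 1) ^ (2 * s) * freqConst S.ρ S.K * (2 * S.K * (2 *
          weightedSq s S.M fun j => ∑ m ∈ Finset.range (2 * S.K), S.modeSize u v m j))) := by
  have hγi := h.one_le_inv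
  have hε := h.ε_pos
  have hf : 0 ≤ freqConst S.ρ S.K := Real.sqrt_nonneg _
  have hA0 : 0 ≤ (1 + γ⁻¹) ^ (4 * S.K) * (1 + γ⁻¹) ^ (4 * S.K) := by positivity
  have hD0 : 0 ≤ ((S.K : ℝ) + 1) ^ (2 * s) * freqConst S.ρ S.K := by positivity
  have hE := fun l => h.norm_almostInvariant_le u v l ht0 ht1
  have hsummand := fun j hj k hk l => h.weighted_summand_le u v hs (j := j) hj (k := k) hk l
  generalize (1 + γ⁻¹) ^ (4 * S.K) * (1 + γ⁻¹) ^ (4 * S.K) = A at hA0 hE ⊢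
  generalize ((S.K : ℝ) + 1) ^ (2 * s) * freqConst S.ρ S.K = D at hD0 hsummand ⊢
  calc _ ≤ ∑ l : Fin (S.M + 1), A * ∑ j ∈ modes S.M, ∑ k ∈ indices S.M S.K j,
        D * (((k l).natAbs : ℝ) * (weight s j *
        (S.rescaledSize u v (reflect S.M j) (-k) * S.rescaledSize u v j k))) := by
        refine Finset.sum_le_sum fun l _ => ?_
        have z : 0 ≤ weight s ((l : ℕ) : ℤ) * S.ε ^ (-(profile S.K ((l : ℕ) : ℤ) : ℤ)) :=
          mul_nonneg (weight_nonneg _ _) (by positivity)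
        refine (mul_le_mul_of_nonneg_left (hE l) z).trans ?_
        rw [mul_left_comm, Finset.mul_sum]
        refine mul_le_mul_of_nonneg_left (Finset.sum_le_sum fun j hj => ?_) hA0
        rw [Finset.mul_sum]
        exact Finset.sum_le_sum fun k hk => hsummand j hj k hk l
    _ = A * (D * ∑ j ∈ modes S.M, ∑ k ∈ indices S.M S.K j,
        (((∑ l, (k l).natAbs : ℕ) : ℝ) * (weight s j *
        (S.rescaledSize u v (reflect S.M j) (-k) * S.rescaledSize u v j k)))) := by
        rw [← Finset.mul_sum, Finset.sum_comm, Finset.mul_sum (a := D)]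
        congr 1
        refine Finset.sum_congr rfl fun j _ => ?_
        rw [Finset.sum_comm, Finset.mul_sum]
        refine Finset.sum_congr rfl fun k _ => ?_
        rw [← Finset.mul_sum, ← Finset.sum_mul, Nat.cast_sum]
    _ ≤ _ := mul_le_mul_of_nonneg_left (mul_le_mul_of_nonneg_left
        (h.sum_weight_rescaledSize_le u v s) hD0) hA0

end Regime
end Scheme
end TrigInt
end

theorem theorem3 (K : ℕ) (hK : 3 ≤ K) (ν s ρ γ B C₀ : ℝ)
    (hν₀ : 0 ≤ ν) (hν₁ : ν < 1 / 2) (hs : 1 / 2 < s) (hρ : 0 < ρ)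
    (hγ₀ : 0 < γ) (hγ₁ : γ ≤ 1) :
    ∃ ε₀ : ℝ, 0 < ε₀ ∧ ∃ Cinv : ℝ, 0 < Cinv ∧
      ∀ (M : ℕ), K ≤ M → ∀ (τ ε : ℝ), 0 < τ → 0 < ε → ε ≤ ε₀ →
      ∀ (φ ψ : ℝ → ℝ), TrigInt.IsSymplecticFilter B φ ψ →
      TrigInt.NonResonant M K ρ ν γ ε τ →
      ∀ (u v : ℤ → ℂ), TrigInt.RealValued M u → TrigInt.RealValued M v →
      (∑ l : Fin (M + 1), TrigInt.weight s ((l : ℕ) : ℤ) *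
          ε ^ (-(TrigInt.profile K ((l : ℕ) : ℤ) : ℤ)) *
          TrigInt.modeEnergy ρ u v ((l : ℕ) : ℤ) ≤ C₀) →
      ∀ t : ℝ, 0 ≤ t → t ≤ 1 →
        ∑ l : Fin (M + 1), TrigInt.weight s ((l : ℕ) : ℤ) *
          ε ^ (-(TrigInt.profile K ((l : ℕ) : ℤ) : ℤ)) *
          ‖(TrigInt.Scheme.mk M K ρ ν ε τ φ ψ).almostInvariant u v l t‖ ≤ Cinv := by
  choose c hc0 hc using TrigInt.Scheme.exists_weightedSq_modeSize_le hs ρ γ B (8 * C₀)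
  -- No smallness of ε beyond ε ≤ 1 is needed; the maximum with 1 only ensures positivity of the
  -- constant.
  refine ⟨1, one_pos, max 1 ((1 + γ⁻¹) ^ (4 * K) * (1 + γ⁻¹) ^ (4 * K) *
    (((K : ℝ) + 1) ^ (2 * s) * TrigInt.freqConst ρ K * (2 * K * (2 *
      ((Finset.range (2 * K)).card * ∑ m ∈ Finset.range (2 * K), c m))))),
    lt_max_of_lt_left one_pos, ?_⟩
  intro M hM τ ε hτ hε hε1 φ ψ hfilter hnonres u v hu hv hdata t ht0 ht1
  have h : (TrigInt.Scheme.mk M K ρ ν ε τ φ ψ).Regime γ B :=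
    ⟨hK, hM, hτ, hε, hε1, hν₀, hν₁, hρ, hγ₀, hγ₁, hfilter, hnonres⟩
  have hsize := fun m => hc m _ h rfl u v (h.weightedSq_dataSize_le hu hv hdata)
  refine le_max_of_le_right ((h.sum_weight_almostInvariant_le u v (by linarith) ht0 ht1).trans ?_)
  have hf : 0 ≤ TrigInt.freqConst ρ K := Real.sqrt_nonneg _
  have hγi : 0 ≤ γ⁻¹ := inv_nonneg.2 hγ₀.le
  have key := (TrigInt.weightedSq_sum_le s M (Finset.range (2 * K))
    ((TrigInt.Scheme.mk M K ρ ν ε τ φ ψ).modeSize u v)).trans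
    (mul_le_mul_of_nonneg_left (Finset.sum_le_sum fun m _ => hsize m) (Nat.cast_nonneg _))
  gcongr
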